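/- **Setting.** Let $F_1,\dots,F_L\subset\mathbb R^3$ be closed planar polygonal fractures, each with a constant symmetric positive definite diffusion tensor $K_i$. Two different fractures are either disjoint or meet in a segment (a trace) $S_m=F_{i}\cap F_{j}$, $i<j$, of positive length; distinct traces $S_1,\dots,S_M$ have distance at least some $\gamma_0>0$. Let $\mathscr T_i$ be the set of (indices of) traces on $F_i$, $\Sigma_i=\bigcup_{m\in\mathscr T_i}S_m$, and let $\partial\Omega^D\subseteq\bigcup_i\partial F_i$ be the Dirichlet boundary, which meets each trace at most in its end points. $H^1_*(F_i)$ is the space of functions in $H^1(F_i)$ that vanish on $\partial F_i\cap\partial\Omega^D$. **Discretization.** Let $\mathcal T^i_\delta$ (conforming triangular meshes of $F_i$) and $\mathcal K^m_\delta$ (meshes of $S_m$) be shape regular and quasi-uniform, with mesh sizes $\delta_i\simeq\delta_m\simeq\delta$, and suppose that each $\mathcal K^m_\delta$ has at least one node outside $\partial\Omega^D$. Let $V_\delta=\prod_i\{v\in H^1_*(F_i): v|_T\in\mathbb P_1\ \forall T\in\mathcal T^i_\delta\}$, let $\Psi^m_\delta$ be the space of continuous functions on $S_m$ that are affine on each element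 of $\mathcal K_\delta^m$ and vanish on $S_m\cap\partial\Omega^D$, and let $\Psi_\delta=\prod_m\Psi_\delta^m$, $\Lambda_\delta=\prod_i\prod_{m\in\mathscr T_i}\Psi^m_\delta$. For $m\in\mathscr T_i$ let $F_{i,m}\subseteq F_i$ be meshed by a shape regular conforming triangular mesh $\widehat{\mathcal T}^{i,m}$ such that each element of $\mathcal K^m_\delta$ is an edge of $\widehat{\mathcal T}^{i,m}$ and the nodes of $\widehat{\mathcal T}^{i,m}$ interior to $F_{i,m}$ are exactly the nodes of $\mathcal K^m_\delta$ interior to $F_i$; for fixed $i$ the interiors of the $F_{i,m}$ are disjoint. Let $\widehat w^m_k$ be the nodal functions of $\widehat{\mathcal T}^{i,m}$ at the nodes of $\mathcal K^m_\delta$ not on $\partial\Omega^D$, extended by zero to $F_i$; it is assumed that $\widehat w_k^m\in H^1_*(F_i)$ and that it is continuous on $F_i$. Let $\widetilde w^m_k$ be the basis of $\Psi^m_\delta$ with $\int_{S_m}\widetilde w^m_k\widehat w^m_\ell=\delta_{k\ell}$. For functionals $f,g$ put $$[f,g]_{-1,i,\delta}=\sum_{m\in\mathscr T_i}\sum_{k,\ell}\delta\Big(\int_{S_m}\widetilde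 w^m_k\widetilde w^m_\ell\Big)\langle f,\widehat w^m_\ell\rangle\langle g,\widehat w^m_k\rangle .$$ With $\langle A_iu,v\rangle=\int_{F_i}K_i\nabla u\cdot\nabla v$, $\langle B_i^T\lambda,v\rangle=\sum_{m\in\mathscr T_i}\int_{S_m}\lambda^{i,m} v$, and a fixed $t\in\mathbb R$, define for $\alpha>0$ $$\mathfrak A(u,\lambda;v,\mu)=\sum_i\Big(\langle A_iu^i,v^i\rangle-\langle B_i^T\lambda^i,v^i\rangle+\langle B_i^T\mu^i,u^i\rangle+\alpha\,[A_iu^i-B_i^T\lambda^i,\;tA_iv^i-B_i^T\mu^i]_{-1,i,\delta}\Big),$$ $$\|u\|_{1,\delta}^2=\sum_i|u^i|_{1,F_i}^2+\sum_m|S_m|\Big|\frac1{|S_m|}\int_{S_m}(u^i-u^j)\Big|^2\quad(S_m=F_i\cap F_j,\ i<j),\qquad \|\lambda\|_{-1/2,\delta}^2=\sum_i\delta_i\|\lambda^i\|_{0,\Sigma_i}^2 ,$$ and say that $(u,\lambda)\in\ker\mathfrak B$ if $\sum_i\sum_{m\in\mathscr T_i}\int_{S_m}\lambda^{i,m}\psi^m=0$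 for all $\psi\in\Psi_\delta$. **Lemma.** There are constants $\alpha_0,C,c>0$, depending only on the network (with $K_i$ and $\partial\Omega^D$), on $t$, and on the constants of shape regularity, quasi-uniformity and comparability of the mesh sizes (not on the meshes, their size, or $\alpha$), such that for every discretization as above, every $0<\alpha<\alpha_0$ and all $(u_\delta,\lambda_\delta)\in V_\delta\times\Lambda_\delta$ there is $\mu_\delta\in\Lambda_\delta$ with $$\|\mu_\delta\|_{-1/2,\delta}\le C\big(\|u_\delta\|_{1,\delta}+\|\lambda_\delta\|_{-1/2,\delta}\big),\qquad \mathfrak A(u_\delta,\lambda_\delta;u_\delta,\mu_\delta)\ge c\big(\|u_\delta\|_{1,\delta}^2+\alpha\|\lambda_\delta\|_{-1/2,\delta}^2\big),$$ and such that $(u_\delta,\mu_\delta)\in\ker\mathfrak B$ whenever $(u_\delta,\lambda_\delta)\in\ker\mathfrak B$. -/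

import Mathlib

open Set Filter Topology MeasureTheory

/-- The reference plane in which a planar fracture is described. -/
abbrev Plane := EuclideanSpace ℝ (Fin 2)

/-- The ambient three-dimensional space. -/
abbrev Space3 := EuclideanSpace ℝ (Fin 3)

/-! ### Geometry -/

/-- A closed polygonal region of the plane: a finite union of nondegenerate triangles whose interior
is connected, also near each point of the region (no two parts of it touch only at a corner). -/
structure IsPolygon (P : Set Plane) : Prop where
  triangles : ∃ s : Finset (Fin 3 → Plane), (∀ v ∈ s, AffineIndependent ℝ v) ∧
    P = ⋃ v ∈ s, convexHull ℝ (range v)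
  connected : IsConnected (interior P)
  locally_connected : ∀ x ∈ P, ∀ᶠ r in 𝓝[>] (0 : ℝ), IsConnected (interior P ∩ Metric.ball x r)

/-- A discrete fracture network with `L` fractures and `M` traces, together with the constant
diffusion tensors and the Dirichlet part of the boundary. -/
structure DFN (L M : ℕ) where
  /-- isometric parametrization of the plane that contains the `i`-th fracture -/
  chart : Fin L → (Plane →ᵃⁱ[ℝ] Space3)
  /-- the `i`-th fracture, in the coordinates of its plane -/
  poly : Fin L → Set Plane
  isPolygon : ∀ i, IsPolygon (poly i)
  /-- the end points of the traces -/
  ptA : Fin M → Space3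
  ptB : Fin M → Space3
  ptA_ne_ptB : ∀ m, ptA m ≠ ptB m
  /-- the two fractures that share a trace, in increasing order -/
  fst : Fin M → Fin L
  snd : Fin M → Fin L
  fst_lt_snd : ∀ m, fst m < snd m
  inter_eq : ∀ m, (chart (fst m) '' poly (fst m)) ∩ (chart (snd m) '' poly (snd m)) =
    segment ℝ (ptA m) (ptB m)
  exists_trace : ∀ i j, i < j → ((chart i '' poly i) ∩ (chart j '' poly j)).Nonempty →
    ∃ m, fst m = i ∧ snd m = j
  separated : ∃ γ₀ : ℝ, 0 < γ₀ ∧ ∀ m m', m ≠ m' → ∀ x ∈ segment ℝ (ptA m) (ptB m),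
    ∀ y ∈ segment ℝ (ptA m') (ptB m'), γ₀ ≤ dist x y
  /-- the diffusion tensors, in the coordinates of the planes of the fractures -/
  tensor : Fin L → Matrix (Fin 2) (Fin 2) ℝ
  tensor_posDef : ∀ i, (tensor i).PosDef
  /-- the Dirichlet part of the boundary; the rest of the boundary is the Neumann part -/
  dirichlet : Set Space3
  dirichlet_subset : dirichlet ⊆ ⋃ i, chart i '' frontier (poly i)
  /-- a trace reaches the Dirichlet boundary at most with its end points -/
  dirichlet_inter_trace : ∀ m, dirichlet ∩ segment ℝ (ptA m) (ptB m) ⊆ {ptA m, ptB m}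

namespace DFN

variable {L M : ℕ} (N : DFN L M)

/-- The `m`-th trace. -/
def trace (m : Fin M) : Set Space3 := segment ℝ (N.ptA m) (N.ptB m)

/-- The length of the `m`-th trace. -/
noncomputable def length (m : Fin M) : ℝ := dist (N.ptA m) (N.ptB m)

/-- The line integral over the `m`-th trace. -/
noncomputable def lineInt (m : Fin M) (f : Space3 → ℝ) : ℝ :=
  N.length m * ∫ s in (0 : ℝ)..1, f (AffineMap.lineMap (N.ptA m) (N.ptB m) s)

/-- The traces that lie on the `i`-th fracture. -/
def traces (i : Fin L) : Finset (Fin M) :=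
  Finset.univ.filter fun m => N.fst m = i ∨ N.snd m = i

/-- The planar coordinates of a point of the `i`-th fracture: the inverse of the chart. -/
noncomputable def coord (i : Fin L) : Space3 → Plane := Function.invFun (N.chart i)

theorem coord_chart (i : Fin L) (x : Plane) : N.coord i (N.chart i x) = x :=
  Function.leftInverse_invFun (N.chart i).injective x

/-- A function on the `i`-th fracture, given in planar coordinates, as a function of points in
space. -/
noncomputable def onSpace (i : Fin L) (v : Plane → ℝ) : Space3 → ℝ := fun x => v (N.coord i x)

/-- The Dirichlet part of the boundary of the `i`-th fracture, in planar coordinates. -/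
def clamped (i : Fin L) : Set Plane := {x | x ∈ frontier (N.poly i) ∧ N.chart i x ∈ N.dirichlet}

/-- Continuous functions on the `i`-th fracture whose trace vanishes (almost everywhere for the
length measure) on the Dirichlet part of its boundary. A continuous function that is affine on each
triangle of a mesh of the fracture is in `H¹`, and conversely, so that for piecewise affine functions
this is the condition to be in the subspace of `H¹` with vanishing trace on the Dirichlet part. -/
def Conforming (i : Fin L) (v : Plane → ℝ) : Prop :=
  ContinuousOn v (N.poly i) ∧ Measure.hausdorffMeasure 1 {x | x ∈ N.clamped i ∧ v x ≠ 0} = 0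

end DFN

/-! ### Meshes -/

/-- A conforming triangular mesh: a finite simplicial complex all of whose maximal faces are
triangles. The meshed region is `K.space`. -/
structure IsTriangularMesh (K : Geometry.SimplicialComplex ℝ Plane) : Prop where
  finite : K.faces.Finite
  pure : ∀ s ∈ K.faces, ∃ T ∈ K.faces, s ⊆ T ∧ T.card = 3

/-- The diameter of the triangle with vertex set `T`. -/
noncomputable def triDiam (T : Finset Plane) : ℝ := Metric.diam (convexHull ℝ (T : Set Plane))

/-- Shape regularity with constant `σ`: the diameter of each triangle is at most `σ` times the
radius of a disc that it contains. -/
def ShapeRegular (σ : ℝ) (K : Geometry.SimplicialComplex ℝ Plane) : Prop :=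
  ∀ T ∈ K.faces, T.card = 3 → ∃ c : Plane, ∃ r : ℝ, 0 < r ∧
    Metric.closedBall c r ⊆ convexHull ℝ (T : Set Plane) ∧ triDiam T ≤ σ * r

/-- `v` is affine on each triangle of the mesh `K`. -/
def IsP1 (K : Geometry.SimplicialComplex ℝ Plane) (v : Plane → ℝ) : Prop :=
  ∀ T ∈ K.faces, T.card = 3 → ∃ g : Plane →ᵃ[ℝ] ℝ, EqOn v g (convexHull ℝ (T : Set Plane))

/-- `w` are barycentric coordinates of `x` with respect to the vertices of a face of `K`. -/
def IsBarycentric (K : Geometry.SimplicialComplex ℝ Plane) (x : Plane) (w : Plane → ℝ) : Prop :=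
  ∃ s ∈ K.faces, (∀ y, 0 ≤ w y) ∧ (∀ y, y ∉ s → w y = 0) ∧ ∑ y ∈ s, w y = 1 ∧ ∑ y ∈ s, w y • y = x

open Classical in
/-- The nodal function (hat function) of the mesh `K` at its vertex `z`, extended by zero outside
the meshed region. Its value at `x` is the barycentric coordinate of `x` with respect to `z`. -/
noncomputable def hat (K : Geometry.SimplicialComplex ℝ Plane) (z x : Plane) : ℝ :=
  if h : ∃ w, IsBarycentric K x w then h.choose z else 0

/-- The discrete setting over a network: the mesh size, the triangular meshes of the fractures, the
meshes of the traces, and the local auxiliary meshes around the traces, one for each pair of a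
fracture and a trace on it (`aux i m` is irrelevant if the trace `m` does not lie on `i`). -/
structure Discretization {L M : ℕ} (N : DFN L M) where
  /-- the global mesh size -/
  δ : ℝ
  /-- the mesh sizes of the fractures -/
  δF : Fin L → ℝ
  /-- the mesh sizes of the traces -/
  δT : Fin M → ℝ
  /-- the meshes of the fractures -/
  mesh : Fin L → Geometry.SimplicialComplex ℝ Plane
  isMesh : ∀ i, IsTriangularMesh (mesh i)
  mesh_space : ∀ i, (mesh i).space = N.poly i
  /-- the number of elements of the mesh of a trace -/
  num : Fin M → ℕ
  /-- the affine parameters of the nodes of the mesh of a trace -/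
  param : (m : Fin M) → Fin (num m + 1) → ℝ
  param_strictMono : ∀ m, StrictMono (param m)
  param_zero : ∀ m, param m 0 = 0
  param_last : ∀ m, param m (Fin.last (num m)) = 1
  /-- the auxiliary meshes -/
  aux : Fin L → Fin M → Geometry.SimplicialComplex ℝ Plane

namespace Discretization

variable {L M : ℕ} {N : DFN L M} (D : Discretization N)

/-- The `k`-th node of the mesh of the `m`-th trace. -/
noncomputable def node (m : Fin M) (k : Fin (D.num m + 1)) : Space3 :=
  AffineMap.lineMap (N.ptA m) (N.ptB m) (D.param m k)

/-- The nodes of the mesh of the `m`-th trace that are not on the Dirichlet boundary. -/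
abbrev FreeNode (m : Fin M) := {k : Fin (D.num m + 1) // D.node m k ∉ N.dirichlet}

noncomputable instance (m : Fin M) : Fintype (D.FreeNode m) := Fintype.ofFinite _

/-- The space of continuous, piecewise affine functions on the `m`-th trace that vanish on the
Dirichlet boundary (only the values on the trace matter). -/
def TraceSpace (m : Fin M) (ψ : Space3 → ℝ) : Prop :=
  ContinuousOn ψ (N.trace m) ∧
  (∀ k : Fin (D.num m), ∃ g : Space3 →ᵃ[ℝ] ℝ,
    EqOn ψ g (segment ℝ (D.node m k.castSucc) (D.node m k.succ))) ∧
  ∀ x ∈ N.trace m, x ∈ N.dirichlet → ψ x = 0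

/-- The primal discrete space: on each fracture, conforming piecewise affine functions. -/
def InV (u : Fin L → Plane → ℝ) : Prop := ∀ i, N.Conforming i (u i) ∧ IsP1 (D.mesh i) (u i)

/-- The multiplier space: one function for each pair of a fracture and a trace on it. -/
def InΛ (lam : Fin L → Fin M → Space3 → ℝ) : Prop :=
  ∀ i, ∀ m ∈ N.traces i, D.TraceSpace m (lam i m)

/-- The discrete space of single-valued functions on the skeleton. -/
def InΨ (ψ : Fin M → Space3 → ℝ) : Prop := ∀ m, D.TraceSpace m (ψ m)

/-- The basis functions of the local auxiliary space: the nodal functions of the auxiliary mesh at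
the nodes on the trace that are not on the Dirichlet boundary, extended by zero. -/
noncomputable def auxBasis (i : Fin L) (m : Fin M) (k : D.FreeNode m) : Plane → ℝ :=
  hat (D.aux i m) (N.coord i (D.node m k))

/-- The assumptions on the meshes, with regularity constant `σ`. -/
structure IsRegular (σ : ℝ) : Prop where
  δ_pos : 0 < D.δ
  /-- the fracture meshes are shape regular and quasi uniform -/
  shape : ∀ i, ShapeRegular σ (D.mesh i)
  quasiUniform : ∀ i, ∀ T ∈ (D.mesh i).faces, T.card = 3 →
    triDiam T ≤ D.δF i ∧ D.δF i ≤ σ * triDiam T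
  /-- the trace meshes are quasi uniform -/
  quasiUniform_trace : ∀ m, ∀ k : Fin (D.num m),
    dist (D.node m k.castSucc) (D.node m k.succ) ≤ D.δT m ∧
    D.δT m ≤ σ * dist (D.node m k.castSucc) (D.node m k.succ)
  /-- all mesh sizes are comparable -/
  comparable : ∀ i, D.δF i ≤ σ * D.δ ∧ D.δ ≤ σ * D.δF i
  comparable_trace : ∀ m, D.δT m ≤ σ * D.δ ∧ D.δ ≤ σ * D.δT m
  /-- the discrete spaces on the traces are not trivial -/
  exists_free : ∀ m, Nonempty (D.FreeNode m)
  /-- the auxiliary meshes are shape regular meshes of subregions of the fractures -/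
  aux_isMesh : ∀ i, ∀ m ∈ N.traces i, IsTriangularMesh (D.aux i m)
  aux_subset : ∀ i, ∀ m ∈ N.traces i, (D.aux i m).space ⊆ N.poly i
  aux_shape : ∀ i, ∀ m ∈ N.traces i, ShapeRegular σ (D.aux i m)
  /-- each element of the mesh of a trace is an edge of the auxiliary mesh -/
  aux_edge : ∀ i, ∀ m ∈ N.traces i, ∀ k : Fin (D.num m), ∃ e ∈ (D.aux i m).faces,
    (e : Set Plane) = {N.coord i (D.node m k.castSucc), N.coord i (D.node m k.succ)}
  /-- the interior nodes of the auxiliary mesh are the nodes of the trace interior to the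
  fracture -/
  aux_interior : ∀ i, ∀ m ∈ N.traces i,
    {z | z ∈ (D.aux i m).vertices ∧ z ∈ interior (D.aux i m).space} =
      {z | z ∈ interior (N.poly i) ∧ ∃ k, z = N.coord i (D.node m k)}
  /-- the local auxiliary spaces are subspaces of the continuous primal space -/
  aux_conforming : ∀ i, ∀ m ∈ N.traces i, ∀ k : D.FreeNode m, N.Conforming i (D.auxBasis i m k)
  /-- different auxiliary meshes of the same fracture do not overlap -/
  aux_disjoint : ∀ i, ∀ m ∈ N.traces i, ∀ m' ∈ N.traces i, m ≠ m' →
    Disjoint (interior (D.aux i m).space) (interior (D.aux i m').space)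

/-! ### The stabilized bilinear form -/

/-- The partial derivative in the direction of the `a`-th coordinate axis. -/
noncomputable def pd (a : Fin 2) (v : Plane → ℝ) (x : Plane) : ℝ :=
  fderiv ℝ v x (EuclideanSpace.single a 1)

/-- The diffusion form `∫ K ∇u · ∇v` on the `i`-th fracture. -/
noncomputable def formA (N : DFN L M) (i : Fin L) (u v : Plane → ℝ) : ℝ :=
  ∫ x in N.poly i, ∑ a, ∑ b, N.tensor i a b * pd b u x * pd a v x

/-- The pairing of a multiplier on the `i`-th fracture with a function on the fracture: the
integral over the traces of the fracture. -/
noncomputable def pairB (N : DFN L M) (i : Fin L) (lam : Fin M → Space3 → ℝ)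
    (v : Plane → ℝ) : ℝ :=
  ∑ m ∈ N.traces i, N.lineInt m fun x => lam m x * N.onSpace i v x

/-- The mass matrix of the traces of the auxiliary basis functions. -/
noncomputable def mass (i : Fin L) (m : Fin M) : Matrix (D.FreeNode m) (D.FreeNode m) ℝ :=
  fun k l => N.lineInt m fun x =>
    N.onSpace i (D.auxBasis i m k) x * N.onSpace i (D.auxBasis i m l) x

open Classical in
/-- The basis of the multiplier space on the `m`-th trace that is biorthogonal to the traces of the
auxiliary basis functions. -/
noncomputable def dualBasis (i : Fin L) (m : Fin M) (k : D.FreeNode m) (x : Space3) : ℝ :=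
  ∑ l, (D.mass i m)⁻¹ k l * N.onSpace i (D.auxBasis i m l) x

/-- The mass matrix of the biorthogonal basis. -/
noncomputable def dualMass (i : Fin L) (m : Fin M) : Matrix (D.FreeNode m) (D.FreeNode m) ℝ :=
  fun k l => N.lineInt m fun x => D.dualBasis i m k x * D.dualBasis i m l x

/-- The mesh dependent scalar product of two functionals, local to a fracture and a trace on it. -/
noncomputable def stabLocal (i : Fin L) (m : Fin M) (f g : (Plane → ℝ) → ℝ) : ℝ :=
  ∑ k, ∑ l, D.δ * D.dualMass i m k l * f (D.auxBasis i m l) * g (D.auxBasis i m k)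

/-- The mesh dependent scalar product of functionals on the `i`-th fracture. -/
noncomputable def stab (i : Fin L) (f g : (Plane → ℝ) → ℝ) : ℝ :=
  ∑ m ∈ N.traces i, D.stabLocal i m f g

/-- The stabilized form `𝔄(u, lam; v, mu)` with weight `α` and parameter `t`. -/
noncomputable def form (α t : ℝ) (u : Fin L → Plane → ℝ) (lam : Fin L → Fin M → Space3 → ℝ)
    (v : Fin L → Plane → ℝ) (mu : Fin L → Fin M → Space3 → ℝ) : ℝ :=
  ∑ i, formA N i (u i) (v i) - ∑ i, pairB N i (lam i) (v i) + ∑ i, pairB N i (mu i) (u i) +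
    α * ∑ i, D.stab i (fun w => formA N i (u i) w - pairB N i (lam i) w)
      (fun w => t * formA N i (v i) w - pairB N i (mu i) w)

/-- The pair of any `u` and `lam` is in the kernel of `𝔅`, that is, the sum of the multipliers of
the different fractures is orthogonal to the discrete functions on the skeleton. -/
def InKerB (lam : Fin L → Fin M → Space3 → ℝ) : Prop :=
  ∀ ψ, D.InΨ ψ → ∑ i, ∑ m ∈ N.traces i, N.lineInt m (fun x => lam i m x * ψ m x) = 0

/-! ### Norms -/

/-- The mean value over the `m`-th trace of the jump of `u`. -/
noncomputable def meanJump (N : DFN L M) (u : Fin L → Plane → ℝ) (m : Fin M) : ℝ :=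
  (N.length m)⁻¹ *
    N.lineInt m fun x => N.onSpace (N.fst m) (u (N.fst m)) x - N.onSpace (N.snd m) (u (N.snd m)) x

/-- The square of the `H¹` seminorm on the `i`-th fracture. -/
noncomputable def semiSq (N : DFN L M) (i : Fin L) (v : Plane → ℝ) : ℝ :=
  ∫ x in N.poly i, ∑ a, (pd a v x) ^ 2

/-- The mesh dependent norm of the primal unknown. -/
noncomputable def normV (N : DFN L M) (u : Fin L → Plane → ℝ) : ℝ :=
  √(∑ i, semiSq N i (u i) + ∑ m, N.length m * (meanJump N u m) ^ 2)

/-- The mesh dependent norm of the multipliers. -/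
noncomputable def normΛ (lam : Fin L → Fin M → Space3 → ℝ) : ℝ :=
  √(∑ i, D.δF i * ∑ m ∈ N.traces i, N.lineInt m fun x => (lam i m x) ^ 2)

end Discretization

open scoped ENNReal NNReal

/-! ### Upper gradients and linked segments -/

/-! The test multiplier is `mu = lam + κ ξ`. The mixed terms `-⟨Bᵀ lam, u⟩ + ⟨Bᵀ lam, u⟩` cancel,
and what remains is the diffusion energy of `u`, the term `κ ∑ ⟨Bᵀ ξ, u⟩` and the stabilization. On
a trace, `ξ` is the mean jump `J` of `u` times the discrete function `χ` that equals 1 at all free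
nodes (`cutoff`), with sign plus on the first fracture and minus on the second. The opposite signs
make `ξ` orthogonal to all functions that are single-valued on the skeleton, so adding it preserves
the kernel condition.

The jump term is `∑ J ∫ χ [u]`. Here `∫ χ` is at least half the length of the trace, because the
trace mesh has a free node. Replacing `[u]` by its mean costs only the `L¹` oscillation of `[u]` on
the trace, which is bounded by the gradients (`IsPolygon.exists_poincare`, `exists_jump_bound`). The
constant in that Poincaré inequality must not see the mesh, so it is derived from geometry alone.
Two segments are `Linked` if the mean difference of the values of `u` on them is at most `C ∫ G` for
every upper gradient `G`. For adjacent sides of a parallelogram this holds because two points on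
them are joined through the opposite corner of a smaller parallelogram, and averaging over both
points sweeps out the large one. Chains of parallelograms, triangles and balls then link any segment
in a polygon to itself, and this is the oscillation bound.

For the stabilization, let `R` be the discrete Riesz map on a trace. Then `[f, g]` is a sum of `δ ∫
Rf Rg`, and `R` maps the pairing with a multiplier back to that multiplier (`stabLocal_eq`,
`comb_rieszCoeff_pairB`). With `ρ = R(A u)` the integrand is `(ρ - lam)(tρ - lam - κξ)`, which is at
least `lam²/2` minus multiples of `ρ²` and `(κξ)²`. The bound `δ ∫ ρ² ≤ C |u|²`
(`delta_lineInt_riesz_formA_le`) is obtained by testing the diffusion form with the lift of `ρ` to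
the auxiliary mesh. The nodal values of this lift live on the trace only, so an inverse inequality
together with the lower bound for the mass matrix controls its energy.

Finally `κ` is taken small against the coercivity of the diffusion form, and then `α₀` small against
both. -/

/-- `G` is an upper gradient of `u` along the segments contained in `F`. -/
structure UpperGradient (F : Set Plane) (u : Plane → ℝ) (G : Plane → ℝ≥0∞) : Prop where
  measurable_fun : Measurable u
  measurable_grad : Measurable G
  enorm_sub_le : ∀ p q, segment ℝ p q ⊆ F → ∀ s ∈ Icc (0 : ℝ) 1,
    ‖u (AffineMap.lineMap p q s) - u p‖ₑ ≤
      ‖q - p‖ₑ * ∫⁻ r in Icc (0 : ℝ) 1, G (AffineMap.lineMap p q r)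

/-- The mean distance between the values of `u` on two segments. -/
noncomputable def meanGap (u : Plane → ℝ) (p q p' q' : Plane) : ℝ≥0∞ :=
  ∫⁻ s in Icc (0 : ℝ) 1, ∫⁻ t in Icc (0 : ℝ) 1,
    ‖u (AffineMap.lineMap p q s) - u (AffineMap.lineMap p' q' t)‖ₑ

/-- The mean gap between two segments is controlled by the upper gradient on `F`. -/
def Linked (F : Set Plane) (p q p' q' : Plane) : Prop :=
  ∃ C : ℝ≥0, ∀ u G, UpperGradient F u G → meanGap u p q p' q' ≤ C * ∫⁻ x in F, G x

theorem measurable_lineMap_real (p q : Plane) :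
    Measurable fun s : ℝ => (AffineMap.lineMap p q s : Plane) :=
  (AffineMap.lineMap_continuous (p := p) (q := q)).measurable

theorem lintegral_const_Icc (c : ℝ≥0∞) : ∫⁻ _ in Icc (0 : ℝ) 1, c = c := by simp

theorem meanGap_comm (u : Plane → ℝ) (hu : Measurable u) (p q p' q' : Plane) :
    meanGap u p q p' q' = meanGap u p' q' p q := by
  unfold meanGap
  rw [lintegral_lintegral_swap]
  · simp_rw [enorm_sub_rev (u (AffineMap.lineMap p q _))]
  · refine Measurable.aemeasurable ?_
    have h1 := hu.comp (measurable_lineMap_real p q)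
    have h2 := hu.comp (measurable_lineMap_real p' q')
    exact ((h1.comp measurable_fst).sub (h2.comp measurable_snd)).enorm

/-- Insert a point of the middle segment into the difference and average over it; the intervals have
length one, so no constant appears. -/
theorem meanGap_triangle (u : Plane → ℝ) (hu : Measurable u) (p q p' q' p'' q'' : Plane) :
    meanGap u p q p'' q'' ≤ meanGap u p q p' q' + meanGap u p' q' p'' q'' := by
  rw [meanGap_comm u hu p' q']
  have h1 := hu.comp (measurable_lineMap_real p q)
  have h2 := hu.comp (measurable_lineMap_real p' q')
  have h3 := hu.comp (measurable_lineMap_real p'' q'')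
  set f := u ∘ fun s : ℝ => (AffineMap.lineMap p q s : Plane)
  set g := u ∘ fun s : ℝ => (AffineMap.lineMap p' q' s : Plane)
  set h := u ∘ fun s : ℝ => (AffineMap.lineMap p'' q'' s : Plane)
  change ∫⁻ s in Icc (0 : ℝ) 1, ∫⁻ t in Icc (0 : ℝ) 1, ‖f s - h t‖ₑ ≤
    (∫⁻ s in Icc (0 : ℝ) 1, ∫⁻ t in Icc (0 : ℝ) 1, ‖f s - g t‖ₑ) +
    (∫⁻ s in Icc (0 : ℝ) 1, ∫⁻ t in Icc (0 : ℝ) 1, ‖h s - g t‖ₑ)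
  have key : ∀ s t, ‖f s - h t‖ₑ ≤
      (∫⁻ r in Icc (0 : ℝ) 1, ‖f s - g r‖ₑ) + ∫⁻ r in Icc (0 : ℝ) 1, ‖h t - g r‖ₑ := by
    intro s t
    rw [← lintegral_add_left (by fun_prop)]
    calc ‖f s - h t‖ₑ = ∫⁻ r in Icc (0 : ℝ) 1, ‖f s - h t‖ₑ := (lintegral_const_Icc _).symm
      _ ≤ _ := by
        refine lintegral_mono fun r => ?_
        have : f s - h t = (f s - g r) - (h t - g r) := by ring
        rw [this]
        exact enorm_sub_le
  have hm : Measurable fun t => ∫⁻ r in Icc (0 : ℝ) 1, ‖h t - g r‖ₑ := by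
    apply Measurable.lintegral_prod_right'
      (f := fun z : ℝ × ℝ => ‖h z.1 - g z.2‖ₑ)
    exact ((h3.comp measurable_fst).sub (h2.comp measurable_snd)).enorm
  calc _ ≤ ∫⁻ s in Icc (0 : ℝ) 1, ∫⁻ t in Icc (0 : ℝ) 1,
        ((∫⁻ r in Icc (0 : ℝ) 1, ‖f s - g r‖ₑ) + ∫⁻ r in Icc (0 : ℝ) 1, ‖h t - g r‖ₑ) :=
        lintegral_mono fun s => lintegral_mono fun t => key s t
    _ = ∫⁻ s in Icc (0 : ℝ) 1, ((∫⁻ r in Icc (0 : ℝ) 1, ‖f s - g r‖ₑ) +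
          ∫⁻ t in Icc (0 : ℝ) 1, ∫⁻ r in Icc (0 : ℝ) 1, ‖h t - g r‖ₑ) := by
        refine lintegral_congr fun s => ?_
        rw [lintegral_add_right _ hm, lintegral_const_Icc]
    _ = _ := by rw [lintegral_add_right _ measurable_const, lintegral_const_Icc]

/-- Together with transitivity, being linked is a partial equivalence relation. Reflexivity is not
automatic: that a segment is linked to itself is a Poincaré inequality. -/
theorem Linked.symm {F : Set Plane} {p q p' q' : Plane} (h : Linked F p q p' q') :
    Linked F p' q' p q := by
  obtain ⟨C, hC⟩ := h
  exact ⟨C, fun u G hu => by rw [meanGap_comm u hu.measurable_fun]; exact hC u G hu⟩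

theorem Linked.trans {F : Set Plane} {p q p' q' p'' q'' : Plane} (h : Linked F p q p' q')
    (h' : Linked F p' q' p'' q'') : Linked F p q p'' q'' := by
  obtain ⟨C, hC⟩ := h
  obtain ⟨C', hC'⟩ := h'
  refine ⟨C + C', fun u G hu => (meanGap_triangle u hu.measurable_fun p q p' q' p'' q'').trans ?_⟩
  rw [ENNReal.coe_add, add_mul]
  exact add_le_add (hC u G hu) (hC' u G hu)

/-! ### Linking segments in parallelograms, triangles, convex sets and polygons. -/

/-- Change of variables on a parallelogram. -/
theorem exists_lintegral_parallelogram_le {a b : Plane} (hab : LinearIndependent ℝ ![a, b]) :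
    ∃ C : ℝ≥0, ∀ (G : Plane → ℝ≥0∞), Measurable G → ∀ (F : Set Plane), MeasurableSet F → ∀ o,
      (∀ s ∈ Icc (0 : ℝ) 1, ∀ t ∈ Icc (0 : ℝ) 1, o + s • a + t • b ∈ F) →
      ∫⁻ s in Icc (0 : ℝ) 1, ∫⁻ t in Icc (0 : ℝ) 1, G (o + s • a + t • b) ≤
        C * ∫⁻ x in F, G x := by
  let B : Module.Basis (Fin 2) ℝ Plane := basisOfLinearIndependentOfCardEqFinrank hab (by simp)
  let e : (Fin 2 → ℝ) ≃L[ℝ] Plane := B.equivFun.symm.toContinuousLinearEquiv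
  let e' : (ℝ × ℝ) ≃L[ℝ] Plane :=
    (ContinuousLinearEquiv.finTwoArrow ℝ ℝ).symm.trans e
  have he : ∀ s t : ℝ, e' (s, t) = s • a + t • b := by
    intro s t
    simp [e', e, Module.Basis.equivFun_symm_apply, B, Fin.sum_univ_two]
  let ν : Measure Plane := Measure.map e' (volume : Measure (ℝ × ℝ))
  have hν : ν.IsAddHaarMeasure := e'.isAddHaarMeasure_map volume
  -- The image of Lebesgue measure under the linear map is a Haar measure, hence a multiple of
  -- Lebesgue measure. The factor depends on `a` and `b` only, not on the corner `o`.
  obtain ⟨C, hC⟩ : ∃ C : ℝ≥0, ν = C • (volume : Measure Plane) :=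
    ⟨_, Measure.isAddLeftInvariant_eq_smul ν volume⟩
  refine ⟨C, fun G hG F hF o hQ => ?_⟩
  have hem : Measurable e' := e'.continuous.measurable
  have hm : Measurable fun z : ℝ × ℝ => G (o + z.1 • a + z.2 • b) := by
    apply hG.comp; fun_prop
  calc ∫⁻ s in Icc (0 : ℝ) 1, ∫⁻ t in Icc (0 : ℝ) 1, G (o + s • a + t • b)
      = ∫⁻ z in Icc (0 : ℝ) 1 ×ˢ Icc (0 : ℝ) 1, G (o + z.1 • a + z.2 • b) := by
        rw [Measure.volume_eq_prod, ← Measure.prod_restrict, lintegral_prod _ hm.aemeasurable]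
    _ ≤ ∫⁻ z : ℝ × ℝ, F.indicator G (o + e' z) := by
        rw [← lintegral_indicator (measurableSet_Icc.prod measurableSet_Icc)]
        refine lintegral_mono fun z => ?_
        by_cases hz : z ∈ Icc (0 : ℝ) 1 ×ˢ Icc (0 : ℝ) 1
        · have h2 : o + e' z = o + z.1 • a + z.2 • b := by rw [add_assoc, ← he z.1 z.2]
          rw [indicator_of_mem hz, h2, indicator_of_mem (hQ z.1 hz.1 z.2 hz.2)]
        · rw [indicator_of_notMem hz]
          exact zero_le
    _ = ∫⁻ x, F.indicator G (o + x) ∂ν :=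
        (lintegral_map ((hG.indicator hF).comp (measurable_const_add o)) hem).symm
    _ = C * ∫⁻ x, F.indicator G (o + x) := by
        rw [hC, lintegral_smul_measure]; rfl
    _ = C * ∫⁻ x in F, G x := by
        rw [lintegral_add_left_eq_self (μ := (volume : Measure Plane)) (F.indicator G) o,
          lintegral_indicator hF]

/-- Adjacent sides of a parallelogram are linked. -/
theorem Linked.of_parallelogram {F : Set Plane} (hF : MeasurableSet F) {o a b : Plane}
    (hab : LinearIndependent ℝ ![a, b])
    (hQ : ∀ s ∈ Icc (0 : ℝ) 1, ∀ t ∈ Icc (0 : ℝ) 1, o + s • a + t • b ∈ F) :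
    Linked F o (o + a) o (o + b) := by
  have hba : LinearIndependent ℝ ![b, a] := by
    rw [LinearIndependent.pair_iff] at hab ⊢
    intro s t h
    exact (hab t s (by rw [add_comm]; exact h)).symm
  obtain ⟨C, hC⟩ := exists_lintegral_parallelogram_le hab
  obtain ⟨C', hC'⟩ := exists_lintegral_parallelogram_le hba
  refine ⟨‖b‖₊ * C + ‖a‖₊ * C', fun u G hu => ?_⟩
  have hQ' : ∀ t ∈ Icc (0 : ℝ) 1, ∀ s ∈ Icc (0 : ℝ) 1, o + t • b + s • a ∈ F :=
    fun t ht s hs => by rw [add_right_comm]; exact hQ s hs t ht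
  have hl : ∀ (x v : Plane) (r : ℝ), AffineMap.lineMap x (x + v) r = x + r • v := by
    intro x v r; simp [AffineMap.lineMap_apply, add_comm]
  -- The points `o + s a` and `o + t b` are compared through `o + s a + t b`, which is reached from
  -- the first along `b` and from the second along `a`.
  have h1 : ∀ s ∈ Icc (0 : ℝ) 1, ∀ t ∈ Icc (0 : ℝ) 1, ‖u (o + s • a + t • b) - u (o + s • a)‖ₑ ≤
      ‖b‖ₑ * ∫⁻ r in Icc (0 : ℝ) 1, G (o + s • a + r • b) := by
    intro s hs t ht
    have := hu.enorm_sub_le (o + s • a) (o + s • a + b) ?_ t ht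
    · simpa only [hl, add_sub_cancel_left] using this
    · rw [segment_eq_image_lineMap]
      rintro _ ⟨r, hr, rfl⟩
      rw [hl]; exact hQ s hs r hr
  have h2 : ∀ s ∈ Icc (0 : ℝ) 1, ∀ t ∈ Icc (0 : ℝ) 1, ‖u (o + t • b + s • a) - u (o + t • b)‖ₑ ≤
      ‖a‖ₑ * ∫⁻ r in Icc (0 : ℝ) 1, G (o + t • b + r • a) := by
    intro s hs t ht
    have := hu.enorm_sub_le (o + t • b) (o + t • b + a) ?_ s hs
    · simpa only [hl, add_sub_cancel_left] using this
    · rw [segment_eq_image_lineMap]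
      rintro _ ⟨r, hr, rfl⟩
      rw [hl]; exact hQ' t ht r hr
  have hm : ∀ c d : Plane,
      Measurable fun t : ℝ => ∫⁻ r in Icc (0 : ℝ) 1, G (o + t • c + r • d) := by
    intro c d
    apply Measurable.lintegral_prod_right' (f := fun z : ℝ × ℝ => G (o + z.1 • c + z.2 • d))
    apply hu.measurable_grad.comp; fun_prop
  unfold meanGap
  simp only [hl]
  calc _ ≤ ∫⁻ s in Icc (0 : ℝ) 1, ∫⁻ t in Icc (0 : ℝ) 1,
        (‖b‖ₑ * (∫⁻ r in Icc (0 : ℝ) 1, G (o + s • a + r • b)) +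
        ‖a‖ₑ * ∫⁻ r in Icc (0 : ℝ) 1, G (o + t • b + r • a)) := by
        refine setLIntegral_mono' measurableSet_Icc fun s hs =>
          setLIntegral_mono' measurableSet_Icc fun t ht => ?_
        have e : u (o + s • a) - u (o + t • b) = (u (o + t • b + s • a) - u (o + t • b)) -
          (u (o + s • a + t • b) - u (o + s • a)) := by
          rw [add_right_comm o (t • b)]; ring
        rw [e, add_comm (‖b‖ₑ * _)]
        exact enorm_sub_le.trans (add_le_add (h2 s hs t ht) (h1 s hs t ht))
    _ = ‖b‖ₑ * (∫⁻ s in Icc (0 : ℝ) 1, ∫⁻ r in Icc (0 : ℝ) 1, G (o + s • a + r • b)) +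
        ‖a‖ₑ * ∫⁻ t in Icc (0 : ℝ) 1, ∫⁻ r in Icc (0 : ℝ) 1, G (o + t • b + r • a) := by
        have : ∀ s : ℝ, ∫⁻ t in Icc (0 : ℝ) 1,
          (‖b‖ₑ * (∫⁻ r in Icc (0 : ℝ) 1, G (o + s • a + r • b)) +
          ‖a‖ₑ * ∫⁻ r in Icc (0 : ℝ) 1, G (o + t • b + r • a)) =
          ‖b‖ₑ * (∫⁻ r in Icc (0 : ℝ) 1, G (o + s • a + r • b)) +
          ‖a‖ₑ * ∫⁻ t in Icc (0 : ℝ) 1, ∫⁻ r in Icc (0 : ℝ) 1, G (o + t • b + r • a) := by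
          intro s
          rw [lintegral_add_left measurable_const, lintegral_const_Icc,
            lintegral_const_mul _ (hm b a)]
        simp_rw [this]
        rw [lintegral_add_right _ measurable_const, lintegral_const_Icc,
          lintegral_const_mul _ (hm a b)]
    _ ≤ ‖b‖ₑ * (C * ∫⁻ x in F, G x) + ‖a‖ₑ * (C' * ∫⁻ x in F, G x) := by
        gcongr
        · exact hC G hu.measurable_grad F hF o hQ
        · exact hC' G hu.measurable_grad F hF o hQ'
    _ = _ := by
        rw [ENNReal.coe_add, ENNReal.coe_mul, ENNReal.coe_mul, add_mul, mul_assoc, mul_assoc]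
        rfl

/-- The integral over a piece of the unit interval, reparametrized. -/
theorem lintegral_Icc_comp_lineMap (f : ℝ → ℝ≥0∞) {α β : ℝ} (h : α ≠ β) :
    ∫⁻ s in uIcc α β, f s =
      ENNReal.ofReal |β - α| * ∫⁻ r in Icc (0 : ℝ) 1, f (AffineMap.lineMap α β r) := by
  have himg : (fun r : ℝ => (AffineMap.lineMap α β r : ℝ)) '' Icc 0 1 = uIcc α β := by
    rw [← segment_eq_uIcc, segment_eq_image_lineMap]
  rw [← himg, lintegral_image_eq_lintegral_abs_deriv_mul measurableSet_Icc
    (f' := fun _ => β - α) (fun x _ => by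
      have : HasDerivAt (fun r : ℝ => (AffineMap.lineMap α β r : ℝ)) (β - α) x :=
        AffineMap.hasDerivAt_lineMap
      exact this.hasDerivWithinAt) (AffineMap.lineMap_injective ℝ h).injOn]
  rw [lintegral_const_mul' _ _ ENNReal.ofReal_ne_top]

/-- If finitely many pieces of a segment cover it and each of them is linked to a given segment,
then so is the whole segment. -/
theorem Linked.of_cover {F : Set Plane} {p q p' q' : Plane} {ι : Type*} (S : Finset ι)
    (α β : ι → ℝ) (hcov : Icc (0 : ℝ) 1 ⊆ ⋃ j ∈ S, uIcc (α j) (β j))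
    (h : ∀ j ∈ S, α j ≠ β j →
      Linked F (AffineMap.lineMap p q (α j)) (AffineMap.lineMap p q (β j)) p' q') :
    Linked F p q p' q' := by
  classical
  choose! C hC using h
  refine ⟨∑ j ∈ S, if α j = β j then 0 else Real.toNNReal |β j - α j| * C j, fun u G hu => ?_⟩
  set f : ℝ → ℝ≥0∞ := fun s => ∫⁻ t in Icc (0 : ℝ) 1,
    ‖u (AffineMap.lineMap p q s) - u (AffineMap.lineMap p' q' t)‖ₑ with hf
  have hcomp : ∀ a b r : ℝ, (AffineMap.lineMap (AffineMap.lineMap p q a)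
      (AffineMap.lineMap p q b) r : Plane) = AffineMap.lineMap p q (AffineMap.lineMap a b r) := by
    intro a b r
    rw [← AffineMap.apply_lineMap]
  calc meanGap u p q p' q' = ∫⁻ s in Icc (0 : ℝ) 1, f s := rfl
    _ ≤ ∫⁻ s in ⋃ j ∈ S, uIcc (α j) (β j), f s := lintegral_mono_set hcov
    _ ≤ ∑ j ∈ S, ∫⁻ s in uIcc (α j) (β j), f s := by
        clear hcov hC
        induction S using Finset.induction_on with
        | empty => simp
        | insert j S hj ih =>
          rw [Finset.set_biUnion_insert, Finset.sum_insert hj]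
          exact (lintegral_union_le _ _ _).trans (add_le_add le_rfl ih)
    _ ≤ ∑ j ∈ S, ((if α j = β j then 0 else Real.toNNReal |β j - α j| * C j : ℝ≥0) : ℝ≥0∞) *
          ∫⁻ x in F, G x := by
        refine Finset.sum_le_sum fun j hj => ?_
        by_cases hab : α j = β j
        · simp [hab]
        · rw [if_neg hab, lintegral_Icc_comp_lineMap f hab, ENNReal.coe_mul, mul_assoc]
          refine mul_le_mul' le_rfl ?_
          have := hC j hj hab u G hu
          simpa only [meanGap, hcomp] using this
    _ = _ := by rw [ENNReal.ofNNReal_finsetSum, Finset.sum_mul]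

/-- Cover the segment by a single piece, run through from parameter 1 to 0. -/
theorem Linked.swap_left {F : Set Plane} {p q p' q' : Plane} (h : Linked F p q p' q') :
    Linked F q p p' q' := by
  refine Linked.of_cover {()} (fun _ => 1) (fun _ => 0) ?_ ?_
  · intro s hs; simpa [uIcc_comm (1 : ℝ) 0] using hs
  · intro _ _ _; simpa using h

/-- Opposite sides of a parallelogram are linked. -/
theorem Linked.of_parallelogram_opposite {F : Set Plane} (hF : MeasurableSet F) {o a b : Plane}
    (hab : LinearIndependent ℝ ![a, b])
    (hQ : ∀ s ∈ Icc (0 : ℝ) 1, ∀ t ∈ Icc (0 : ℝ) 1, o + s • a + t • b ∈ F) :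
    Linked F o (o + a) (o + b) (o + b + a) := by
  have h1 := Linked.of_parallelogram hF hab hQ
  have h2 : Linked F (o + b) (o + b + -b) (o + b) (o + b + a) := by
    refine Linked.of_parallelogram hF ?_ fun s hs t ht => ?_
    · rw [LinearIndependent.pair_iff] at hab ⊢
      intro s t h
      have := hab t (-s) (by rw [← h, smul_neg, neg_smul, add_comm])
      exact ⟨by linarith [this.2], this.1⟩
    · have := hQ t ht (1 - s) ⟨by linarith [hs.2], by linarith [hs.1]⟩
      convert this using 1
      module
  -- Both opposite sides are adjacent to the side from `o` to `o + b`, which serves as the link.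
  rw [add_neg_cancel_right] at h2
  exact h1.trans (h2.swap_left).symm.symm

theorem Convex.three_mem {K : Set Plane} (hK : Convex ℝ K) {p q r : Plane} (hp : p ∈ K)
    (hq : q ∈ K) (hr : r ∈ K) {a b c : ℝ} (ha : 0 ≤ a) (hb : 0 ≤ b) (hc : 0 ≤ c)
    (h : a + b + c = 1) : a • p + b • q + c • r ∈ K := by
  have := hK.sum_mem (t := Finset.univ) (w := ![a, b, c]) (z := ![p, q, r])
    (by intro i _; fin_cases i <;> assumption) (by simpa [Fin.sum_univ_three] using h)
    (by intro i _; fin_cases i <;> assumption)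
  simpa [Fin.sum_univ_three] using this

/-- The parallelogram on the half sides fits into the triangle: its far corner is the midpoint of
the third side. The one on the full sides would not fit, hence the factor 2. -/
theorem parallelogram_subset_of_convex {K : Set Plane} (hK : Convex ℝ K) {p a b : Plane}
    (hp : p ∈ K) (hq : p + (2 : ℝ) • a ∈ K) (hr : p + (2 : ℝ) • b ∈ K) :
    ∀ s ∈ Icc (0 : ℝ) 1, ∀ t ∈ Icc (0 : ℝ) 1, p + s • a + t • b ∈ K := by
  intro s hs t ht
  have := hK.three_mem hp hq hr (a := 1 - s / 2 - t / 2) (b := s / 2) (c := t / 2)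
    (by linarith [hs.2, ht.2]) (by linarith [hs.1]) (by linarith [ht.1]) (by ring)
  convert this using 1
  module

/-- A side of a triangle is linked to its half. -/
theorem Linked.half_side {F K : Set Plane} (hF : MeasurableSet F) (hK : Convex ℝ K) (hKF : K ⊆ F)
    {p a b : Plane} (hab : LinearIndependent ℝ ![a, b])
    (hp : p ∈ K) (hq : p + (2 : ℝ) • a ∈ K) (hr : p + (2 : ℝ) • b ∈ K) :
    Linked F p (p + (2 : ℝ) • a) p (p + a) := by
  have h1 := Linked.of_parallelogram_opposite hF hab
    fun s hs t ht => hKF (parallelogram_subset_of_convex hK hp hq hr s hs t ht)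
  -- A second parallelogram, based at the other end of the side. In both, the side opposite to a
  -- half of the long side is the midline from `p + b` to `p + b + a`, so both halves are linked to
  -- the midline.
  have hab' : LinearIndependent ℝ ![-a, b - a] := by
    rw [LinearIndependent.pair_iff] at hab ⊢
    intro s t h
    have := hab (-s - t) t (by rw [← h]; module)
    exact ⟨by linarith [this.1, this.2], this.2⟩
  have h2 := Linked.of_parallelogram_opposite (o := p + (2 : ℝ) • a) hF hab'
    fun s hs t ht => hKF (parallelogram_subset_of_convex hK hq (by convert hp using 1; module)
      (by convert hr using 1; module) s hs t ht)
  have e1 : p + (2 : ℝ) • a + -a = p + a := by module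
  have e2 : p + (2 : ℝ) • a + (b - a) = p + b + a := by module
  have e3 : p + b + a + -a = p + b := by module
  rw [e1, e2, e3] at h2
  have h3 : Linked F (p + (2 : ℝ) • a) (p + a) (p + b) (p + b + a) := (h2.symm.swap_left).symm
  refine Linked.trans ?_ h1.symm
  refine Linked.of_cover {(0 : ℝ), 1} (fun x => x) (fun _ => 1 / 2) ?_ ?_
  · intro s hs
    simp only [Finset.mem_insert, Finset.mem_singleton, iUnion_iUnion_eq_or_left,
      iUnion_iUnion_eq_left, mem_union, mem_uIcc]
    rcases le_total s (1 / 2) with h | h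
    · exact Or.inl (Or.inl ⟨hs.1, h⟩)
    · exact Or.inr (Or.inr ⟨h, hs.2⟩)
  · intro j hj _
    have e4 : (AffineMap.lineMap p (p + (2 : ℝ) • a) (1 / 2 : ℝ) : Plane) = p + a := by
      simp only [AffineMap.lineMap_apply_module]; module
    rw [e4]
    rcases Finset.mem_insert.1 hj with rfl | hj
    · simpa using h1
    · rw [Finset.mem_singleton.1 hj]; simpa using h3

/-- Two sides of a triangle are linked. -/
theorem Linked.of_triangle {F K : Set Plane} (hF : MeasurableSet F) (hK : Convex ℝ K)
    (hKF : K ⊆ F) {p q r : Plane} (hpqr : LinearIndependent ℝ ![q - p, r - p])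
    (hp : p ∈ K) (hq : q ∈ K) (hr : r ∈ K) : Linked F p q p r := by
  obtain ⟨a, rfl⟩ : ∃ a, q = p + (2 : ℝ) • a := ⟨(1 / 2 : ℝ) • (q - p), by module⟩
  obtain ⟨b, rfl⟩ : ∃ b, r = p + (2 : ℝ) • b := ⟨(1 / 2 : ℝ) • (r - p), by module⟩
  have hab : LinearIndependent ℝ ![a, b] := by
    rw [LinearIndependent.pair_iff] at hpqr ⊢
    intro s t h
    refine hpqr s t ?_
    rw [add_sub_cancel_left, add_sub_cancel_left, smul_comm s, smul_comm t, ← smul_add, h,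
      smul_zero]
  have hba : LinearIndependent ℝ ![b, a] := by
    rw [LinearIndependent.pair_iff] at hab ⊢
    intro s t h
    exact (hab t s (by rw [add_comm]; exact h)).symm
  exact ((Linked.half_side hF hK hKF hab hp hq hr).trans (Linked.of_parallelogram hF hab
    fun s hs t ht => hKF (parallelogram_subset_of_convex hK hp hq hr s hs t ht))).trans
    (Linked.half_side hF hK hKF hba hp hr hq).symm

/-- The points on the line through two points form a null set. -/
theorem volume_not_linearIndependent {p q : Plane} (h : p ≠ q) :
    volume {r : Plane | ¬ LinearIndependent ℝ ![q - p, r - p]} = 0 := by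
  refine measure_mono_null ?_
    (Measure.addHaar_affineSubspace volume (affineSpan ℝ {p, q}) ?_)
  · intro r hr
    rw [mem_ofPred_eq, LinearIndependent.pair_iff' (sub_ne_zero.2 h.symm)] at hr
    push Not at hr
    obtain ⟨a, ha⟩ := hr
    have : r = AffineMap.lineMap p q a := by
      rw [AffineMap.lineMap_apply, vsub_eq_sub, ha]; simp
    rw [this]
    exact AffineMap.lineMap_mem_affineSpan_pair a p q
  · intro htop
    have h1 : Collinear ℝ ({p, q} : Set Plane) := collinear_pair ℝ p q
    have h2 := collinear_iff_finrank_le_one.1 h1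
    rw [← direction_affineSpan, htop, AffineSubspace.direction_top, finrank_top] at h2
    simp at h2

/-- All segments in a convex subset with nonempty interior are linked. -/
theorem Linked.of_convex {F K : Set Plane} (hF : MeasurableSet F) (hK : Convex ℝ K)
    (hKF : K ⊆ F) (hint : (interior K).Nonempty) {p q p' q' : Plane} (hpq : p ≠ q)
    (hpq' : p' ≠ q') (hp : p ∈ K) (hq : q ∈ K) (hp' : p' ∈ K) (hq' : q' ∈ K) :
    Linked F p q p' q' := by
  have swap : ∀ {x y z : Plane}, LinearIndependent ℝ ![y - x, z - x] →
      LinearIndependent ℝ ![x - z, y - z] := by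
    intro x y z h
    rw [LinearIndependent.pair_iff] at h ⊢
    intro s t hst
    have := h t (-s - t) (by rw [← hst]; module)
    exact ⟨by linarith [this.1, this.2], this.1⟩
  have hnull : volume ({r : Plane | ¬ LinearIndependent ℝ ![q - p, r - p]} ∪
      {r : Plane | ¬ LinearIndependent ℝ ![q' - p', r - p']} ∪
      {r : Plane | p ≠ p' ∧ ¬ LinearIndependent ℝ ![p' - p, r - p]}) = 0 := by
    refine measure_union_null (measure_union_null (volume_not_linearIndependent hpq)
      (volume_not_linearIndependent hpq')) ?_
    by_cases h : p = p'
    · simp [h]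
    · refine measure_mono_null ?_ (volume_not_linearIndependent h)
      exact fun r hr => hr.2
  -- A point `r` off the three lines through `p q`, `p' q'` and `p p'` exists because lines are null
  -- sets. The chain is then `p q`, `p r`, `p' r`, `p' q'`, each step within a nondegenerate
  -- triangle.
  obtain ⟨r, hrK, hr⟩ : ∃ r ∈ interior K, r ∉ ({r : Plane | ¬ LinearIndependent ℝ ![q - p, r - p]} ∪
      {r : Plane | ¬ LinearIndependent ℝ ![q' - p', r - p']} ∪
      {r : Plane | p ≠ p' ∧ ¬ LinearIndependent ℝ ![p' - p, r - p]}) := by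
    by_contra! hcon
    exact (isOpen_interior.measure_pos volume hint).ne' (measure_mono_null hcon hnull)
  simp only [mem_union, mem_ofPred_eq, not_or, not_and, not_not] at hr
  obtain ⟨⟨h1, h2⟩, h3⟩ := hr
  have hr' := interior_subset hrK
  refine (Linked.of_triangle hF hK hKF h1 hp hq hr').trans
    (Linked.trans ?_ (Linked.of_triangle hF hK hKF h2 hp' hq' hr').symm)
  by_cases h : p = p'
  · subst h
    exact (Linked.of_triangle hF hK hKF h1 hp hq hr').symm.trans
      (Linked.of_triangle hF hK hKF h1 hp hq hr')
  · exact ((Linked.of_triangle hF hK hKF (swap (h3 h)) hr' hp hp').swap_left.symm.swap_left).symm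

open Classical in
/-- Every segment in a polygon is linked to itself. -/
theorem IsPolygon.linked_self {P : Set Plane} (hP : IsPolygon P) {p q : Plane} (hpq : p ≠ q)
    (hseg : segment ℝ p q ⊆ P) : Linked P p q p q := by
  obtain ⟨S, hS, hPS⟩ := hP.triangles
  have hcl : ∀ v ∈ S, IsCompact (convexHull ℝ (range v)) := fun v _ =>
    (finite_range v).isCompact_convexHull (𝕜 := ℝ)
  have hF : MeasurableSet P := by
    rw [hPS]
    exact Finset.measurableSet_biUnion _ fun v hv => (hcl v hv).isClosed.measurableSet
  have hsub : ∀ v ∈ S, convexHull ℝ (range v) ⊆ P := fun v hv => by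
    rw [hPS]; exact subset_biUnion_of_mem (u := fun v : Fin 3 → Plane => convexHull ℝ (range v)) hv
  have hint : ∀ v ∈ S, (interior (convexHull ℝ (range v))).Nonempty := by
    intro v hv
    refine (interior_convexHull_nonempty_iff_affineSpan_eq_top (V := Plane)).2 ?_
    exact (hS v hv).affineSpan_eq_top_iff_card_eq_finrank_add_one.2 (by simp)
  -- segments near two interior points are linked
  have chain : ∀ x ∈ interior P, ∀ y ∈ interior P, ∀ K K' : Set Plane, Convex ℝ K → K ⊆ P →
      K ∈ 𝓝 x → Convex ℝ K' → K' ⊆ P → K' ∈ 𝓝 y → ∀ a b a' b', a ∈ K → b ∈ K → a' ∈ K' →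
      b' ∈ K' → a ≠ b → a' ≠ b' → Linked P a b a' b' := by
    intro x hx y hy
    have nonempty_int : ∀ {K : Set Plane} {x : Plane}, K ∈ 𝓝 x → (interior K).Nonempty :=
      fun h => ⟨_, mem_interior_iff_mem_nhds.2 h⟩
    have pair : ∀ {K : Set Plane} {x : Plane}, K ∈ 𝓝 x → ∃ a ∈ K, ∃ b ∈ K, a ≠ b := by
      intro K x h
      obtain ⟨b, hb, hbx⟩ := (infinite_of_mem_nhds x h).nontrivial.exists_ne x
      exact ⟨x, mem_of_mem_nhds h, b, hb, hbx.symm⟩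
    refine hP.connected.isPreconnected.induction₂ (fun x y => ∀ K K' : Set Plane, Convex ℝ K →
      K ⊆ P → K ∈ 𝓝 x → Convex ℝ K' → K' ⊆ P → K' ∈ 𝓝 y → ∀ a b a' b', a ∈ K → b ∈ K →
      a' ∈ K' → b' ∈ K' → a ≠ b → a' ≠ b' → Linked P a b a' b') ?_ ?_ ?_ hx hy
    · intro x hx
      obtain ⟨ε, hε, hball⟩ := Metric.isOpen_iff.1 isOpen_interior x hx
      have hb : Metric.ball x ε ∈ 𝓝 x := Metric.ball_mem_nhds x hε
      filter_upwards [mem_nhdsWithin_of_mem_nhds hb] with y hy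
      intro K K' hK hKP hKx hK' hKP' hKy a b a' b' ha hb' ha' hb'' hab hab'
      obtain ⟨c, hc, d, hd, hcd⟩ := pair (inter_mem hKx hb)
      obtain ⟨c', hc', d', hd', hcd'⟩ := pair (inter_mem hKy (Metric.isOpen_ball.mem_nhds hy))
      exact (Linked.of_convex hF hK hKP (nonempty_int hKx) hab hcd ha hb' hc.1 hd.1).trans
        ((Linked.of_convex hF (convex_ball x ε) (hball.trans interior_subset)
          (nonempty_int hb) hcd hcd' hc.2 hd.2 hc'.2 hd'.2).trans
        (Linked.of_convex hF hK' hKP' (nonempty_int hKy) hcd' hab' hc'.1 hd'.1 ha' hb''))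
    · intro x y z _ hy _ h1 h2 K K' hK hKP hKx hK' hKP' hKz a b a' b' ha hb ha' hb' hab hab'
      obtain ⟨ε, hε, hball⟩ := Metric.isOpen_iff.1 isOpen_interior y hy
      have hbn : Metric.ball y ε ∈ 𝓝 y := Metric.ball_mem_nhds y hε
      obtain ⟨c, hc, d, hd, hcd⟩ := pair hbn
      exact (h1 K _ hK hKP hKx (convex_ball y ε) (hball.trans interior_subset) hbn a b c d
        ha hb hc hd hab hcd).trans (h2 _ K' (convex_ball y ε) (hball.trans interior_subset) hbn
        hK' hKP' hKz c d a' b' hc hd ha' hb' hcd hab')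
    · intro x y _ _ h K K' hK hKP hKx hK' hKP' hKy a b a' b' ha hb ha' hb' hab hab'
      exact (h K' K hK' hKP' hKy hK hKP hKx a' b' a b ha' hb' ha hb hab' hab).symm
  -- segments in the triangles are linked
  have tri : ∀ v ∈ S, ∀ v' ∈ S, ∀ a b a' b', a ∈ convexHull ℝ (range v) →
      b ∈ convexHull ℝ (range v) → a' ∈ convexHull ℝ (range v') →
      b' ∈ convexHull ℝ (range v') → a ≠ b → a' ≠ b' → Linked P a b a' b' := by
    intro v hv v' hv' a b a' b' ha hb ha' hb' hab hab'
    obtain ⟨x, hx⟩ := hint v hv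
    obtain ⟨y, hy⟩ := hint v' hv'
    exact chain x (interior_mono (hsub v hv) hx) y (interior_mono (hsub v' hv') hy) _ _
      (convex_convexHull ℝ _) (hsub v hv) (mem_interior_iff_mem_nhds.1 hx)
      (convex_convexHull ℝ _) (hsub v' hv') (mem_interior_iff_mem_nhds.1 hy)
      a b a' b' ha hb ha' hb' hab hab'
  obtain ⟨v₀, hv₀, -⟩ : ∃ v₀ ∈ S, p ∈ convexHull ℝ (range v₀) := by
    have := hseg (left_mem_segment ℝ p q)
    rw [hPS] at this
    simpa using this
  have hne : v₀ 0 ≠ v₀ 1 := (hS v₀ hv₀).injective.ne (by decide)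
  have hv0 : ∀ i, v₀ i ∈ convexHull ℝ (range v₀) := fun i =>
    subset_convexHull ℝ _ (mem_range_self i)
  suffices h : Linked P p q (v₀ 0) (v₀ 1) from h.trans h.symm
  -- The parameters for which the segment is in a given triangle. The pieces between their extreme
  -- values cover the segment, each lies in one triangle, and all are linked to one fixed side of
  -- `v₀`; pieces that shrink to a point contribute nothing.
  let I : (Fin 3 → Plane) → Set ℝ := fun v =>
    Icc 0 1 ∩ (fun s : ℝ => (AffineMap.lineMap p q s : Plane)) ⁻¹' convexHull ℝ (range v)
  have hIc : ∀ v ∈ S, IsCompact (I v) := fun v hv =>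
    isCompact_Icc.inter_right ((hcl v hv).isClosed.preimage AffineMap.lineMap_continuous)
  refine Linked.of_cover (S.filter fun v => (I v).Nonempty) (fun v => sInf (I v))
    (fun v => sSup (I v)) ?_ ?_
  · intro s hs
    have : (AffineMap.lineMap p q s : Plane) ∈ P :=
      hseg (by rw [segment_eq_image_lineMap]; exact ⟨s, hs, rfl⟩)
    rw [hPS] at this
    obtain ⟨v, hv, hsv⟩ := mem_iUnion₂.1 this
    have hsI : s ∈ I v := ⟨hs, hsv⟩
    refine mem_iUnion₂.2 ⟨v, Finset.mem_filter.2 ⟨hv, ⟨s, hsI⟩⟩, ?_⟩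
    exact mem_uIcc.2 (Or.inl ⟨csInf_le (hIc v hv).bddBelow hsI,
      le_csSup (hIc v hv).bddAbove hsI⟩)
  · intro v hv hαβ
    obtain ⟨hv, hne'⟩ := Finset.mem_filter.1 hv
    have h1 := (hIc v hv).sInf_mem hne'
    have h2 := (hIc v hv).sSup_mem hne'
    exact tri v hv v₀ hv₀ _ _ _ _ h1.2 h2.2 (hv0 0) (hv0 1)
      (fun h => hαβ (AffineMap.lineMap_injective ℝ hpq h)) hne

/-! ### Triangular meshes -/

theorem AffineMap.map_sum_smul (g : Plane →ᵃ[ℝ] ℝ) (s : Finset Plane) (w : Plane → ℝ)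
    (hw : ∑ y ∈ s, w y = 1) : g (∑ y ∈ s, w y • y) = ∑ y ∈ s, w y * g y := by
  have h : ∀ x, g x = g.linear x + g 0 := fun x => congrFun g.decomp x
  rw [h, map_sum, Finset.sum_congr rfl fun y _ => congrArg (w y * ·) (h y)]
  simp only [mul_add, Finset.sum_add_distrib, ← Finset.sum_mul, hw, map_smul, smul_eq_mul,
    one_mul]

theorem exists_affine_interpolation {T : Finset Plane}
    (hT : AffineIndependent ℝ ((↑) : T → Plane)) (hcard : T.card = 3) (c : Plane → ℝ) :
    ∃ g : Plane →ᵃ[ℝ] ℝ, ∀ y ∈ T, g y = c y := by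
  classical
  let b : AffineBasis T ℝ Plane := ⟨(↑), hT,
    hT.affineSpan_eq_top_iff_card_eq_finrank_add_one.2 (by simp [hcard])⟩
  refine ⟨∑ z : T, c z • b.coord z, fun y hy => ?_⟩
  have h1 : ∀ z : T, b.coord z y = if (⟨y, hy⟩ : T) = z then 1 else 0 := fun z => by
    have h := b.coord_apply z ⟨y, hy⟩
    simp only [eq_comm (a := z)] at h
    exact h
  have h2 : (∑ z : T, c z • b.coord z) y = ∑ z : T, c z * b.coord z y := by
    induction (Finset.univ : Finset T) using Finset.induction_on with
    | empty => simp
    | insert z s hz ih =>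
      rw [Finset.sum_insert hz, Finset.sum_insert hz, ← ih]; rfl
  rw [h2]
  simp [h1]

namespace IsTriangularMesh

variable {K : Geometry.SimplicialComplex ℝ Plane}

open Classical in
/-- The triangles of a mesh. -/
noncomputable def tris (hK : IsTriangularMesh K) : Finset (Finset Plane) :=
  hK.finite.toFinset.filter fun T => T.card = 3

theorem mem_tris (hK : IsTriangularMesh K) {T : Finset Plane} :
    T ∈ hK.tris ↔ T ∈ K.faces ∧ T.card = 3 := by
  simp [tris]

theorem isClosed_convexHull_finset (T : Finset Plane) :
    IsClosed (convexHull ℝ (T : Set Plane)) := T.finite_toSet.isClosed_convexHull ℝ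

theorem isCompact_convexHull_finset (T : Finset Plane) :
    IsCompact (convexHull ℝ (T : Set Plane)) := T.finite_toSet.isCompact_convexHull ℝ

theorem exists_tri (hK : IsTriangularMesh K) {x : Plane} (hx : x ∈ K.space) :
    ∃ T ∈ hK.tris, x ∈ convexHull ℝ (T : Set Plane) := by
  obtain ⟨s, hs, hxs⟩ := Geometry.SimplicialComplex.mem_space_iff.1 hx
  obtain ⟨T, hT, hsT, hcard⟩ := hK.pure s hs
  exact ⟨T, hK.mem_tris.2 ⟨hT, hcard⟩, convexHull_mono (by exact_mod_cast hsT) hxs⟩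

theorem convexHull_subset (hK : IsTriangularMesh K) {T : Finset Plane} (hT : T ∈ hK.tris) :
    convexHull ℝ (T : Set Plane) ⊆ K.space :=
  Geometry.SimplicialComplex.convexHull_subset_space (hK.mem_tris.1 hT).1

theorem interior_nonempty (hK : IsTriangularMesh K) {T : Finset Plane} (hT : T ∈ hK.tris) :
    (interior (convexHull ℝ (T : Set Plane))).Nonempty := by
  refine (interior_convexHull_nonempty_iff_affineSpan_eq_top (V := Plane)).2 ?_
  have h := (K.indep (hK.mem_tris.1 hT).1).affineSpan_eq_top_iff_card_eq_finrank_add_one.2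
    (by simp [(hK.mem_tris.1 hT).2])
  simpa using h

/-- Two faces of a complex meet in the hull of their common vertices. If the interiors meet, this
hull has interior points, so there are three common vertices and the triangles coincide. -/
theorem disjoint_interior (hK : IsTriangularMesh K) {T T' : Finset Plane} (hT : T ∈ hK.tris)
    (hT' : T' ∈ hK.tris) (hne : T ≠ T') : Disjoint (interior (convexHull ℝ (T : Set Plane)))
      (interior (convexHull ℝ (T' : Set Plane))) := by
  classical
  rw [Set.disjoint_iff_inter_eq_empty, ← interior_inter]
  by_contra hcon
  have hne' := nonempty_iff_ne_empty.2 hcon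
  rw [Geometry.SimplicialComplex.convexHull_inter_convexHull (hK.mem_tris.1 hT).1
    (hK.mem_tris.1 hT').1, ← Finset.coe_inter] at hne'
  have htop := (interior_convexHull_nonempty_iff_affineSpan_eq_top (V := Plane)).1 hne'
  have hind : AffineIndependent ℝ ((↑) : (T ∩ T' : Finset Plane) → Plane) :=
    AffineIndependent.mono (t := (T : Set Plane)) (s := ((T ∩ T' : Finset Plane) : Set Plane))
      (K.indep (hK.mem_tris.1 hT).1) (Finset.coe_subset.2 Finset.inter_subset_left)
  have hc := hind.affineSpan_eq_top_iff_card_eq_finrank_add_one.1 (by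
    rw [Subtype.range_coe_subtype]; exact htop)
  rw [finrank_euclideanSpace_fin, Fintype.card_coe] at hc
  have h1 : T ∩ T' = T := Finset.eq_of_subset_of_card_le Finset.inter_subset_left
    (by rw [hc, (hK.mem_tris.1 hT).2])
  have h2 : T ∩ T' = T' := Finset.eq_of_subset_of_card_le Finset.inter_subset_right
    (by rw [hc, (hK.mem_tris.1 hT').2])
  exact hne (h1.symm.trans h2)

theorem space_subset_closure_interior (hK : IsTriangularMesh K) :
    K.space ⊆ closure (interior K.space) := by
  intro x hx
  obtain ⟨T, hT, hxT⟩ := hK.exists_tri hx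
  refine closure_mono (interior_mono (hK.convexHull_subset hT)) ?_
  rw [(convex_convexHull ℝ _).closure_interior_eq_closure_of_nonempty_interior
    (hK.interior_nonempty hT)]
  exact subset_closure hxT

/-- The union of the boundaries of the triangles. -/
noncomputable def skeleton (hK : IsTriangularMesh K) : Set Plane :=
  ⋃ T ∈ hK.tris, frontier (convexHull ℝ (T : Set Plane))

theorem measurableSet_skeleton (hK : IsTriangularMesh K) : MeasurableSet hK.skeleton :=
  Finset.measurableSet_biUnion _ fun _ _ => isClosed_frontier.measurableSet

theorem volume_skeleton (hK : IsTriangularMesh K) : volume hK.skeleton = 0 :=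
  (measure_biUnion_null_iff hK.tris.countable_toSet).2 fun _ _ =>
    (convex_convexHull ℝ _).addHaar_frontier volume

theorem mem_interior (hK : IsTriangularMesh K) {x : Plane} (hx : x ∉ hK.skeleton)
    {T : Finset Plane} (hT : T ∈ hK.tris) (hxT : x ∈ convexHull ℝ (T : Set Plane)) :
    x ∈ interior (convexHull ℝ (T : Set Plane)) := by
  by_contra h
  exact hx (mem_iUnion₂.2 ⟨T, hT, subset_closure hxT, h⟩)

theorem isCompact_space (hK : IsTriangularMesh K) : IsCompact K.space := by
  have : K.space = ⋃ T ∈ hK.tris, convexHull ℝ (T : Set Plane) := by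
    refine subset_antisymm (fun x hx => ?_) (iUnion₂_subset fun T hT => hK.convexHull_subset hT)
    obtain ⟨T, hT, h⟩ := hK.exists_tri hx
    exact mem_iUnion₂.2 ⟨T, hT, h⟩
  rw [this]
  exact hK.tris.isCompact_biUnion fun T _ => isCompact_convexHull_finset T

end IsTriangularMesh

/-! ### Nodal functions -/

/-- A point of two faces lies in the hull of their common vertices. Its coordinates there, extended
by zero, are barycentric for both faces, so uniqueness within one face gives the claim. This makes
the choice in `hat` immaterial. -/
theorem IsBarycentric.eq {K : Geometry.SimplicialComplex ℝ Plane} {x : Plane} {w w' : Plane → ℝ}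
    (h : IsBarycentric K x w) (h' : IsBarycentric K x w') : w = w' := by
  classical
  have uniq : ∀ s ∈ K.faces, ∀ v v' : Plane → ℝ, (∀ y, y ∉ s → v y = 0) → ∑ y ∈ s, v y = 1 →
      ∑ y ∈ s, v y • y = x → (∀ y, y ∉ s → v' y = 0) → ∑ y ∈ s, v' y = 1 →
      ∑ y ∈ s, v' y • y = x → v = v' := by
    intro s hs v v' hv1 hv2 hv3 hv1' hv2' hv3'
    have hind := K.indep hs
    rw [affineIndependent_iff_eq_of_fintype_affineCombination_eq] at hind
    have e : ∀ u : Plane → ℝ, ∑ y ∈ s, u y = 1 →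
        (Finset.univ : Finset s).affineCombination ℝ ((↑) : s → Plane) (fun y => u y) =
          ∑ y ∈ s, u y • y := by
      intro u hu
      rw [Finset.affineCombination_eq_linear_combination _ _ _
        (by rw [Finset.sum_coe_sort s u]; exact hu), Finset.sum_coe_sort s fun y => u y • y]
    have := hind (fun y => v y) (fun y => v' y) (by rw [Finset.sum_coe_sort s v]; exact hv2)
      (by rw [Finset.sum_coe_sort s v']; exact hv2') (by rw [e v hv2, e v' hv2', hv3, hv3'])
    funext y
    by_cases hy : y ∈ s
    · exact congrFun this ⟨y, hy⟩
    · rw [hv1 y hy, hv1' y hy]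
  obtain ⟨s, hs, h0, h1, h2, h3⟩ := h
  obtain ⟨s', hs', h0', h1', h2', h3'⟩ := h'
  have hx : x ∈ convexHull ℝ (s : Set Plane) :=
    (Finset.mem_convexHull').2 ⟨w, fun y _ => h0 y, h2, h3⟩
  have hx' : x ∈ convexHull ℝ (s' : Set Plane) :=
    (Finset.mem_convexHull').2 ⟨w', fun y _ => h0' y, h2', h3'⟩
  have hxi := K.inter_subset_convexHull hs hs' ⟨hx, hx'⟩
  rw [← Finset.coe_inter] at hxi
  obtain ⟨v, -, hv1, hv2⟩ := (Finset.mem_convexHull').1 hxi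
  set v' : Plane → ℝ := fun y => if y ∈ s ∩ s' then v y else 0 with hv'
  have ext : ∀ t : Finset Plane, s ∩ s' ⊆ t → ∑ y ∈ t, v' y = 1 ∧ ∑ y ∈ t, v' y • y = x := by
    intro t ht
    constructor
    · rw [← hv1, ← Finset.sum_subset ht (f := v') fun y _ hy => by simp only [hv', if_neg hy]]
      exact Finset.sum_congr rfl fun y hy => if_pos hy
    · rw [← hv2, ← Finset.sum_subset ht (f := fun y => v' y • y)
        fun y _ hy => by simp only [hv', if_neg hy, zero_smul]]
      exact Finset.sum_congr rfl fun y hy => by simp only [hv', if_pos hy]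
  have z : ∀ t : Finset Plane, s ∩ s' ⊆ t → ∀ y, y ∉ t → v' y = 0 := fun t ht y hy =>
    if_neg fun h => hy (ht h)
  have l := Finset.inter_subset_left (s₁ := s) (s₂ := s')
  have r := Finset.inter_subset_right (s₁ := s) (s₂ := s')
  exact (uniq s hs w v' h1 h2 h3 (z s l) (ext s l).1 (ext s l).2).trans
    (uniq s' hs' w' v' h1' h2' h3' (z s' r) (ext s' r).1 (ext s' r).2).symm

theorem hat_eq {K : Geometry.SimplicialComplex ℝ Plane} {x : Plane} {w : Plane → ℝ}
    (h : IsBarycentric K x w) (z : Plane) : hat K z x = w z := by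
  have hex : ∃ w, IsBarycentric K x w := ⟨w, h⟩
  rw [hat, dif_pos hex, hex.choose_spec.eq h]

theorem exists_barycentric {x : Plane} {s : Finset Plane} (hx : x ∈ convexHull ℝ (s : Set Plane)) :
    ∃ w : Plane → ℝ, (∀ y, 0 ≤ w y) ∧ (∀ y, y ∉ s → w y = 0) ∧ ∑ y ∈ s, w y = 1 ∧
      ∑ y ∈ s, w y • y = x := by
  classical
  obtain ⟨w, hw0, hw1, hw2⟩ := (Finset.mem_convexHull').1 hx
  refine ⟨fun y => if y ∈ s then w y else 0, fun y => ?_, fun y hy => if_neg hy, ?_, ?_⟩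
  · dsimp only; split_ifs with h
    · exact hw0 y h
    · exact le_rfl
  · rw [← hw1]; exact Finset.sum_congr rfl fun y hy => if_pos hy
  · rw [← hw2]; exact Finset.sum_congr rfl fun y hy => by simp only [if_pos hy]

theorem hat_eq_zero {K : Geometry.SimplicialComplex ℝ Plane} {x : Plane} (hx : x ∉ K.space)
    (z : Plane) : hat K z x = 0 := by
  rw [hat, dif_neg]
  rintro ⟨w, s, hs, h0, -, h1, h2⟩
  exact hx (Geometry.SimplicialComplex.convexHull_subset_space hs
    ((Finset.mem_convexHull').2 ⟨w, fun y _ => h0 y, h1, h2⟩))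

open Classical in
theorem hat_vertex {K : Geometry.SimplicialComplex ℝ Plane} {y : Plane} {s : Finset Plane}
    (hs : s ∈ K.faces) (hy : y ∈ s) (z : Plane) : hat K z y = if y = z then 1 else 0 := by
  have : IsBarycentric K y fun x => if y = x then 1 else 0 := by
    refine ⟨s, hs, fun x => ?_, fun x hx => ?_, ?_, ?_⟩
    · dsimp only; split_ifs <;> norm_num
    · exact if_neg fun h : y = x => hx (h ▸ hy)
    · simp [hy]
    · simp [hy]
  rw [hat_eq this]

open Classical in
/-- On each face, the nodal functions are the barycentric coordinates. -/
theorem exists_affine_hat {K : Geometry.SimplicialComplex ℝ Plane} {T : Finset Plane}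
    (hT : T ∈ K.faces) (hcard : T.card = 3) (z : Plane) :
    ∃ g : Plane →ᵃ[ℝ] ℝ, EqOn (hat K z) g (convexHull ℝ (T : Set Plane)) := by
  obtain ⟨g, hg⟩ := exists_affine_interpolation (K.indep hT) hcard fun y => if y = z then 1 else 0
  refine ⟨g, fun x hx => ?_⟩
  obtain ⟨w, hw0, hw1, hw2, hw3⟩ := exists_barycentric hx
  rw [hat_eq ⟨T, hT, hw0, hw1, hw2, hw3⟩, ← hw3, g.map_sum_smul T w hw2,
    Finset.sum_congr rfl fun y hy => by rw [hg y hy]]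
  by_cases hz : z ∈ T
  · simp [hz]
  · simp [hz, hw1 z hz]

open Classical in
/-- The nodal functions on an edge. -/
theorem hat_lineMap {K : Geometry.SimplicialComplex ℝ Plane} {e : Finset Plane}
    (he : e ∈ K.faces) {p q : Plane} (hpq : p ≠ q) (hepq : (e : Set Plane) = {p, q}) (z : Plane)
    {s : ℝ} (hs : s ∈ Icc (0 : ℝ) 1) : hat K z (AffineMap.lineMap p q s) =
      (1 - s) * (if p = z then 1 else 0) + s * (if q = z then 1 else 0) := by
  have he' : e = {p, q} := by
    apply Finset.coe_injective; rw [hepq]; simp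
  have : IsBarycentric K (AffineMap.lineMap p q s) fun x =>
      (1 - s) * (if p = x then 1 else 0) + s * (if q = x then 1 else 0) := by
    refine ⟨e, he, fun x => ?_, fun x hx => ?_, ?_, ?_⟩
    · have h1 := hs.1; have h2 := hs.2
      dsimp only
      split_ifs <;> linarith
    · rw [he'] at hx
      simp only [Finset.mem_insert, Finset.mem_singleton, not_or] at hx
      dsimp only
      rw [if_neg (Ne.symm hx.1), if_neg (Ne.symm hx.2)]; ring
    · rw [he', Finset.sum_pair hpq]; simp [hpq, hpq.symm]
    · rw [he', Finset.sum_pair hpq]; simp [hpq, hpq.symm, AffineMap.lineMap_apply_module]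
  rw [hat_eq this]

/-! ### Gradients of piecewise affine functions -/

/-- The squared length of the gradient. -/
noncomputable def gradSq (v : Plane → ℝ) (x : Plane) : ℝ := ∑ a, (Discretization.pd a v x) ^ 2

theorem gradSq_nonneg (v : Plane → ℝ) (x : Plane) : 0 ≤ gradSq v x :=
  Finset.sum_nonneg fun _ _ => sq_nonneg _

theorem measurable_pd (a : Fin 2) (v : Plane → ℝ) : Measurable (Discretization.pd a v) :=
  measurable_fderiv_apply_const ℝ v _

theorem measurable_gradSq (v : Plane → ℝ) : Measurable (gradSq v) :=
  Finset.measurable_sum _ fun a _ => (measurable_pd a v).pow_const 2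

/-- Cauchy–Schwarz in coordinates; it connects the operator norm in the upper gradient with the `H¹`
seminorm. -/
theorem enorm_fderiv_le (v : Plane → ℝ) (x : Plane) :
    ‖fderiv ℝ v x‖ₑ ≤ ENNReal.ofReal (√(gradSq v x)) := by
  rw [← ofReal_norm]
  refine ENNReal.ofReal_le_ofReal (ContinuousLinearMap.opNorm_le_bound _ (Real.sqrt_nonneg _) ?_)
  intro y
  have hy : y = ∑ a, y a • EuclideanSpace.single a (1 : ℝ) := by
    ext i; fin_cases i <;> simp [Fin.sum_univ_two]
  have h1 : fderiv ℝ v x y = ∑ a, Discretization.pd a v x * y a := by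
    conv_lhs => rw [hy]
    rw [map_sum]
    exact Finset.sum_congr rfl fun a _ => by rw [map_smul, smul_eq_mul, mul_comm]; rfl
  rw [h1, Real.norm_eq_abs, EuclideanSpace.norm_eq]
  simp only [Real.norm_eq_abs, sq_abs]
  rw [← Real.sqrt_mul (gradSq_nonneg v x)]
  exact Real.abs_le_sqrt (Finset.sum_mul_sq_le_sq_mul_sq _ _ _)

/-- The derivative of a function that is affine on a neighbourhood. -/
theorem hasFDerivAt_of_eqOn {v : Plane → ℝ} {g : Plane →ᵃ[ℝ] ℝ} {S : Set Plane} (h : EqOn v g S)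
    {x : Plane} (hx : x ∈ interior S) :
    HasFDerivAt v (LinearMap.toContinuousLinearMap g.linear) x := by
  have h1 : HasFDerivAt g (LinearMap.toContinuousLinearMap g.linear) x := by
    have h2 : (g : Plane → ℝ) = fun y => LinearMap.toContinuousLinearMap g.linear y + g 0 :=
      funext fun y => congrFun g.decomp y
    rw [h2]
    exact (ContinuousLinearMap.hasFDerivAt _).add_const _
  exact h1.congr_of_eventuallyEq (h.eventuallyEq_of_mem (mem_interior_iff_mem_nhds.1 hx))

namespace IsTriangularMesh

variable {K : Geometry.SimplicialComplex ℝ Plane}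

theorem ae_mem_interior (hK : IsTriangularMesh K) :
    ∀ᵐ x, x ∈ K.space → ∃ T ∈ hK.tris, x ∈ interior (convexHull ℝ (T : Set Plane)) := by
  have h0 := measure_eq_zero_iff_ae_notMem.1 hK.volume_skeleton
  filter_upwards [h0] with x hx hxs
  obtain ⟨T, hT, h⟩ := hK.exists_tri hxs
  exact ⟨T, hT, hK.mem_interior hx hT h⟩

theorem exists_affine (hK : IsTriangularMesh K) {v : Plane → ℝ} (hv : IsP1 K v) :
    ∃ g : Finset Plane → (Plane →ᵃ[ℝ] ℝ), ∀ T ∈ hK.tris,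
      EqOn v (g T) (convexHull ℝ (T : Set Plane)) := by
  choose! g hg using hv
  exact ⟨g, fun T hT => hg T (hK.mem_tris.1 hT).1 (hK.mem_tris.1 hT).2⟩

theorem ae_differentiableAt (hK : IsTriangularMesh K) {v : Plane → ℝ} (hv : IsP1 K v) :
    ∀ᵐ x, x ∈ K.space → DifferentiableAt ℝ v x := by
  obtain ⟨g, hg⟩ := hK.exists_affine hv
  filter_upwards [hK.ae_mem_interior] with x hx hxs
  obtain ⟨T, hT, h⟩ := hx hxs
  exact (hasFDerivAt_of_eqOn (hg T hT) h).differentiableAt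

/-- Only finitely many slopes occur. The bound depends on the mesh and on `v`; it serves for
integrability, never for an estimate. -/
theorem exists_pd_bound (hK : IsTriangularMesh K) {v : Plane → ℝ} (hv : IsP1 K v) :
    ∃ B : ℝ, ∀ᵐ x, x ∈ K.space → ∀ a, |Discretization.pd a v x| ≤ B := by
  obtain ⟨g, hg⟩ := hK.exists_affine hv
  refine ⟨∑ T ∈ hK.tris, ∑ a, |(g T).linear (EuclideanSpace.single a 1)|, ?_⟩
  filter_upwards [hK.ae_mem_interior] with x hx hxs a
  obtain ⟨T, hT, h⟩ := hx hxs
  rw [Discretization.pd, (hasFDerivAt_of_eqOn (hg T hT) h).fderiv]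
  refine le_trans ?_ (Finset.single_le_sum (f := fun T => ∑ a : Fin 2,
    |(g T).linear (EuclideanSpace.single a 1)|) (fun T _ => Finset.sum_nonneg fun _ _ =>
      abs_nonneg _) hT)
  exact Finset.single_le_sum (f := fun a : Fin 2 =>
    |(g T).linear (EuclideanSpace.single a 1)|) (fun _ _ => abs_nonneg _) (Finset.mem_univ a)

/-- A continuous piecewise affine function has an upper gradient that is almost everywhere equal to
the length of its gradient. -/
theorem upperGradient (hK : IsTriangularMesh K) {v : Plane → ℝ} (hv : IsP1 K v)
    (hc : ContinuousOn v K.space) :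
    UpperGradient K.space (K.space.indicator v)
      (fun x => hK.skeleton.indicator (fun _ => ⊤) x + ‖fderiv ℝ v x‖ₑ) := by
  obtain ⟨g, hg⟩ := hK.exists_affine hv
  have hmeas : Measurable (K.space.indicator v) := by
    classical
    have h1 := hc.measurable_piecewise (g := fun _ : Plane => (0 : ℝ)) continuousOn_const
      hK.isCompact_space.measurableSet
    rwa [← Set.piecewise_eq_indicator]
  refine ⟨hmeas, ?_, ?_⟩
  · exact (measurable_const.indicator hK.measurableSet_skeleton).add
      (measurable_fderiv ℝ v).enorm
  intro p q hpq s hs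
  rcases eq_or_ne p q with rfl | hne
  · simp
  set γ : ℝ → Plane := fun s => AffineMap.lineMap p q s with hγ
  have hγc : Continuous γ := AffineMap.lineMap_continuous
  have hγm : ∀ s ∈ Icc (0 : ℝ) 1, γ s ∈ K.space := fun s hs =>
    hpq (by rw [segment_eq_image_lineMap]; exact ⟨s, hs, rfl⟩)
  set φ : ℝ → ℝ := fun s => K.space.indicator v (γ s) with hφ
  have hφv : ∀ s, γ s ∈ K.space → φ s = v (γ s) := fun s h => indicator_of_mem h v
  let I : Finset Plane → Set ℝ := fun T => γ ⁻¹' convexHull ℝ (T : Set Plane)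
  have hIcompact : ∀ T, IsCompact (I T) := by
    intro T
    refine Metric.isCompact_of_isClosed_isBounded
      ((isClosed_convexHull_finset T).preimage hγc) ?_
    obtain ⟨R, hR⟩ := (isCompact_convexHull_finset T).isBounded.subset_closedBall p
    refine (Metric.isBounded_closedBall (x := (0 : ℝ)) (r := R / dist p q)).subset fun s hs => ?_
    have h1 := hR hs
    rw [Metric.mem_closedBall, dist_lineMap_left] at h1
    rw [Metric.mem_closedBall, dist_zero_right, le_div_iff₀ (dist_pos.2 hne)]
    exact h1
  -- The line meets each triangle in a compact interval, which has at most two boundary points. Away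
  -- from these, the function is affine along the line near each parameter.
  have hIcountable : (⋃ T ∈ hK.tris, frontier (I T)).Countable := by
    refine hK.tris.countable_toSet.biUnion fun T _ => ?_
    rcases (I T).eq_empty_or_nonempty with h | h
    · simp [h]
    · have hconv : Convex ℝ (I T) := (convex_convexHull ℝ _).affine_preimage
        (AffineMap.lineMap p q : ℝ →ᵃ[ℝ] Plane)
      rw [eq_Icc_of_connected_compact ⟨h, hconv.isPreconnected⟩ (hIcompact T),
        frontier_Icc (csInf_le_csSup h (hIcompact T).bddBelow (hIcompact T).bddAbove)]
      exact (Set.toFinite _).countable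
  -- the derivative at all but countably many points
  have hder : ∀ r ∈ Icc (0 : ℝ) 1, r ∉ ⋃ T ∈ hK.tris, frontier (I T) →
      ∃ T ∈ hK.tris, γ r ∈ convexHull ℝ (T : Set Plane) ∧
        HasDerivAt φ ((g T).linear (q - p)) r := by
    intro r hr hrI
    obtain ⟨T, hT, hrT⟩ := hK.exists_tri (hγm r hr)
    refine ⟨T, hT, hrT, ?_⟩
    have hint : r ∈ interior (I T) := by
      by_contra h
      exact hrI (mem_iUnion₂.2 ⟨T, hT, subset_closure hrT, h⟩)
    have h1 : φ =ᶠ[𝓝 r] fun s => (g T).linear (s • (q - p)) + (g T) p := by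
      filter_upwards [mem_interior_iff_mem_nhds.1 hint] with s hs
      rw [hφv s (hK.convexHull_subset hT hs), hg T hT hs]
      simp only [hγ, AffineMap.lineMap_apply]
      exact (g T).map_vadd p _
    refine HasDerivAt.congr_of_eventuallyEq ?_ h1
    simp_rw [map_smul, smul_eq_mul]
    simpa using ((hasDerivAt_id r).mul_const ((g T).linear (q - p))).add_const ((g T) p)
  have hbound : ∀ r ∈ Icc (0 : ℝ) 1, r ∉ ⋃ T ∈ hK.tris, frontier (I T) →
      ‖deriv φ r‖ ≤ ∑ T ∈ hK.tris, ‖(g T).linear (q - p)‖ := by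
    intro r hr hrI
    obtain ⟨T, hT, -, h⟩ := hder r hr hrI
    rw [h.deriv]
    exact Finset.single_le_sum (f := fun T => ‖(g T).linear (q - p)‖)
      (fun _ _ => norm_nonneg _) hT
  -- The value `⊤` on the skeleton covers segments that run along edges, where the full derivative
  -- need not exist. Integrals over the region do not see it, since the skeleton is a null set.
  have hgrad : ∀ r ∈ Icc (0 : ℝ) 1, r ∉ ⋃ T ∈ hK.tris, frontier (I T) →
      ‖deriv φ r‖ₑ ≤ ‖q - p‖ₑ *
        (hK.skeleton.indicator (fun _ => ⊤) (γ r) + ‖fderiv ℝ v (γ r)‖ₑ) := by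
    intro r hr hrI
    obtain ⟨T, hT, hrT, h⟩ := hder r hr hrI
    by_cases hsk : γ r ∈ hK.skeleton
    · rw [indicator_of_mem hsk, top_add, ENNReal.mul_top]
      · exact le_top
      · simpa [sub_eq_zero] using hne.symm
    · rw [indicator_of_notMem hsk, zero_add, h.deriv,
        (hasFDerivAt_of_eqOn (hg T hT) (hK.mem_interior hsk hT hrT)).fderiv, mul_comm]
      exact ContinuousLinearMap.le_opENorm
        (LinearMap.toContinuousLinearMap (g T).linear) (q - p)
  have hae : ∀ᵐ r : ℝ, r ∉ ⋃ T ∈ hK.tris, frontier (I T) :=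
    measure_eq_zero_iff_ae_notMem.1 (hIcountable.measure_zero _)
  have hφm : Measurable (deriv φ) := measurable_deriv φ
  have hInt : IntervalIntegrable (deriv φ) volume 0 s := by
    rw [intervalIntegrable_iff_integrableOn_Ioc_of_le hs.1]
    refine Measure.integrableOn_of_bounded (M := ∑ T ∈ hK.tris, ‖(g T).linear (q - p)‖)
      (by simp) hφm.aestronglyMeasurable ?_
    rw [ae_restrict_iff' measurableSet_Ioc]
    filter_upwards [hae] with r hr hrs
    exact hbound r ⟨hrs.1.le, hrs.2.trans hs.2⟩ hr
  have hφc : ContinuousOn φ (Icc 0 s) := by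
    have h1 : ContinuousOn (v ∘ γ) (Icc 0 s) := hc.comp hγc.continuousOn
      fun r hr => hγm r ⟨hr.1, hr.2.trans hs.2⟩
    exact h1.congr fun r hr => hφv r (hγm r ⟨hr.1, hr.2.trans hs.2⟩)
  have hftc := integral_eq_of_hasDerivAt_off_countable_of_le φ (deriv φ) hs.1 hIcountable hφc
    (fun r hr => by
      obtain ⟨T, hT, -, h⟩ := hder r ⟨hr.1.1.le, hr.1.2.le.trans hs.2⟩ hr.2
      exact h.differentiableAt.hasDerivAt) hInt
  have hp : K.space.indicator v p = φ 0 := by simp [hφ, hγ]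
  change ‖φ s - K.space.indicator v p‖ₑ ≤ _
  rw [hp, ← hftc, intervalIntegral.integral_of_le hs.1]
  calc ‖∫ r in Ioc 0 s, deriv φ r‖ₑ ≤ ∫⁻ r in Ioc 0 s, ‖deriv φ r‖ₑ :=
        enorm_integral_le_lintegral_enorm _
    _ ≤ ∫⁻ r in Icc 0 1, ‖deriv φ r‖ₑ := lintegral_mono_set
        (Ioc_subset_Icc_self.trans (Icc_subset_Icc le_rfl hs.2))
    _ ≤ ∫⁻ r in Icc (0 : ℝ) 1, ‖q - p‖ₑ *
        (hK.skeleton.indicator (fun _ => ⊤) (γ r) + ‖fderiv ℝ v (γ r)‖ₑ) := by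
        refine lintegral_mono_ae ?_
        rw [ae_restrict_iff' measurableSet_Icc]
        filter_upwards [hae] with r hr hrs
        exact hgrad r hrs hr
    _ = _ := lintegral_const_mul' _ _ enorm_ne_top

end IsTriangularMesh

/-! ### Integrability of gradients and the Poincaré inequality on a segment. -/

/-- The gradient of `v` is essentially bounded on `P`. -/
def BoundedGradient (P : Set Plane) (v : Plane → ℝ) : Prop :=
  ∃ B : ℝ, ∀ᵐ x, x ∈ P → ∀ a, |Discretization.pd a v x| ≤ B

theorem BoundedGradient.integrableOn_mul {P : Set Plane} (hP : IsCompact P) {u v : Plane → ℝ}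
    (hu : BoundedGradient P u) (hv : BoundedGradient P v) (a b : Fin 2) :
    IntegrableOn (fun x => Discretization.pd a u x * Discretization.pd b v x) P := by
  obtain ⟨B, hB⟩ := hu
  obtain ⟨B', hB'⟩ := hv
  refine Measure.integrableOn_of_bounded (M := |B| * |B'|) hP.measure_lt_top.ne
    ((measurable_pd a u).mul (measurable_pd b v)).aestronglyMeasurable ?_
  rw [ae_restrict_iff' hP.measurableSet]
  filter_upwards [hB, hB'] with x h1 h2 hx
  rw [norm_mul]
  exact mul_le_mul ((h1 hx a).trans (le_abs_self B)) ((h2 hx b).trans (le_abs_self B'))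
    (norm_nonneg _) (abs_nonneg _)

theorem BoundedGradient.integrableOn_gradSq {P : Set Plane} (hP : IsCompact P) {u : Plane → ℝ}
    (hu : BoundedGradient P u) : IntegrableOn (gradSq u) P := by
  have : gradSq u = fun x => ∑ a, Discretization.pd a u x * Discretization.pd a u x :=
    funext fun x => Finset.sum_congr rfl fun a _ => sq _
  rw [this]
  exact integrable_finsetSum _ fun a _ => hu.integrableOn_mul hP hu a a

theorem IsPolygon.isCompact {P : Set Plane} (hP : IsPolygon P) : IsCompact P := by
  obtain ⟨S, hS, rfl⟩ := hP.triangles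
  exact S.isCompact_biUnion fun v _ => (finite_range v).isCompact_convexHull ℝ

/-- A Poincaré inequality on a segment in a polygon: the mean oscillation on the segment is
controlled by the gradient in the polygon, with a constant that does not depend on the mesh. -/
theorem IsPolygon.exists_poincare {P : Set Plane} (hP : IsPolygon P) {p q : Plane} (hpq : p ≠ q)
    (hseg : segment ℝ p q ⊆ P) : ∃ C : ℝ, 0 ≤ C ∧ ∀ K, IsTriangularMesh K → K.space = P →
      ∀ u : Plane → ℝ, ContinuousOn u P → IsP1 K u →
        ∫ s in (0 : ℝ)..1, |u (AffineMap.lineMap p q s) -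
          ∫ t in (0 : ℝ)..1, u (AffineMap.lineMap p q t)| ≤ C * √(∫ x in P, gradSq u x) := by
  obtain ⟨C, hC⟩ := hP.linked_self hpq hseg
  refine ⟨C * √(volume.real P), by positivity, ?_⟩
  rintro K hK hKP u hu hu1
  have hPm := hP.isCompact.measurableSet
  have hfin : volume P ≠ ⊤ := hP.isCompact.measure_lt_top.ne
  have hbg : BoundedGradient P u := hKP ▸ hK.exists_pd_bound hu1
  have hGI := hbg.integrableOn_gradSq hP.isCompact
  have hug := hK.upperGradient hu1 (hKP ▸ hu)
  rw [hKP] at hug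
  have h1 := hC _ _ hug
  -- Cauchy–Schwarz on `P` passes from the `L¹` norm of the upper gradient to the `L²` norm of the
  -- gradient, at the cost of the square root of the area.
  have h2 : ∫⁻ x in P, (hK.skeleton.indicator (fun _ => ⊤) x + ‖fderiv ℝ u x‖ₑ) ≤
      ENNReal.ofReal (√(volume.real P) * √(∫ x in P, gradSq u x)) := by
    have h3 := ENNReal.lintegral_mul_le_Lp_mul_Lq (volume.restrict P) Real.HolderConjugate.two_two
      (f := fun _ => 1) (g := fun x => ENNReal.ofReal (√(gradSq u x))) aemeasurable_const
      (measurable_gradSq u).sqrt.ennreal_ofReal.aemeasurable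
    have h4 : ∀ x, ENNReal.ofReal (√(gradSq u x)) ^ (2 : ℝ) = ENNReal.ofReal (gradSq u x) := by
      intro x
      rw [ENNReal.rpow_two, ← ENNReal.ofReal_pow (Real.sqrt_nonneg _),
        Real.sq_sqrt (gradSq_nonneg u x)]
    simp only [Pi.mul_apply, one_mul, ENNReal.one_rpow, h4, lintegral_const,
      Measure.restrict_apply_univ] at h3
    rw [← ofReal_integral_eq_lintegral_ofReal hGI
      (Eventually.of_forall fun x => gradSq_nonneg u x)] at h3
    calc _ ≤ ∫⁻ x in P, ENNReal.ofReal (√(gradSq u x)) := by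
          refine lintegral_mono_ae (ae_restrict_of_ae ?_)
          filter_upwards [measure_eq_zero_iff_ae_notMem.1 hK.volume_skeleton] with x hx
          rw [indicator_of_notMem hx, zero_add]
          exact enorm_fderiv_le u x
      _ ≤ _ := h3
      _ = _ := by
          have hI : 0 ≤ ∫ x in P, gradSq u x := integral_nonneg fun x => gradSq_nonneg u x
          rw [ENNReal.ofReal_mul (Real.sqrt_nonneg _), Real.sqrt_eq_rpow, Real.sqrt_eq_rpow,
            ← ENNReal.ofReal_rpow_of_nonneg measureReal_nonneg (by norm_num),
            ← ENNReal.ofReal_rpow_of_nonneg hI (by norm_num), ofReal_measureReal hfin]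
  set f : ℝ → ℝ := fun s => u (AffineMap.lineMap p q s) with hf
  have hγ : ∀ s ∈ Icc (0 : ℝ) 1, (AffineMap.lineMap p q s : Plane) ∈ P := fun s hs =>
    hseg (by rw [segment_eq_image_lineMap]; exact ⟨s, hs, rfl⟩)
  have hfc : ContinuousOn f (Icc 0 1) :=
    hu.comp (AffineMap.lineMap_continuous (p := p) (q := q)).continuousOn hγ
  have hfi : IntegrableOn f (Icc 0 1) := hfc.integrableOn_Icc
  set m := ∫ t in (0 : ℝ)..1, f t with hm
  have hm' : m = ∫ t in Icc (0 : ℝ) 1, f t := by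
    rw [hm, intervalIntegral.integral_of_le zero_le_one, integral_Icc_eq_integral_Ioc]
  have h5 : ∫⁻ s in Icc (0 : ℝ) 1, ‖f s - m‖ₑ ≤
      ENNReal.ofReal (C * (√(volume.real P) * √(∫ x in P, gradSq u x))) := by
    rw [ENNReal.ofReal_mul C.coe_nonneg, ENNReal.ofReal_coe_nnreal]
    refine le_trans ?_ (h1.trans (mul_le_mul' le_rfl h2))
    refine setLIntegral_mono' measurableSet_Icc fun s hs => ?_
    -- The deviation from the mean is the mean of the differences `f s - f t`, so the oscillation is
    -- at most the mean gap of the segment with itself.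
    have h6 : f s - m = ∫ t in Icc (0 : ℝ) 1, (f s - f t) := by
      rw [integral_sub (integrable_const _) hfi, ← hm']
      simp
    rw [h6]
    refine (enorm_integral_le_lintegral_enorm _).trans ?_
    refine setLIntegral_mono' measurableSet_Icc fun t ht => ?_
    rw [indicator_of_mem (hγ s hs), indicator_of_mem (hγ t ht)]
  rw [intervalIntegral.integral_of_le zero_le_one, ← integral_Icc_eq_integral_Ioc]
  have h7 : ∫ s in Icc (0 : ℝ) 1, ‖f s - m‖ = (∫⁻ s in Icc (0 : ℝ) 1, ‖f s - m‖ₑ).toReal :=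
    integral_norm_eq_lintegral_enorm (hfi.sub (integrable_const m)).aestronglyMeasurable
  change ∫ s in Icc (0 : ℝ) 1, ‖f s - m‖ ≤ _
  rw [h7, mul_assoc]
  exact ENNReal.toReal_le_of_le_ofReal (by positivity) h5

/-! ### Shape regular meshes: triangles at a vertex and an inverse inequality. -/

namespace IsTriangularMesh

variable {K : Geometry.SimplicialComplex ℝ Plane}

theorem le_triDiam {T : Finset Plane} {x y : Plane} (hx : x ∈ convexHull ℝ (T : Set Plane))
    (hy : y ∈ convexHull ℝ (T : Set Plane)) : dist x y ≤ triDiam T :=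
  Metric.dist_le_diam_of_mem (isCompact_convexHull_finset T).isBounded hx hy

theorem radius_le_triDiam {T : Finset Plane} {c : Plane} {r : ℝ} (hr : 0 < r)
    (h : Metric.closedBall c r ⊆ convexHull ℝ (T : Set Plane)) : r ≤ triDiam T := by
  have h1 : c + r • EuclideanSpace.single 0 (1 : ℝ) ∈ Metric.closedBall c r := by
    simp [norm_smul, abs_of_pos hr]
  have := le_triDiam (h h1) (h (Metric.mem_closedBall_self hr.le))
  simpa [norm_smul, abs_of_pos hr] using this

open Classical in
/-- In a shape regular mesh, the number of triangles at a vertex is bounded. -/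
theorem card_triangles_le (hK : IsTriangularMesh K) {σ : ℝ} (hσ : 0 < σ) (hs : ShapeRegular σ K)
    (z : Plane) : ((hK.tris.filter fun T => z ∈ T).card : ℝ) ≤ σ ^ 2 := by
  set A := hK.tris.filter fun T => z ∈ T with hA
  rcases A.eq_empty_or_nonempty with h0 | hne
  · rw [h0]; simp; positivity
  have hAt : ∀ T ∈ A, T ∈ hK.tris := fun T hT => (Finset.mem_filter.1 hT).1
  choose! c r hr hball hdiam using fun T (hT : T ∈ A) =>
    hs T (hK.mem_tris.1 (hAt T hT)).1 (hK.mem_tris.1 (hAt T hT)).2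
  have hd : ∀ T ∈ A, 0 < triDiam T := fun T hT =>
    (hr T hT).trans_le (radius_le_triDiam (hr T hT) (hball T hT))
  obtain ⟨T₀, hT₀, hmin⟩ := A.exists_min_image triDiam hne
  set ρ := triDiam T₀ with hρ
  have hρ0 : 0 < ρ := hd T₀ hT₀
  -- Shrink each triangle at `z` towards `z` until its diameter is the smallest one, `ρ`. The
  -- shrunken discs have radius at least `ρ / σ`, stay in the interiors of their triangles, hence
  -- are disjoint, and lie in the disc of radius `ρ` about `z`. Comparing areas bounds their number
  -- by `σ ^ 2`.
  let θ : Finset Plane → ℝ := fun T => ρ / triDiam T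
  have hθ0 : ∀ T ∈ A, 0 < θ T := fun T hT => div_pos hρ0 (hd T hT)
  have hθ1 : ∀ T ∈ A, θ T ≤ 1 := fun T hT => (div_le_one (hd T hT)).2 (hmin T hT)
  let U : Finset Plane → Set Plane := fun T => Metric.ball (z + θ T • (c T - z)) (θ T * r T)
  have hUmem : ∀ T ∈ A, ∀ x ∈ U T, ∃ y ∈ convexHull ℝ (T : Set Plane), x = z + θ T • (y - z) := by
    intro T hT x hx
    have hθ := hθ0 T hT
    refine ⟨z + (θ T)⁻¹ • (x - z), hball T hT ?_, ?_⟩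
    · rw [Metric.mem_closedBall, dist_eq_norm]
      rw [Metric.mem_ball, dist_eq_norm] at hx
      have h1 : z + (θ T)⁻¹ • (x - z) - c T = (θ T)⁻¹ • (x - (z + θ T • (c T - z))) := by
        rw [smul_sub, smul_sub, smul_add, smul_smul, inv_mul_cancel₀ hθ.ne']
        module
      rw [h1, norm_smul, norm_inv, Real.norm_eq_abs, abs_of_pos hθ, inv_mul_le_iff₀ hθ]
      exact hx.le
    · rw [add_sub_cancel_left, smul_smul, mul_inv_cancel₀ hθ.ne']
      module
  have hzT : ∀ T ∈ A, z ∈ convexHull ℝ (T : Set Plane) := fun T hT =>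
    subset_convexHull ℝ _ (Finset.mem_filter.1 hT).2
  have hUint : ∀ T ∈ A, U T ⊆ interior (convexHull ℝ (T : Set Plane)) := by
    intro T hT
    refine interior_maximal (fun x hx => ?_) Metric.isOpen_ball
    obtain ⟨y, hy, rfl⟩ := hUmem T hT x hx
    exact (convex_convexHull ℝ _).add_smul_sub_mem (hzT T hT) hy ⟨(hθ0 T hT).le, hθ1 T hT⟩
  have hUball : ∀ T ∈ A, U T ⊆ Metric.closedBall z ρ := by
    intro T hT x hx
    obtain ⟨y, hy, rfl⟩ := hUmem T hT x hx
    rw [Metric.mem_closedBall, dist_eq_norm, add_sub_cancel_left, norm_smul, Real.norm_eq_abs,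
      abs_of_pos (hθ0 T hT), ← dist_eq_norm]
    calc θ T * dist y z ≤ θ T * triDiam T :=
          mul_le_mul_of_nonneg_left (le_triDiam hy (hzT T hT)) (hθ0 T hT).le
      _ = ρ := div_mul_cancel₀ _ (hd T hT).ne'
  set ω := volume (Metric.ball (0 : Plane) 1) with hω
  have hω0 : ω ≠ 0 := (Metric.measure_ball_pos volume _ one_pos).ne'
  have hω1 : ω ≠ ⊤ := measure_ball_lt_top.ne
  have hUvol : ∀ T ∈ A, ENNReal.ofReal ((ρ / σ) ^ 2) * ω ≤ volume (U T) := by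
    intro T hT
    rw [Measure.addHaar_ball volume _ (mul_nonneg (hθ0 T hT).le (hr T hT).le),
      finrank_euclideanSpace_fin]
    refine mul_le_mul' (ENNReal.ofReal_le_ofReal (pow_le_pow_left₀ (by positivity) ?_ 2)) le_rfl
    rw [div_le_iff₀ hσ]
    calc ρ = θ T * triDiam T := (div_mul_cancel₀ _ (hd T hT).ne').symm
      _ ≤ θ T * (σ * r T) := mul_le_mul_of_nonneg_left (hdiam T hT) (hθ0 T hT).le
      _ = _ := by ring
  have hsum : (A.card : ℝ≥0∞) * (ENNReal.ofReal ((ρ / σ) ^ 2) * ω) ≤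
      ENNReal.ofReal (ρ ^ 2) * ω := by
    calc _ = ∑ T ∈ A, ENNReal.ofReal ((ρ / σ) ^ 2) * ω := by
          rw [Finset.sum_const, nsmul_eq_mul]
      _ ≤ ∑ T ∈ A, volume (U T) := Finset.sum_le_sum hUvol
      _ = volume (⋃ T ∈ A, U T) := by
          refine (measure_biUnion_finset ?_ fun T _ => measurableSet_ball).symm
          intro T hT T' hT' hTT'
          exact (hK.disjoint_interior (hAt T hT) (hAt T' hT') hTT').mono (hUint T hT)
            (hUint T' hT')
      _ ≤ volume (Metric.closedBall z ρ) := measure_mono (iUnion₂_subset hUball)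
      _ = _ := by rw [Measure.addHaar_closedBall volume _ hρ0.le, finrank_euclideanSpace_fin]
  rw [← mul_assoc, ENNReal.mul_le_mul_iff_left hω0 hω1, ← ENNReal.ofReal_natCast,
    ← ENNReal.ofReal_mul (Nat.cast_nonneg _), ENNReal.ofReal_le_ofReal_iff (by positivity),
    div_pow, mul_div_assoc', div_le_iff₀ (by positivity), mul_comm] at hsum
  exact le_of_mul_le_mul_left hsum (by positivity)

/-- The gradient of an affine function on a triangle that contains a disc of radius `r`. -/
theorem abs_linear_le {T : Finset Plane} {c : Plane} {r : ℝ} (hr : 0 < r)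
    (h : Metric.closedBall c r ⊆ convexHull ℝ (T : Set Plane)) (g : Plane →ᵃ[ℝ] ℝ) {b : ℝ}
    (hb : ∀ y ∈ T, |g y| ≤ b) (a : Fin 2) :
    |g.linear (EuclideanSpace.single a 1)| ≤ b / r := by
  have hg : ∀ x ∈ convexHull ℝ (T : Set Plane), |g x| ≤ b := by
    intro x hx
    obtain ⟨w, hw0, -, hw2, hw3⟩ := exists_barycentric hx
    rw [← hw3, g.map_sum_smul T w hw2]
    calc |∑ y ∈ T, w y * g y| ≤ ∑ y ∈ T, |w y * g y| := Finset.abs_sum_le_sum_abs _ _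
      _ ≤ ∑ y ∈ T, w y * b := Finset.sum_le_sum fun y hy => by
          rw [abs_mul, abs_of_nonneg (hw0 y)]
          exact mul_le_mul_of_nonneg_left (hb y hy) (hw0 y)
      _ = b := by rw [← Finset.sum_mul, hw2, one_mul]
  set e : Plane := EuclideanSpace.single a 1 with he
  have hne : ‖r • e‖ = r := by simp [he, norm_smul, abs_of_pos hr]
  -- The slope in direction `e` is the difference of the values at `c + r e` and `c - r e`, divided
  -- by `2 r`.
  have h1 := hg (c + r • e) (h (by rw [Metric.mem_closedBall, dist_eq_norm, add_sub_cancel_left, hne]))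
  have h2 := hg (c - r • e) (h (by
    rw [Metric.mem_closedBall, dist_eq_norm, sub_sub_cancel_left, norm_neg, hne]))
  have h3 : ∀ x, g x = g.linear x + g 0 := fun x => congrFun g.decomp x
  rw [h3, map_add, map_smul, smul_eq_mul] at h1
  rw [h3, map_sub, map_smul, smul_eq_mul] at h2
  rw [le_div_iff₀ hr, show |g.linear e| * r = |g.linear e * r| by rw [abs_mul, abs_of_pos hr]]
  rw [abs_le] at h1 h2 ⊢
  constructor <;> linarith [h1.1, h1.2, h2.1, h2.2]

theorem ae_mem_interior_or (hK : IsTriangularMesh K) :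
    ∀ᵐ x, (∃ T ∈ hK.tris, x ∈ interior (convexHull ℝ (T : Set Plane))) ∨
      x ∈ interior (K.spaceᶜ) := by
  filter_upwards [hK.ae_mem_interior] with x hx
  by_cases h : x ∈ K.space
  · exact Or.inl (hx h)
  · exact Or.inr ((hK.isCompact_space.isClosed.isOpen_compl.interior_eq).symm ▸ h)

/-- A function that vanishes outside of the mesh has no gradient there. -/
theorem hasFDerivAt_zero {v : Plane → ℝ} (hv0 : ∀ x ∉ K.space, v x = 0) {x : Plane}
    (hx : x ∈ interior (K.spaceᶜ)) : HasFDerivAt v (0 : Plane →L[ℝ] ℝ) x :=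
  (hasFDerivAt_const (0 : ℝ) x).congr_of_eventuallyEq
    (Filter.mem_of_superset (mem_interior_iff_mem_nhds.1 hx) fun y hy => hv0 y hy)

open Classical in
/-- An inverse inequality: the gradient of a piecewise affine function is controlled by the sum of
the squares of its nodal values. -/
theorem integral_gradSq_le (hK : IsTriangularMesh K) {σ : ℝ} (hσ : 0 < σ)
    (hs : ShapeRegular σ K) {v : Plane → ℝ} (hv : IsP1 K v) (hv0 : ∀ x ∉ K.space, v x = 0)
    (Z : Finset Plane) (hZ : ∀ T ∈ hK.tris, ∀ y ∈ T, y ∉ Z → v y = 0) (P : Set Plane) :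
    ∫ x in P, gradSq v x ≤
      2 * volume.real (Metric.ball (0 : Plane) 1) * σ ^ 4 * ∑ z ∈ Z, v z ^ 2 := by
  obtain ⟨g, hg⟩ := hK.exists_affine hv
  choose! c r hr hball hdiam using fun T (hT : T ∈ hK.tris) =>
    hs T (hK.mem_tris.1 hT).1 (hK.mem_tris.1 hT).2
  set ω := volume.real (Metric.ball (0 : Plane) 1) with hω
  have hω0 : 0 ≤ ω := measureReal_nonneg
  let S : Finset Plane → ℝ := fun T => ∑ y ∈ T, v y ^ 2
  have hS0 : ∀ T, 0 ≤ S T := fun T => Finset.sum_nonneg fun _ _ => sq_nonneg _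
  have hgrad : ∀ T ∈ hK.tris, ∀ x ∈ interior (convexHull ℝ (T : Set Plane)),
      gradSq v x ≤ 2 * S T / r T ^ 2 := by
    intro T hT x hx
    have h1 : ∀ a, (Discretization.pd a v x) ^ 2 ≤ S T / r T ^ 2 := by
      intro a
      rw [Discretization.pd, (hasFDerivAt_of_eqOn (hg T hT) hx).fderiv]
      have h2 := abs_linear_le (hr T hT) (hball T hT) (g T) (b := √(S T)) (fun y hy => by
        rw [← hg T hT (subset_convexHull ℝ _ hy)]
        exact Real.abs_le_sqrt (Finset.single_le_sum (f := fun y => v y ^ 2)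
          (fun _ _ => sq_nonneg _) hy)) a
      rw [← Real.sq_sqrt (hS0 T), ← div_pow]
      exact sq_le_sq' (abs_le.1 h2).1 (abs_le.1 h2).2
    rw [gradSq, Fin.sum_univ_two, mul_div_assoc, two_mul]
    exact add_le_add (h1 0) (h1 1)
  let F : Plane → ℝ := fun x => ∑ T ∈ hK.tris,
    (convexHull ℝ (T : Set Plane)).indicator (fun _ => 2 * S T / r T ^ 2) x
  have hmeasT : ∀ T : Finset Plane, MeasurableSet (convexHull ℝ (T : Set Plane)) :=
    fun T => (isClosed_convexHull_finset T).measurableSet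
  have hfinT : ∀ T : Finset Plane, volume (convexHull ℝ (T : Set Plane)) < ⊤ :=
    fun T => (isCompact_convexHull_finset T).measure_lt_top
  have hIT : ∀ T : Finset Plane, Integrable
      ((convexHull ℝ (T : Set Plane)).indicator fun _ => 2 * S T / r T ^ 2) := fun T =>
    (integrable_indicator_iff (hmeasT T)).2 (integrableOn_const (hfinT T).ne)
  have hF : Integrable F := integrable_finsetSum _ fun T _ => hIT T
  have hF0 : ∀ (T : Finset Plane) x, 0 ≤ (convexHull ℝ (T : Set Plane)).indicator
      (fun _ => 2 * S T / r T ^ 2) x := fun T x =>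
    indicator_nonneg (fun _ _ => div_nonneg (mul_nonneg zero_le_two (hS0 T)) (sq_nonneg _)) x
  have hle : ∀ᵐ x, gradSq v x ≤ F x := by
    filter_upwards [hK.ae_mem_interior_or] with x hx
    rcases hx with ⟨T, hT, hxT⟩ | hx
    · refine (hgrad T hT x hxT).trans ?_
      refine le_trans ?_ (Finset.single_le_sum (f := fun T : Finset Plane =>
        (convexHull ℝ (T : Set Plane)).indicator (fun _ => 2 * S T / r T ^ 2) x)
        (fun T _ => hF0 T x) hT)
      rw [indicator_of_mem (interior_subset hxT)]
    · refine le_trans (le_of_eq ?_) (Finset.sum_nonneg fun T _ => hF0 T x)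
      simp [gradSq, Discretization.pd, (hasFDerivAt_zero hv0 hx).fderiv]
  -- The triangle lies in a disc of radius `σ r`, so its area is at most a multiple of `r²`. This
  -- cancels the `r⁻²` of the squared gradient: in two dimensions the inverse inequality for nodal
  -- values carries no power of the mesh size.
  have hvol : ∀ T ∈ hK.tris, volume.real (convexHull ℝ (T : Set Plane)) ≤
      σ ^ 2 * r T ^ 2 * ω := by
    intro T hT
    have h1 : convexHull ℝ (T : Set Plane) ⊆ Metric.closedBall (c T) (σ * r T) := fun x hx =>
      (le_triDiam hx (hball T hT (Metric.mem_closedBall_self (hr T hT).le))).trans (hdiam T hT)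
    have h2 := measureReal_mono (μ := volume) h1 measure_closedBall_lt_top.ne
    have h3 : volume.real (Metric.closedBall (c T) (σ * r T)) = (σ * r T) ^ 2 * ω := by
      rw [measureReal_def, Measure.addHaar_closedBall volume _ (mul_nonneg hσ.le (hr T hT).le),
        finrank_euclideanSpace_fin, ENNReal.toReal_mul, ENNReal.toReal_ofReal (sq_nonneg _)]
      rfl
    rw [h3, mul_pow] at h2
    exact h2
  calc ∫ x in P, gradSq v x ≤ ∫ x in P, F x :=
        integral_mono_of_nonneg (Eventually.of_forall fun x => gradSq_nonneg v x) hF.integrableOn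
          (ae_restrict_of_ae hle)
    _ ≤ ∫ x, F x := setIntegral_le_integral hF
          (Eventually.of_forall fun x => Finset.sum_nonneg fun T _ => hF0 T x)
    _ = ∑ T ∈ hK.tris, volume.real (convexHull ℝ (T : Set Plane)) * (2 * S T / r T ^ 2) := by
        rw [integral_finsetSum _ fun T _ => hIT T]
        refine Finset.sum_congr rfl fun T _ => ?_
        rw [integral_indicator (hmeasT T), setIntegral_const, smul_eq_mul]
    _ ≤ ∑ T ∈ hK.tris, 2 * ω * σ ^ 2 * S T := by
        refine Finset.sum_le_sum fun T hT => ?_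
        calc _ ≤ σ ^ 2 * r T ^ 2 * ω * (2 * S T / r T ^ 2) :=
              mul_le_mul_of_nonneg_right (hvol T hT)
                (div_nonneg (mul_nonneg zero_le_two (hS0 T)) (sq_nonneg _))
          _ = _ := by
              have := (hr T hT).ne'
              field_simp
    _ = 2 * ω * σ ^ 2 * ∑ T ∈ hK.tris, ∑ z ∈ Z, if z ∈ T then v z ^ 2 else 0 := by
        rw [Finset.mul_sum]
        refine Finset.sum_congr rfl fun T hT => ?_
        congr 1
        rw [← Finset.sum_filter]
        refine (Finset.sum_subset (fun y hy => (Finset.mem_filter.1 hy).2) fun y hy hy' => ?_).symm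
        have : y ∉ Z := fun h => hy' (Finset.mem_filter.2 ⟨h, hy⟩)
        rw [hZ T hT y hy this]; simp
    _ = 2 * ω * σ ^ 2 * ∑ z ∈ Z, (hK.tris.filter fun T => z ∈ T).card * v z ^ 2 := by
        rw [Finset.sum_comm]
        congr 1
        refine Finset.sum_congr rfl fun z _ => ?_
        rw [← Finset.sum_filter, Finset.sum_const, nsmul_eq_mul]
    _ ≤ 2 * ω * σ ^ 2 * ∑ z ∈ Z, σ ^ 2 * v z ^ 2 := by
        gcongr with z hz
        exact hK.card_triangles_le hσ hs z
    _ = _ := by rw [← Finset.mul_sum]; ring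

/-- The set `P` may exceed the meshed region. Outside the region the function vanishes on an open
set, and the skeleton is a null set. -/
theorem boundedGradient_of_zero (hK : IsTriangularMesh K) {v : Plane → ℝ} (hv : IsP1 K v)
    (hv0 : ∀ x ∉ K.space, v x = 0) (P : Set Plane) : BoundedGradient P v := by
  obtain ⟨B, hB⟩ := hK.exists_pd_bound hv
  refine ⟨|B|, ?_⟩
  filter_upwards [hB, hK.ae_mem_interior_or] with x h1 h2 _ a
  rcases h2 with ⟨T, hT, hxT⟩ | hx
  · exact (h1 (hK.convexHull_subset hT (interior_subset hxT)) a).trans (le_abs_self B)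
  · simp [Discretization.pd, (hasFDerivAt_zero hv0 hx).fderiv]

theorem ae_differentiableAt_of_zero (hK : IsTriangularMesh K) {v : Plane → ℝ} (hv : IsP1 K v)
    (hv0 : ∀ x ∉ K.space, v x = 0) : ∀ᵐ x, DifferentiableAt ℝ v x := by
  filter_upwards [hK.ae_differentiableAt hv, hK.ae_mem_interior_or] with x h1 h2
  rcases h2 with ⟨T, hT, hxT⟩ | hx
  · exact h1 (hK.convexHull_subset hT (interior_subset hxT))
  · exact (hasFDerivAt_zero hv0 hx).differentiableAt

end IsTriangularMesh

/-! ### Piecewise linear functions on a partition of the unit interval -/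

/-- `f` is affine between consecutive nodes of the partition `p`. -/
def PiecewiseLinear {n : ℕ} (p : Fin (n + 1) → ℝ) (f : ℝ → ℝ) : Prop :=
  ∀ k : Fin n, ∀ s ∈ Icc (0 : ℝ) 1, f (AffineMap.lineMap (p k.castSucc) (p k.succ) s) =
    (1 - s) * f (p k.castSucc) + s * f (p k.succ)

section

variable {n : ℕ} {p : Fin (n + 1) → ℝ}

theorem exists_mem_element (h0 : p 0 = 0) (h1 : p (Fin.last n) = 1) (hp : StrictMono p) {x : ℝ}
    (hx : x ∈ Icc (0 : ℝ) 1) : ∃ k : Fin n, ∃ s ∈ Icc (0 : ℝ) 1,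
      AffineMap.lineMap (p k.castSucc) (p k.succ) s = x := by
  suffices h : ∃ k : Fin n, x ∈ Icc (p k.castSucc) (p k.succ) by
    obtain ⟨k, hk⟩ := h
    rw [← segment_eq_Icc (hp.monotone (Fin.castSucc_le_succ k)), segment_eq_image_lineMap] at hk
    exact ⟨k, hk⟩
  by_contra! hcon
  have : ∀ j : Fin (n + 1), p j ≤ x := by
    intro j
    induction j using Fin.induction with
    | zero => rw [h0]; exact hx.1
    | succ k ih => exact le_of_not_ge fun h => hcon k ⟨ih, h⟩
  have hn : n ≠ 0 := by
    rintro rfl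
    have : p 0 = p (Fin.last 0) := rfl
    rw [h0, h1] at this
    exact zero_ne_one this
  obtain ⟨k, rfl⟩ := Nat.exists_eq_succ_of_ne_zero hn
  have h2 := hcon (Fin.last k)
  rw [Fin.succ_last, h1] at h2
  exact h2 ⟨this _, hx.2⟩

theorem integral_eq_sum_elements (h0 : p 0 = 0) (h1 : p (Fin.last n) = 1) (hp : StrictMono p)
    {f : ℝ → ℝ} (hf : ContinuousOn f (Icc 0 1)) :
    ∫ x in (0 : ℝ)..1, f x = ∑ k : Fin n, (p k.succ - p k.castSucc) *
      ∫ s in (0 : ℝ)..1, f (AffineMap.lineMap (p k.castSucc) (p k.succ) s) := by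
  -- The value 1 past the last node is a dummy; only indices up to `n` occur.
  let a : ℕ → ℝ := fun j => if h : j < n + 1 then p ⟨j, h⟩ else 1
  have ha : ∀ k (hk : k < n + 1), a k = p ⟨k, hk⟩ := fun k hk => dif_pos hk
  have h01 : ∀ j, p j ∈ Icc (0 : ℝ) 1 := fun j =>
    ⟨h0 ▸ hp.monotone (Fin.zero_le j), h1 ▸ hp.monotone (Fin.le_last j)⟩
  have h2 := intervalIntegral.sum_integral_adjacent_intervals (μ := volume) (a := a) (n := n)
    (f := f) (fun k hk => by
      rw [ha k (by lia), ha (k + 1) (by lia)]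
      refine (hf.mono ?_).intervalIntegrable
      exact uIcc_subset_Icc (h01 _) (h01 _))
  have e0 : a 0 = 0 := by rw [ha 0 (by lia)]; exact h0
  have e1 : a n = 1 := by rw [ha n (by lia)]; exact h1
  rw [e0, e1, Finset.sum_range] at h2
  rw [← h2]
  refine Finset.sum_congr rfl fun k _ => ?_
  rw [ha k (by lia), ha (k + 1) (by lia)]
  change ∫ x in p k.castSucc..p k.succ, f x = _
  have h3 := intervalIntegral.smul_integral_comp_add_mul (a := 0) (b := 1) f
    (p k.succ - p k.castSucc) (p k.castSucc)
  rw [mul_zero, mul_one, add_zero, add_sub_cancel, smul_eq_mul] at h3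
  rw [← h3]
  congr 2
  funext s
  rw [AffineMap.lineMap_apply, vsub_eq_sub, vadd_eq_add, smul_eq_mul]
  congr 1; ring

/-- The trapezoidal rule is exact for affine functions. -/
theorem PiecewiseLinear.integral_eq {f : ℝ → ℝ} (hfp : PiecewiseLinear p f) (h0 : p 0 = 0)
    (h1 : p (Fin.last n) = 1) (hp : StrictMono p) (hf : ContinuousOn f (Icc 0 1)) :
    ∫ x in (0 : ℝ)..1, f x =
      ∑ k : Fin n, (p k.succ - p k.castSucc) * ((f (p k.castSucc) + f (p k.succ)) / 2) := by
  rw [integral_eq_sum_elements h0 h1 hp hf]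
  refine Finset.sum_congr rfl fun k _ => ?_
  congr 1
  rw [intervalIntegral.integral_congr (g := fun s => (1 - s) * f (p k.castSucc) + s * f (p k.succ))
    fun s hs => hfp k s (by rwa [uIcc_of_le zero_le_one] at hs)]
  rw [intervalIntegral.integral_add (Continuous.intervalIntegrable (by fun_prop) _ _)
    (Continuous.intervalIntegrable (by fun_prop) _ _), intervalIntegral.integral_mul_const,
    intervalIntegral.integral_mul_const, intervalIntegral.integral_sub
    (Continuous.intervalIntegrable (by fun_prop) _ _)
    (Continuous.intervalIntegrable (by fun_prop) _ _)]
  simp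
  ring

theorem integral_sq_affine (a b : ℝ) :
    ∫ s in (0 : ℝ)..1, ((1 - s) * a + s * b) ^ 2 = (a ^ 2 + a * b + b ^ 2) / 3 := by
  have h : ∀ s : ℝ, ((1 - s) * a + s * b) ^ 2 =
      a ^ 2 + (2 * a * (b - a)) * s + (b - a) ^ 2 * s ^ 2 := fun s => by ring
  simp_rw [h]
  rw [intervalIntegral.integral_add (Continuous.intervalIntegrable (by fun_prop) _ _)
    (Continuous.intervalIntegrable (by fun_prop) _ _),
    intervalIntegral.integral_add (Continuous.intervalIntegrable (by fun_prop) _ _)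
    (Continuous.intervalIntegrable (by fun_prop) _ _), intervalIntegral.integral_const_mul,
    intervalIntegral.integral_const_mul, integral_pow, integral_id]
  simp
  ring

/-- Each node is an end point of some element, provided that there is an element at all. -/
theorem Fin.sum_le_sum_castSucc_add_succ (hn : n ≠ 0) {f : Fin (n + 1) → ℝ} (hf : ∀ k, 0 ≤ f k) :
    ∑ k, f k ≤ ∑ k : Fin n, (f k.castSucc + f k.succ) := by
  obtain ⟨j, rfl⟩ := Nat.exists_eq_succ_of_ne_zero hn
  rw [Fin.sum_univ_succ, Finset.sum_add_distrib]
  have := Finset.single_le_sum (f := fun k : Fin (j + 1) => f k.castSucc) (fun k _ => hf _)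
    (Finset.mem_univ 0)
  have e : f (Fin.castSucc (0 : Fin (j + 1))) = f 0 := rfl
  simp only [e] at this
  linarith

/-- On a partition with elements of length at least `h`, the `L²` norm controls the nodal values. -/
theorem PiecewiseLinear.sum_sq_le {f : ℝ → ℝ} (hfp : PiecewiseLinear p f) (h0 : p 0 = 0)
    (h1 : p (Fin.last n) = 1) (hp : StrictMono p) (hf : ContinuousOn f (Icc 0 1)) {h : ℝ}
    (hh : 0 ≤ h) (hle : ∀ k : Fin n, h ≤ p k.succ - p k.castSucc) :
    h / 6 * ∑ k, f (p k) ^ 2 ≤ ∫ x in (0 : ℝ)..1, f x ^ 2 := by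
  have hn : n ≠ 0 := by
    rintro rfl
    have : p 0 = p (Fin.last 0) := rfl
    rw [h0, h1] at this
    exact zero_ne_one this
  have hf2 : ContinuousOn (fun x => f x ^ 2) (Icc 0 1) := hf.pow 2
  rw [integral_eq_sum_elements h0 h1 hp hf2]
  calc _ ≤ h / 6 * ∑ k : Fin n, (f (p k.castSucc) ^ 2 + f (p k.succ) ^ 2) :=
        mul_le_mul_of_nonneg_left (Fin.sum_le_sum_castSucc_add_succ hn fun k => sq_nonneg _)
          (by positivity)
    _ ≤ _ := by
        rw [Finset.mul_sum]
        refine Finset.sum_le_sum fun k _ => ?_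
        rw [intervalIntegral.integral_congr
          (g := fun s => ((1 - s) * f (p k.castSucc) + s * f (p k.succ)) ^ 2)
          fun s hs => congrArg (· ^ 2) (hfp k s (by rwa [uIcc_of_le zero_le_one] at hs)),
          integral_sq_affine]
        set a := f (p k.castSucc)
        set b := f (p k.succ)
        -- The element mass matrix has the eigenvalues 1/6 and 1/2; this is the smaller one.
        have h2 : (a ^ 2 + b ^ 2) / 6 ≤ (a ^ 2 + a * b + b ^ 2) / 3 := by
          nlinarith [sq_nonneg (a + b)]
        calc h / 6 * (a ^ 2 + b ^ 2) = h * ((a ^ 2 + b ^ 2) / 6) := by ring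
          _ ≤ h * ((a ^ 2 + a * b + b ^ 2) / 3) := mul_le_mul_of_nonneg_left h2 hh
          _ ≤ _ := mul_le_mul_of_nonneg_right (hle k)
              (by nlinarith [sq_nonneg (a + b), sq_nonneg a, sq_nonneg b])

end

/-! ### Traces -/

namespace DFN

variable {L M : ℕ} (N : DFN L M) {i : Fin L} {m : Fin M}

theorem mem_traces : m ∈ N.traces i ↔ N.fst m = i ∨ N.snd m = i := by simp [traces]

theorem trace_subset (hm : m ∈ N.traces i) : N.trace m ⊆ N.chart i '' N.poly i := by
  have h := N.inter_eq m
  rw [trace, ← h]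
  rcases N.mem_traces.1 hm with rfl | rfl
  · exact inter_subset_left
  · exact inter_subset_right

/-- The point of a trace with a given parameter. -/
noncomputable def point (m : Fin M) (s : ℝ) : Space3 := AffineMap.lineMap (N.ptA m) (N.ptB m) s

theorem point_mem {s : ℝ} (hs : s ∈ Icc (0 : ℝ) 1) : N.point m s ∈ N.trace m := by
  rw [trace, segment_eq_image_lineMap]
  exact ⟨s, hs, rfl⟩

theorem exists_point {x : Space3} (hx : x ∈ N.trace m) : ∃ s ∈ Icc (0 : ℝ) 1, N.point m s = x := by
  rwa [trace, segment_eq_image_lineMap] at hx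

theorem continuous_point : Continuous (N.point m) := AffineMap.lineMap_continuous

theorem point_injective : Function.Injective (N.point m) :=
  AffineMap.lineMap_injective ℝ (N.ptA_ne_ptB m)

theorem length_pos : 0 < N.length m := dist_pos.2 (N.ptA_ne_ptB m)

theorem chart_coord {x : Space3} (hx : x ∈ range (N.chart i)) : N.chart i (N.coord i x) = x := by
  obtain ⟨y, rfl⟩ := hx
  rw [coord_chart]

theorem coord_mem {x : Space3} (hx : x ∈ N.chart i '' N.poly i) : N.coord i x ∈ N.poly i := by
  obtain ⟨y, hy, rfl⟩ := hx
  rwa [coord_chart]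

theorem continuousOn_coord : ContinuousOn (N.coord i) (range (N.chart i)) := by
  refine LipschitzOnWith.continuousOn (K := 1) (LipschitzOnWith.of_dist_le_mul fun x hx y hy => ?_)
  rw [← (N.chart i).dist_map, N.chart_coord hx, N.chart_coord hy]
  simp

theorem ptA_mem (hm : m ∈ N.traces i) : N.ptA m ∈ range (N.chart i) :=
  image_subset_range _ _ (N.trace_subset hm (left_mem_segment ℝ _ _))

theorem ptB_mem (hm : m ∈ N.traces i) : N.ptB m ∈ range (N.chart i) :=
  image_subset_range _ _ (N.trace_subset hm (right_mem_segment ℝ _ _))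

/-- Charts are affine, so a trace keeps its affine parameter in planar coordinates. -/
theorem coord_point (hm : m ∈ N.traces i) (s : ℝ) : N.coord i (N.point m s) =
    AffineMap.lineMap (N.coord i (N.ptA m)) (N.coord i (N.ptB m)) s := by
  have h : N.chart i (AffineMap.lineMap (N.coord i (N.ptA m)) (N.coord i (N.ptB m)) s) =
      N.point m s := by
    have h1 := (N.chart i).toAffineMap.apply_lineMap (N.coord i (N.ptA m)) (N.coord i (N.ptB m)) s
    simp only [AffineIsometry.coe_toAffineMap] at h1
    rw [h1, N.chart_coord (N.ptA_mem hm), N.chart_coord (N.ptB_mem hm)]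
    rfl
  rw [← h, coord_chart]

theorem coord_ptA_ne (hm : m ∈ N.traces i) : N.coord i (N.ptA m) ≠ N.coord i (N.ptB m) := by
  intro h
  apply N.ptA_ne_ptB m
  rw [← N.chart_coord (N.ptA_mem hm), h, N.chart_coord (N.ptB_mem hm)]

theorem segment_coord_subset (hm : m ∈ N.traces i) :
    segment ℝ (N.coord i (N.ptA m)) (N.coord i (N.ptB m)) ⊆ N.poly i := by
  rw [segment_eq_image_lineMap]
  rintro _ ⟨s, hs, rfl⟩
  rw [← N.coord_point hm]
  exact N.coord_mem (N.trace_subset hm (N.point_mem hs))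

theorem coord_point_injective (hm : m ∈ N.traces i) :
    Function.Injective fun s => N.coord i (N.point m s) := by
  intro s t h
  simp only [N.coord_point hm] at h
  exact AffineMap.lineMap_injective ℝ (N.coord_ptA_ne hm) h

theorem continuousOn_onSpace (hm : m ∈ N.traces i) {v : Plane → ℝ}
    (hv : ContinuousOn v (N.poly i)) : ContinuousOn (N.onSpace i v) (N.trace m) := by
  refine hv.comp (N.continuousOn_coord.mono ?_) fun x hx => N.coord_mem (N.trace_subset hm hx)
  exact (N.trace_subset hm).trans (image_subset_range _ _)

theorem ContinuousOn.comp_point {f : Space3 → ℝ} (hf : ContinuousOn f (N.trace m)) :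
    ContinuousOn (fun s => f (N.point m s)) (Icc 0 1) :=
  hf.comp N.continuous_point.continuousOn fun _ hs => N.point_mem hs

theorem intervalIntegrable_comp_point {f : Space3 → ℝ} (hf : ContinuousOn f (N.trace m)) :
    IntervalIntegrable (fun s => f (N.point m s)) volume 0 1 :=
  (by simpa using ContinuousOn.comp_point N hf :
    ContinuousOn (fun s => f (N.point m s)) (uIcc 0 1)).intervalIntegrable

theorem lineInt_eq (f : Space3 → ℝ) :
    N.lineInt m f = N.length m * ∫ s in (0 : ℝ)..1, f (N.point m s) := rfl

theorem lineInt_congr {f g : Space3 → ℝ} (h : EqOn f g (N.trace m)) :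
    N.lineInt m f = N.lineInt m g := by
  rw [lineInt_eq, lineInt_eq]
  congr 1
  refine intervalIntegral.integral_congr fun s hs => h (N.point_mem ?_)
  rwa [uIcc_of_le zero_le_one] at hs

theorem lineInt_add {f g : Space3 → ℝ} (hf : ContinuousOn f (N.trace m))
    (hg : ContinuousOn g (N.trace m)) :
    N.lineInt m (fun x => f x + g x) = N.lineInt m f + N.lineInt m g := by
  simp only [lineInt_eq]
  rw [intervalIntegral.integral_add (N.intervalIntegrable_comp_point hf)
    (N.intervalIntegrable_comp_point hg), mul_add]

theorem lineInt_sub {f g : Space3 → ℝ} (hf : ContinuousOn f (N.trace m))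
    (hg : ContinuousOn g (N.trace m)) :
    N.lineInt m (fun x => f x - g x) = N.lineInt m f - N.lineInt m g := by
  simp only [lineInt_eq]
  rw [intervalIntegral.integral_sub (N.intervalIntegrable_comp_point hf)
    (N.intervalIntegrable_comp_point hg), mul_sub]

theorem lineInt_const_mul (c : ℝ) (f : Space3 → ℝ) :
    N.lineInt m (fun x => c * f x) = c * N.lineInt m f := by
  simp only [lineInt_eq]
  rw [intervalIntegral.integral_const_mul]; ring

theorem lineInt_sum {ι : Type*} (S : Finset ι) {f : ι → Space3 → ℝ}
    (hf : ∀ k ∈ S, ContinuousOn (f k) (N.trace m)) :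
    N.lineInt m (fun x => ∑ k ∈ S, f k x) = ∑ k ∈ S, N.lineInt m (f k) := by
  simp only [lineInt_eq]
  rw [intervalIntegral.integral_finsetSum fun k hk => N.intervalIntegrable_comp_point (hf k hk),
    Finset.mul_sum]

theorem lineInt_mono {f g : Space3 → ℝ} (hf : ContinuousOn f (N.trace m))
    (hg : ContinuousOn g (N.trace m)) (h : ∀ x ∈ N.trace m, f x ≤ g x) :
    N.lineInt m f ≤ N.lineInt m g := by
  rw [lineInt_eq, lineInt_eq]
  refine mul_le_mul_of_nonneg_left ?_ N.length_pos.le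
  exact intervalIntegral.integral_mono_on zero_le_one (N.intervalIntegrable_comp_point hf)
    (N.intervalIntegrable_comp_point hg) fun s hs => h _ (N.point_mem hs)

theorem lineInt_nonneg {f : Space3 → ℝ} (h : ∀ x ∈ N.trace m, 0 ≤ f x) : 0 ≤ N.lineInt m f := by
  rw [lineInt_eq]
  exact mul_nonneg N.length_pos.le (intervalIntegral.integral_nonneg zero_le_one fun s hs =>
    h _ (N.point_mem hs))

end DFN

/-! ### Trace meshes and the discrete spaces on the traces. -/

namespace Discretization

variable {L M : ℕ} {N : DFN L M} (D : Discretization N) {i : Fin L} {m : Fin M} {σ : ℝ}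

theorem node_eq (k : Fin (D.num m + 1)) : D.node m k = N.point m (D.param m k) := rfl

theorem param_mem (k : Fin (D.num m + 1)) : D.param m k ∈ Icc (0 : ℝ) 1 :=
  ⟨D.param_zero m ▸ (D.param_strictMono m).monotone (Fin.zero_le k),
    D.param_last m ▸ (D.param_strictMono m).monotone (Fin.le_last k)⟩

theorem node_mem (k : Fin (D.num m + 1)) : D.node m k ∈ N.trace m := N.point_mem (D.param_mem k)

theorem node_injective : Function.Injective (D.node m) :=
  N.point_injective.comp (D.param_strictMono m).injective

theorem point_element (k : Fin (D.num m)) (s : ℝ) :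
    N.point m (AffineMap.lineMap (D.param m k.castSucc) (D.param m k.succ) s) =
      AffineMap.lineMap (D.node m k.castSucc) (D.node m k.succ) s :=
  AffineMap.apply_lineMap (AffineMap.lineMap (N.ptA m) (N.ptB m) : ℝ →ᵃ[ℝ] Space3) _ _ s

theorem exists_mem_element {x : Space3} (hx : x ∈ N.trace m) : ∃ k : Fin (D.num m),
    ∃ s ∈ Icc (0 : ℝ) 1, AffineMap.lineMap (D.node m k.castSucc) (D.node m k.succ) s = x := by
  obtain ⟨r, hr, rfl⟩ := N.exists_point hx
  obtain ⟨k, s, hs, rfl⟩ := _root_.exists_mem_element (D.param_zero m) (D.param_last m)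
    (D.param_strictMono m) hr
  exact ⟨k, s, hs, (D.point_element k s).symm⟩

/-- The function is affine on each element of the trace mesh. -/
def IsP1Trace (m : Fin M) (ψ : Space3 → ℝ) : Prop :=
  ∀ k : Fin (D.num m), ∀ s ∈ Icc (0 : ℝ) 1,
    ψ (AffineMap.lineMap (D.node m k.castSucc) (D.node m k.succ) s) =
      (1 - s) * ψ (D.node m k.castSucc) + s * ψ (D.node m k.succ)

variable {D}

theorem IsP1Trace.piecewiseLinear {ψ : Space3 → ℝ} (h : D.IsP1Trace m ψ) :
    PiecewiseLinear (D.param m) fun s => ψ (N.point m s) := by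
  intro k s hs
  simp only [D.point_element]
  exact h k s hs

/-- Functions that are affine on each element agree if they agree at the nodes. -/
theorem IsP1Trace.eqOn {ψ φ : Space3 → ℝ} (hψ : D.IsP1Trace m ψ) (hφ : D.IsP1Trace m φ)
    (h : ∀ k, ψ (D.node m k) = φ (D.node m k)) : EqOn ψ φ (N.trace m) := by
  intro x hx
  obtain ⟨k, s, hs, rfl⟩ := D.exists_mem_element hx
  rw [hψ k s hs, hφ k s hs, h, h]

theorem IsP1Trace.sum {ι : Type*} (S : Finset ι) {f : ι → Space3 → ℝ} (c : ι → ℝ)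
    (hf : ∀ k ∈ S, D.IsP1Trace m (f k)) : D.IsP1Trace m fun x => ∑ k ∈ S, c k * f k x := by
  intro k s hs
  simp only [Finset.mul_sum]
  rw [← Finset.sum_add_distrib]
  exact Finset.sum_congr rfl fun j hj => by rw [hf j hj k s hs]; ring

theorem TraceSpace.isP1Trace {ψ : Space3 → ℝ} (h : D.TraceSpace m ψ) : D.IsP1Trace m ψ := by
  intro k s hs
  obtain ⟨g, hg⟩ := h.2.1 k
  rw [hg (by rw [segment_eq_image_lineMap]; exact ⟨s, hs, rfl⟩), hg (left_mem_segment ℝ _ _),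
    hg (right_mem_segment ℝ _ _), g.apply_lineMap, AffineMap.lineMap_apply_ring]

theorem exists_affineMap_of_ne {p q : Space3} (hpq : p ≠ q) (a b : ℝ) :
    ∃ g : Space3 →ᵃ[ℝ] ℝ, g p = a ∧ g q = b := by
  have h0 : inner ℝ (q - p) (q - p) ≠ 0 := by
    rw [Ne, inner_self_eq_zero]; exact sub_ne_zero.2 hpq.symm
  set α := (b - a) / inner ℝ (q - p) (q - p) with hα
  refine ⟨(α • innerₛₗ ℝ (q - p)).toAffineMap +
    AffineMap.const ℝ Space3 (a - α * inner ℝ (q - p) p), ?_, ?_⟩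
  · change α * inner ℝ (q - p) p + (a - α * inner ℝ (q - p) p) = a
    ring
  · change α * inner ℝ (q - p) q + (a - α * inner ℝ (q - p) p) = b
    have h1 : α * inner ℝ (q - p) (q - p) = b - a := div_mul_cancel₀ _ h0
    rw [inner_sub_right] at h1
    linarith

/-- The Dirichlet boundary meets a trace at most in its end points, and these are nodes. Hence a
condition on nodal values is enough. -/
theorem IsP1Trace.traceSpace {ψ : Space3 → ℝ} (h : D.IsP1Trace m ψ)
    (hc : ContinuousOn ψ (N.trace m)) (h0 : ∀ k, D.node m k ∈ N.dirichlet → ψ (D.node m k) = 0) :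
    D.TraceSpace m ψ := by
  refine ⟨hc, fun k => ?_, fun x hx hxD => ?_⟩
  · obtain ⟨g, hg1, hg2⟩ := exists_affineMap_of_ne
      (D.node_injective.ne (Fin.castSucc_lt_succ (i := k)).ne) (ψ (D.node m k.castSucc))
      (ψ (D.node m k.succ))
    refine ⟨g, fun x hx => ?_⟩
    rw [segment_eq_image_lineMap] at hx
    obtain ⟨s, hs, rfl⟩ := hx
    rw [h k s hs, g.apply_lineMap, hg1, hg2, AffineMap.lineMap_apply_ring]
  · rcases N.dirichlet_inter_trace m ⟨hxD, hx⟩ with rfl | hx'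
    · have e : D.node m 0 = N.ptA m := by simp [node, D.param_zero]
      rw [← e] at hxD ⊢
      exact h0 _ hxD
    · have e : D.node m (Fin.last _) = N.ptB m := by simp [node, D.param_last]
      rw [mem_singleton_iff.1 hx', ← e] at hxD ⊢
      exact h0 _ hxD

theorem TraceSpace.add {ψ φ : Space3 → ℝ} (hψ : D.TraceSpace m ψ) (hφ : D.TraceSpace m φ) :
    D.TraceSpace m fun x => ψ x + φ x := by
  refine ⟨hψ.1.add hφ.1, fun k => ?_, fun x hx hxD => ?_⟩
  · obtain ⟨g, hg⟩ := hψ.2.1 k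
    obtain ⟨g', hg'⟩ := hφ.2.1 k
    exact ⟨g + g', fun x hx => congrArg₂ (· + ·) (hg hx) (hg' hx)⟩
  · simp only [hψ.2.2 x hx hxD, hφ.2.2 x hx hxD, add_zero]

theorem TraceSpace.const_mul {ψ : Space3 → ℝ} (hψ : D.TraceSpace m ψ) (c : ℝ) :
    D.TraceSpace m fun x => c * ψ x := by
  refine ⟨continuousOn_const.mul hψ.1, fun k => ?_, fun x hx hxD => ?_⟩
  · obtain ⟨g, hg⟩ := hψ.2.1 k
    exact ⟨c • g, fun x hx => congrArg (c * ·) (hg hx)⟩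
  · simp only [hψ.2.2 x hx hxD, mul_zero]

/-! ### The auxiliary basis on the traces -/

/-- Elements of the trace mesh are edges of the auxiliary mesh, so on the trace the auxiliary
functions are the usual one-dimensional hat functions, the same for both fractures. -/
theorem IsRegular.onSpace_hat (hR : D.IsRegular σ) (hm : m ∈ N.traces i) (k : D.FreeNode m)
    (j : Fin (D.num m)) {s : ℝ} (hs : s ∈ Icc (0 : ℝ) 1) :
    N.onSpace i (D.auxBasis i m k) (AffineMap.lineMap (D.node m j.castSucc) (D.node m j.succ) s) =
      (1 - s) * (if j.castSucc = k.1 then 1 else 0) + s * (if j.succ = k.1 then 1 else 0) := by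
  obtain ⟨e, he, heq⟩ := hR.aux_edge i m hm j
  have hinj : Function.Injective fun k => N.coord i (D.node m k) :=
    (N.coord_point_injective hm).comp (D.param_strictMono m).injective
  have h1 : N.coord i (AffineMap.lineMap (D.node m j.castSucc) (D.node m j.succ) s) =
      AffineMap.lineMap (N.coord i (D.node m j.castSucc)) (N.coord i (D.node m j.succ)) s := by
    rw [← D.point_element, N.coord_point hm, D.node_eq, D.node_eq, N.coord_point hm,
      N.coord_point hm]
    exact AffineMap.apply_lineMap (AffineMap.lineMap _ _ : ℝ →ᵃ[ℝ] Plane) _ _ s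
  rw [DFN.onSpace, auxBasis, h1, hat_lineMap he
    (hinj.ne (Fin.castSucc_lt_succ (i := j)).ne) heq _ hs]
  simp only [hinj.eq_iff]

theorem IsRegular.onSpace_hat_node (hR : D.IsRegular σ) (hm : m ∈ N.traces i) (k : D.FreeNode m)
    (j : Fin (D.num m + 1)) :
    N.onSpace i (D.auxBasis i m k) (D.node m j) = if j = k.1 then 1 else 0 := by
  obtain ⟨l, s, hs, h⟩ := D.exists_mem_element (D.node_mem j)
  have hl : j = l.castSucc ∨ j = l.succ := by
    rw [← D.point_element, D.node_eq] at h
    have h2 := N.point_injective h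
    have h3 : D.param m j ∈ Icc (D.param m l.castSucc) (D.param m l.succ) := by
      rw [← h2, ← segment_eq_Icc ((D.param_strictMono m).monotone (Fin.castSucc_le_succ l)),
        segment_eq_image_lineMap]
      exact ⟨s, hs, rfl⟩
    have h4 := (D.param_strictMono m).le_iff_le.1 h3.1
    have h5 := (D.param_strictMono m).le_iff_le.1 h3.2
    rw [Fin.le_def] at h4 h5
    rw [Fin.ext_iff, Fin.ext_iff]
    simp only [Fin.val_castSucc, Fin.val_succ] at *
    omega
  rcases hl with rfl | rfl
  · simpa using hR.onSpace_hat hm k l (s := 0) ⟨le_rfl, zero_le_one⟩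
  · simpa using hR.onSpace_hat hm k l (s := 1) ⟨zero_le_one, le_rfl⟩

theorem IsRegular.isP1Trace_hat (hR : D.IsRegular σ) (hm : m ∈ N.traces i) (k : D.FreeNode m) :
    D.IsP1Trace m (N.onSpace i (D.auxBasis i m k)) := by
  intro j s hs
  rw [hR.onSpace_hat hm k j hs, hR.onSpace_hat_node hm, hR.onSpace_hat_node hm]

theorem IsRegular.continuousOn_hat (hR : D.IsRegular σ) (hm : m ∈ N.traces i) (k : D.FreeNode m) :
    ContinuousOn (N.onSpace i (D.auxBasis i m k)) (N.trace m) :=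
  N.continuousOn_onSpace hm (hR.aux_conforming i m hm k).1

variable (D) in
/-- The function on the trace with given coefficients in the auxiliary basis. -/
noncomputable def comb (i : Fin L) (m : Fin M) (c : D.FreeNode m → ℝ) (x : Space3) : ℝ :=
  ∑ k, c k * N.onSpace i (D.auxBasis i m k) x

theorem IsRegular.isP1Trace_comb (hR : D.IsRegular σ) (hm : m ∈ N.traces i)
    (c : D.FreeNode m → ℝ) : D.IsP1Trace m (D.comb i m c) :=
  IsP1Trace.sum _ _ fun k _ => hR.isP1Trace_hat hm k

theorem IsRegular.continuousOn_comb (hR : D.IsRegular σ) (hm : m ∈ N.traces i)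
    (c : D.FreeNode m → ℝ) : ContinuousOn (D.comb i m c) (N.trace m) :=
  continuousOn_finsetSum _ fun k _ => continuousOn_const.mul (hR.continuousOn_hat hm k)

theorem IsRegular.comb_node (hR : D.IsRegular σ) (hm : m ∈ N.traces i) (c : D.FreeNode m → ℝ)
    (k : D.FreeNode m) : D.comb i m c (D.node m k) = c k := by
  rw [comb, Finset.sum_eq_single k]
  · rw [hR.onSpace_hat_node hm, if_pos rfl, mul_one]
  · intro l _ hl
    rw [hR.onSpace_hat_node hm, if_neg fun h => hl (Subtype.ext h.symm), mul_zero]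
  · simp

theorem IsRegular.comb_node_dirichlet (hR : D.IsRegular σ) (hm : m ∈ N.traces i)
    (c : D.FreeNode m → ℝ) {j : Fin (D.num m + 1)} (hj : D.node m j ∈ N.dirichlet) :
    D.comb i m c (D.node m j) = 0 := by
  refine Finset.sum_eq_zero fun l _ => ?_
  rw [hR.onSpace_hat_node hm, if_neg, mul_zero]
  rintro rfl
  exact l.2 hj

theorem IsRegular.traceSpace_comb (hR : D.IsRegular σ) (hm : m ∈ N.traces i)
    (c : D.FreeNode m → ℝ) : D.TraceSpace m (D.comb i m c) :=
  (hR.isP1Trace_comb hm c).traceSpace (hR.continuousOn_comb hm c)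
    fun _ hk => hR.comb_node_dirichlet hm c hk

/-- Each function of the trace space is a combination of the auxiliary basis. -/
theorem IsRegular.eqOn_comb (hR : D.IsRegular σ) (hm : m ∈ N.traces i) {ψ : Space3 → ℝ}
    (hψ : D.TraceSpace m ψ) : EqOn ψ (D.comb i m fun k => ψ (D.node m k)) (N.trace m) := by
  refine hψ.isP1Trace.eqOn (hR.isP1Trace_comb hm _) fun k => ?_
  by_cases hk : D.node m k ∈ N.dirichlet
  · rw [hR.comb_node_dirichlet hm _ hk, hψ.2.2 _ (D.node_mem k) hk]
  · exact (hR.comb_node hm (fun k => ψ (D.node m k)) ⟨k, hk⟩).symm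

/-- The auxiliary basis functions of one trace vanish on the other traces. -/
theorem IsRegular.onSpace_hat_eq_zero (hR : D.IsRegular σ) (hm : m ∈ N.traces i) {m' : Fin M}
    (hm' : m' ∈ N.traces i) (hne : m ≠ m') (k : D.FreeNode m) {x : Space3} (hx : x ∈ N.trace m') :
    N.onSpace i (D.auxBasis i m k) x = 0 := by
  have hK := hR.aux_isMesh i m hm
  have hK' := hR.aux_isMesh i m' hm'
  have hxs : N.coord i x ∈ (D.aux i m').space := by
    obtain ⟨j, s, hs, rfl⟩ := D.exists_mem_element hx
    obtain ⟨e, he, heq⟩ := hR.aux_edge i m' hm' j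
    refine Geometry.SimplicialComplex.convexHull_subset_space he ?_
    rw [heq, convexHull_pair, segment_eq_image_lineMap]
    refine ⟨s, hs, ?_⟩
    rw [← D.point_element, N.coord_point hm', D.node_eq, D.node_eq, N.coord_point hm',
      N.coord_point hm']
    exact (AffineMap.apply_lineMap (AffineMap.lineMap _ _ : ℝ →ᵃ[ℝ] Plane) _ _ s).symm
  -- The function lives on the closure of the interior of its own region, which is disjoint from the
  -- interior of the other region. Continuity on the fracture extends the zero from that interior to
  -- its closure, which contains the other trace.
  have h0 : EqOn (D.auxBasis i m k) (fun _ => 0) (interior (D.aux i m').space) := by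
    intro y hy
    refine hat_eq_zero (fun hys => ?_) _
    have h1 := hK.space_subset_closure_interior hys
    exact disjoint_left.1 ((hR.aux_disjoint i m hm m' hm' hne).symm.closure_right isOpen_interior)
      hy h1
  exact h0.of_subset_closure ((hR.aux_conforming i m hm k).1.mono (hR.aux_subset i m' hm'))
    continuousOn_const interior_subset hK'.space_subset_closure_interior hxs

end Discretization

/-! ### The stabilization term -/

namespace Discretization

variable {L M : ℕ} {N : DFN L M} {D : Discretization N} {i : Fin L} {m : Fin M} {σ : ℝ}

theorem exists_triangle (D : Discretization N) (i : Fin L) :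
    ∃ T ∈ (D.mesh i).faces, T.card = 3 := by
  obtain ⟨x, hx⟩ := (N.isPolygon i).connected.nonempty
  have hx' : x ∈ (D.mesh i).space := by rw [D.mesh_space i]; exact interior_subset hx
  obtain ⟨T, hT, -⟩ := (D.isMesh i).exists_tri hx'
  exact ⟨T, (D.isMesh i).mem_tris.1 hT⟩

/-- A triangle is at least as wide as the radius of a disc in it. A fracture is needed to have a
triangle. -/
theorem IsRegular.sigma_pos (hR : D.IsRegular σ) (i : Fin L) : 0 < σ := by
  obtain ⟨T, hT, hcard⟩ := D.exists_triangle i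
  obtain ⟨c, r, hr, hball, hd⟩ := hR.shape i T hT hcard
  have h1 := IsTriangularMesh.radius_le_triDiam hr hball
  by_contra h
  have := mul_nonpos_of_nonpos_of_nonneg (not_lt.1 h) hr.le
  linarith

/-- No triangle is wider than its fracture, so the mesh size is bounded in terms of the network and
`σ`. -/
theorem IsRegular.delta_le (hR : D.IsRegular σ) (i : Fin L) :
    D.δ ≤ σ ^ 2 * Metric.diam (N.poly i) := by
  have hσ := hR.sigma_pos i
  obtain ⟨T, hT, hcard⟩ := D.exists_triangle i
  have h1 : triDiam T ≤ Metric.diam (N.poly i) := by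
    refine Metric.diam_mono ?_ (N.isPolygon i).isCompact.isBounded
    rw [← D.mesh_space i]
    exact Geometry.SimplicialComplex.convexHull_subset_space hT
  calc D.δ ≤ σ * D.δF i := (hR.comparable i).2
    _ ≤ σ * (σ * triDiam T) := mul_le_mul_of_nonneg_left (hR.quasiUniform i T hT hcard).2 hσ.le
    _ ≤ σ * (σ * Metric.diam (N.poly i)) := by gcongr
    _ = _ := by ring

/-- The auxiliary functions of one trace vanish on the other traces of the fracture, so the
stabilization decouples into the individual traces. -/
theorem pairB_hat (hR : D.IsRegular σ) (hm : m ∈ N.traces i) (lam : Fin M → Space3 → ℝ)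
    (k : D.FreeNode m) : pairB N i lam (D.auxBasis i m k) =
      N.lineInt m fun x => lam m x * N.onSpace i (D.auxBasis i m k) x := by
  rw [pairB, Finset.sum_eq_single_of_mem m hm]
  intro m' hm' hne
  rw [N.lineInt_congr (g := fun _ => (0 : ℝ) * 0) fun x hx => by
    simp only
    rw [hR.onSpace_hat_eq_zero hm hm' hne.symm k hx, mul_zero, mul_zero], N.lineInt_const_mul,
    zero_mul]

theorem lineInt_mul_comb (hR : D.IsRegular σ) (hm : m ∈ N.traces i) {f : Space3 → ℝ}
    (hf : ContinuousOn f (N.trace m)) (c : D.FreeNode m → ℝ) :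
    N.lineInt m (fun x => f x * D.comb i m c x) =
      ∑ k, c k * N.lineInt m fun x => f x * N.onSpace i (D.auxBasis i m k) x := by
  have h : (fun x => f x * D.comb i m c x) =
      fun x => ∑ k, c k * (f x * N.onSpace i (D.auxBasis i m k) x) := by
    funext x
    rw [comb, Finset.mul_sum]
    exact Finset.sum_congr rfl fun k _ => by ring
  rw [h, N.lineInt_sum _ (f := fun k x => c k * (f x * N.onSpace i (D.auxBasis i m k) x))
    fun k _ => continuousOn_const.mul (hf.mul (hR.continuousOn_hat hm k))]
  exact Finset.sum_congr rfl fun k _ => N.lineInt_const_mul _ _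

theorem lineInt_comb_mul_hat (hR : D.IsRegular σ) (hm : m ∈ N.traces i) (c : D.FreeNode m → ℝ)
    (k : D.FreeNode m) :
    N.lineInt m (fun x => D.comb i m c x * N.onSpace i (D.auxBasis i m k) x) =
      Matrix.vecMul c (D.mass i m) k := by
  simp only [mul_comm (D.comb i m c _)]
  rw [lineInt_mul_comb hR hm (hR.continuousOn_hat hm k) c]
  simp only [Matrix.vecMul, dotProduct, mass]
  exact Finset.sum_congr rfl fun l _ => by simp only [mul_comm]

/-- By quasi-uniformity each element has length at least `δ / σ²`, and the factor 6 is that of the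
element mass matrix. This bounds the mass matrix from below by a multiple of `δ`. -/
theorem sum_sq_le_lineInt (hR : D.IsRegular σ) (hm : m ∈ N.traces i) (c : D.FreeNode m → ℝ) :
    D.δ / (6 * σ ^ 2) * ∑ k, c k ^ 2 ≤ N.lineInt m fun x => D.comb i m c x ^ 2 := by
  have hσ := hR.sigma_pos i
  have hl := N.length_pos (m := m)
  have hdist : ∀ k : Fin (D.num m), dist (D.node m k.castSucc) (D.node m k.succ) =
      (D.param m k.succ - D.param m k.castSucc) * N.length m := by
    intro k
    rw [dist_comm, D.node_eq, D.node_eq, DFN.point, DFN.point, dist_lineMap_lineMap, Real.dist_eq,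
      abs_of_pos (sub_pos.2 (D.param_strictMono m Fin.castSucc_lt_succ))]
    rfl
  have h1 := (hR.isP1Trace_comb hm c).piecewiseLinear.sum_sq_le (D.param_zero m) (D.param_last m)
    (D.param_strictMono m) (DFN.ContinuousOn.comp_point N (hR.continuousOn_comb hm c))
    (h := D.δ / (σ ^ 2 * N.length m)) (div_nonneg hR.δ_pos.le (by positivity)) (fun k => by
      rw [div_le_iff₀ (by positivity)]
      calc D.δ ≤ σ * D.δT m := (hR.comparable_trace m).2
        _ ≤ σ * (σ * dist (D.node m k.castSucc) (D.node m k.succ)) :=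
          mul_le_mul_of_nonneg_left (hR.quasiUniform_trace m k).2 hσ.le
        _ = _ := by rw [hdist]; ring)
  have h2 : ∑ k, c k ^ 2 ≤ ∑ j, D.comb i m c (N.point m (D.param m j)) ^ 2 := by
    calc ∑ k, c k ^ 2 = ∑ k : D.FreeNode m, D.comb i m c (N.point m (D.param m k)) ^ 2 :=
          Finset.sum_congr rfl fun k _ => by rw [← D.node_eq, hR.comb_node hm c k]
      _ = ∑ j ∈ Finset.univ.map (Function.Embedding.subtype _),
          D.comb i m c (N.point m (D.param m j)) ^ 2 := by rw [Finset.sum_map]; rfl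
      _ ≤ _ := Finset.sum_le_sum_of_subset_of_nonneg (Finset.subset_univ _)
          fun _ _ _ => sq_nonneg _
  rw [N.lineInt_eq]
  have hδ := hR.δ_pos
  calc D.δ / (6 * σ ^ 2) * ∑ k, c k ^ 2 ≤
        D.δ / (6 * σ ^ 2) * ∑ j, D.comb i m c (N.point m (D.param m j)) ^ 2 :=
        mul_le_mul_of_nonneg_left h2 (by positivity)
    _ = N.length m * (D.δ / (σ ^ 2 * N.length m) / 6 *
        ∑ j, D.comb i m c (N.point m (D.param m j)) ^ 2) := by
        field_simp
    _ ≤ _ := mul_le_mul_of_nonneg_left h1 hl.le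

/-- The mass matrix is a Gram matrix, and a combination of zero `L²` norm has zero coefficients by
the nodal lower bound. Only now is the inverse in `dualBasis` a genuine inverse. -/
theorem isUnit_det_mass (hR : D.IsRegular σ) (hm : m ∈ N.traces i) :
    IsUnit (D.mass i m).det := by
  classical
  have hσ := hR.sigma_pos i
  have hδ := hR.δ_pos
  rw [← Matrix.isUnit_iff_isUnit_det, ← Matrix.vecMul_injective_iff_isUnit]
  refine (injective_iff_map_eq_zero (D.mass i m).vecMulLinear).2 fun c hc => ?_
  have hc' : Matrix.vecMul c (D.mass i m) = 0 := hc
  have h1 : N.lineInt m (fun x => D.comb i m c x ^ 2) = 0 := by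
    simp only [sq]
    rw [lineInt_mul_comb hR hm (hR.continuousOn_comb hm c)]
    simp_rw [lineInt_comb_mul_hat hR hm, hc']
    simp
  have h2 := sum_sq_le_lineInt hR hm c
  rw [h1] at h2
  have h3 : ∑ k, c k ^ 2 ≤ 0 := by
    have : 0 < D.δ / (6 * σ ^ 2) := by positivity
    exact nonpos_of_mul_nonpos_right h2 this
  have h4 := (Finset.sum_eq_zero_iff_of_nonneg fun k _ => sq_nonneg (c k)).1
    (le_antisymm h3 (Finset.sum_nonneg fun k _ => sq_nonneg (c k)))
  funext k
  simpa using h4 k (Finset.mem_univ k)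

open Classical in
variable (D) in
/-- The coefficients of the discrete Riesz representative of a functional. -/
noncomputable def rieszCoeff (i : Fin L) (m : Fin M) (f : (Plane → ℝ) → ℝ) : D.FreeNode m → ℝ :=
  Matrix.vecMul (fun k => f (D.auxBasis i m k)) (D.mass i m)⁻¹

theorem comb_rieszCoeff (f : (Plane → ℝ) → ℝ) (x : Space3) :
    D.comb i m (D.rieszCoeff i m f) x = ∑ k, f (D.auxBasis i m k) * D.dualBasis i m k x := by
  simp only [comb, rieszCoeff, Matrix.vecMul, dotProduct, dualBasis, Finset.mul_sum,
    Finset.sum_mul]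
  rw [Finset.sum_comm]
  exact Finset.sum_congr rfl fun k _ => Finset.sum_congr rfl fun l _ => by ring

/-- The defining property of the Riesz representative; it uses the invertibility of the mass matrix.
-/
theorem lineInt_comb_rieszCoeff_mul_hat (hR : D.IsRegular σ) (hm : m ∈ N.traces i)
    (f : (Plane → ℝ) → ℝ) (k : D.FreeNode m) :
    N.lineInt m (fun x => D.comb i m (D.rieszCoeff i m f) x * N.onSpace i (D.auxBasis i m k) x) =
      f (D.auxBasis i m k) := by
  classical
  rw [lineInt_comb_mul_hat hR hm, rieszCoeff, Matrix.vecMul_vecMul,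
    Matrix.nonsing_inv_mul _ (isUnit_det_mass hR hm), Matrix.vecMul_one]

/-- The stabilization is the scalar product of the Riesz representatives. -/
theorem stabLocal_eq (hR : D.IsRegular σ) (hm : m ∈ N.traces i) (f g : (Plane → ℝ) → ℝ) :
    D.stabLocal i m f g = D.δ * N.lineInt m fun x =>
      D.comb i m (D.rieszCoeff i m f) x * D.comb i m (D.rieszCoeff i m g) x := by
  have hc : ∀ k, ContinuousOn (D.dualBasis i m k) (N.trace m) := fun k =>
    continuousOn_finsetSum _ fun l _ => continuousOn_const.mul (hR.continuousOn_hat hm l)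
  have h : (fun x => D.comb i m (D.rieszCoeff i m f) x * D.comb i m (D.rieszCoeff i m g) x) =
      fun x => ∑ k, ∑ l, (f (D.auxBasis i m l) * g (D.auxBasis i m k)) *
        (D.dualBasis i m k x * D.dualBasis i m l x) := by
    funext x
    rw [comb_rieszCoeff, comb_rieszCoeff, mul_comm, Finset.sum_mul_sum]
    exact Finset.sum_congr rfl fun k _ => Finset.sum_congr rfl fun l _ => by ring
  have hkl : ∀ k l, ContinuousOn (fun x => (f (D.auxBasis i m l) * g (D.auxBasis i m k)) *
      (D.dualBasis i m k x * D.dualBasis i m l x)) (N.trace m) := fun k l =>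
    continuousOn_const.mul ((hc k).mul (hc l))
  rw [h, N.lineInt_sum _ fun k _ => continuousOn_finsetSum _ fun l _ => hkl k l, stabLocal,
    Finset.mul_sum]
  refine Finset.sum_congr rfl fun k _ => ?_
  rw [N.lineInt_sum _ fun l _ => hkl k l, Finset.mul_sum]
  refine Finset.sum_congr rfl fun l _ => ?_
  rw [N.lineInt_const_mul]
  simp only [dualMass]
  ring

/-- The Riesz representative of the pairing with a multiplier is the multiplier. -/
theorem comb_rieszCoeff_pairB (hR : D.IsRegular σ) (hm : m ∈ N.traces i)
    {lam : Fin M → Space3 → ℝ} (hl : D.TraceSpace m (lam m)) :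
    EqOn (D.comb i m (D.rieszCoeff i m (pairB N i lam))) (lam m) (N.trace m) := by
  classical
  have h1 := hR.eqOn_comb hm hl
  suffices h : D.rieszCoeff i m (pairB N i lam) =
      fun k : D.FreeNode m => lam m (D.node m k) by
    rw [h]; exact h1.symm
  have h2 : (fun k => pairB N i lam (D.auxBasis i m k)) =
      Matrix.vecMul (fun k : D.FreeNode m => lam m (D.node m k)) (D.mass i m) := by
    funext k
    rw [pairB_hat hR hm, ← lineInt_comb_mul_hat hR hm]
    exact N.lineInt_congr fun x hx => by rw [h1 hx]
  rw [rieszCoeff, h2, Matrix.vecMul_vecMul, Matrix.mul_nonsing_inv _ (isUnit_det_mass hR hm),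
    Matrix.vecMul_one]

theorem comb_rieszCoeff_add (f g : (Plane → ℝ) → ℝ) (a b : ℝ) (x : Space3) :
    D.comb i m (D.rieszCoeff i m fun w => a * f w + b * g w) x =
      a * D.comb i m (D.rieszCoeff i m f) x + b * D.comb i m (D.rieszCoeff i m g) x := by
  simp only [comb_rieszCoeff, Finset.mul_sum]
  rw [← Finset.sum_add_distrib]
  exact Finset.sum_congr rfl fun k _ => by ring

/-! ### The diffusion form -/

theorem semiSq_eq (v : Plane → ℝ) : semiSq N i v = ∫ x in N.poly i, gradSq v x := rfl

theorem semiSq_nonneg (v : Plane → ℝ) : 0 ≤ semiSq N i v :=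
  integral_nonneg fun x => gradSq_nonneg v x

theorem integrableOn_formA {u v : Plane → ℝ} (hu : BoundedGradient (N.poly i) u)
    (hv : BoundedGradient (N.poly i) v) :
    IntegrableOn (fun x => ∑ a, ∑ b, N.tensor i a b * pd b u x * pd a v x) (N.poly i) := by
  refine integrable_finsetSum _ fun a _ => integrable_finsetSum _ fun b _ => ?_
  simp only [mul_assoc]
  exact (hu.integrableOn_mul (N.isPolygon i).isCompact hv b a).const_mul _

/-- Young's inequality for each pair of partial derivatives; the free weight `η` is used later to
absorb a term. -/
theorem abs_formA_le {u v : Plane → ℝ} (hu : BoundedGradient (N.poly i) u)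
    (hv : BoundedGradient (N.poly i) v) {η : ℝ} (hη : 0 < η) :
    |formA N i u v| ≤ (∑ a, ∑ b, |N.tensor i a b|) *
      (η / 2 * semiSq N i u + 1 / (2 * η) * semiSq N i v) := by
  have hc := (N.isPolygon i).isCompact
  have hiu := hu.integrableOn_gradSq hc
  have hiv := hv.integrableOn_gradSq hc
  rw [semiSq_eq, semiSq_eq, ← integral_const_mul, ← integral_const_mul,
    ← integral_add (hiu.const_mul _) (hiv.const_mul _), ← integral_const_mul, ← Real.norm_eq_abs]
  refine norm_integral_le_of_norm_le
    (((hiu.const_mul _).add (hiv.const_mul _)).const_mul _) (Eventually.of_forall fun x => ?_)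
  have h1 : ∀ (w : Plane → ℝ) (a : Fin 2), pd a w x ^ 2 ≤ gradSq w x := fun w a =>
    Finset.single_le_sum (f := fun a => pd a w x ^ 2) (fun _ _ => sq_nonneg _) (Finset.mem_univ a)
  have h2 : ∀ a b, |pd b u x * pd a v x| ≤ η / 2 * gradSq u x + 1 / (2 * η) * gradSq v x := by
    intro a b
    have h3 : |pd b u x * pd a v x| ≤ η / 2 * pd b u x ^ 2 + 1 / (2 * η) * pd a v x ^ 2 := by
      rw [abs_mul, ← sq_abs (pd b u x), ← sq_abs (pd a v x)]
      set p := |pd b u x|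
      set q := |pd a v x|
      have : η / 2 * p ^ 2 + 1 / (2 * η) * q ^ 2 - p * q = (η * p - q) ^ 2 / (2 * η) := by
        field_simp; ring
      have : 0 ≤ (η * p - q) ^ 2 / (2 * η) := by positivity
      linarith
    refine h3.trans (add_le_add ?_ ?_)
    · exact mul_le_mul_of_nonneg_left (h1 u b) (by positivity)
    · exact mul_le_mul_of_nonneg_left (h1 v a) (by positivity)
  rw [Finset.sum_mul]
  refine (norm_sum_le _ _).trans (Finset.sum_le_sum fun a _ => ?_)
  rw [Finset.sum_mul]
  refine (norm_sum_le _ _).trans (Finset.sum_le_sum fun b _ => ?_)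
  rw [mul_assoc, norm_mul, Real.norm_eq_abs, Real.norm_eq_abs]
  exact mul_le_mul_of_nonneg_left (h2 a b) (abs_nonneg _)

/-- Coercivity of the diffusion form. -/
theorem le_formA_self {u : Plane → ℝ} (hu : BoundedGradient (N.poly i) u) :
    (N.tensor i).det / (N.tensor i).trace * semiSq N i u ≤ formA N i u u := by
  have hc := (N.isPolygon i).isCompact
  have hpd := N.tensor_posDef i
  have htr : 0 < (N.tensor i).trace := hpd.trace_pos
  rw [semiSq_eq, ← integral_const_mul]
  refine integral_mono ((hu.integrableOn_gradSq hc).const_mul _) (integrableOn_formA hu hu)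
    fun x => ?_
  have hsymm : N.tensor i 1 0 = N.tensor i 0 1 := by
    have := hpd.isHermitian.apply 0 1
    simpa using this
  simp only [gradSq, Fin.sum_univ_two, Matrix.det_fin_two] at htr ⊢
  rw [Matrix.trace_fin_two] at htr ⊢
  rw [hsymm, div_mul_eq_mul_div, div_le_iff₀ htr]
  set k := N.tensor i
  set p := pd 0 u x
  set q := pd 1 u x
  -- By Cayley–Hamilton, `tr k ⟨k x, x⟩ - det k |x|² = |k x|²`; the two squares are its components.
  nlinarith [sq_nonneg (k 0 0 * p + k 0 1 * q), sq_nonneg (k 0 1 * p + k 1 1 * q)]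

theorem tensor_const_pos (N : DFN L M) (i : Fin L) :
    0 < (N.tensor i).det / (N.tensor i).trace :=
  div_pos (N.tensor_posDef i).det_pos (N.tensor_posDef i).trace_pos

theorem isP1_auxBasis (k : D.FreeNode m) : IsP1 (D.aux i m) (D.auxBasis i m k) :=
  fun _ hT hcard => exists_affine_hat hT hcard _

theorem auxBasis_eq_zero (k : D.FreeNode m) : ∀ x ∉ (D.aux i m).space, D.auxBasis i m k x = 0 :=
  fun _ hx => hat_eq_zero hx _

variable (D) in
/-- The function on the fracture with given coefficients in the auxiliary basis. -/
noncomputable def lift (i : Fin L) (m : Fin M) (c : D.FreeNode m → ℝ) (x : Plane) : ℝ :=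
  ∑ k, c k * D.auxBasis i m k x

theorem isP1_lift (c : D.FreeNode m → ℝ) : IsP1 (D.aux i m) (D.lift i m c) := by
  intro T hT hcard
  choose g hg using fun k : D.FreeNode m => isP1_auxBasis (i := i) k T hT hcard
  refine ⟨∑ k, c k • g k, fun x hx => ?_⟩
  have : ∀ S : Finset (D.FreeNode m), (∑ k ∈ S, c k • g k) x = ∑ k ∈ S, c k * g k x := by
    classical
    intro S
    induction S using Finset.induction_on with
    | empty => simp
    | insert z s hz ih =>
      rw [Finset.sum_insert hz, Finset.sum_insert hz, ← ih]; rfl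
  rw [this, lift]
  exact Finset.sum_congr rfl fun k _ => by rw [hg k hx]

theorem lift_eq_zero (c : D.FreeNode m → ℝ) : ∀ x ∉ (D.aux i m).space, D.lift i m c x = 0 :=
  fun x hx => Finset.sum_eq_zero fun k _ => by rw [auxBasis_eq_zero k x hx, mul_zero]

/-- The lift vanishes at all vertices of the auxiliary mesh other than the free trace nodes, where
its values are the coefficients. -/
theorem semiSq_lift_le (hR : D.IsRegular σ) (hm : m ∈ N.traces i) (c : D.FreeNode m → ℝ) :
    semiSq N i (D.lift i m c) ≤
      2 * volume.real (Metric.ball (0 : Plane) 1) * σ ^ 4 * ∑ k, c k ^ 2 := by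
  classical
  have hσ := hR.sigma_pos i
  have hinj : Function.Injective fun k : D.FreeNode m => N.coord i (D.node m k) :=
    ((N.coord_point_injective hm).comp (D.param_strictMono m).injective).comp
      Subtype.val_injective
  have h := (hR.aux_isMesh i m hm).integral_gradSq_le hσ (hR.aux_shape i m hm)
    (isP1_lift c) (lift_eq_zero c) (Finset.univ.image fun k : D.FreeNode m => N.coord i (D.node m k))
    (fun T hT y hy hyZ => Finset.sum_eq_zero fun k _ => by
      rw [auxBasis, hat_vertex ((hR.aux_isMesh i m hm).mem_tris.1 hT).1 hy, if_neg, mul_zero]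
      rintro rfl
      exact hyZ (Finset.mem_image_of_mem _ (Finset.mem_univ k))) (N.poly i)
  rw [Finset.sum_image fun k _ l _ h => hinj h] at h
  refine h.trans_eq ?_
  congr 1
  exact Finset.sum_congr rfl fun k _ => congrArg (· ^ 2) (hR.comb_node hm c k)

theorem formA_lift (hR : D.IsRegular σ) (hm : m ∈ N.traces i) {u : Plane → ℝ}
    (hu : BoundedGradient (N.poly i) u) (c : D.FreeNode m → ℝ) :
    formA N i u (D.lift i m c) = ∑ k, c k * formA N i u (D.auxBasis i m k) := by
  have hb : ∀ k : D.FreeNode m, BoundedGradient (N.poly i) (D.auxBasis i m k) := fun k =>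
    (hR.aux_isMesh i m hm).boundedGradient_of_zero (isP1_auxBasis k) (auxBasis_eq_zero k) _
  have hd : ∀ᵐ x, ∀ k : D.FreeNode m, DifferentiableAt ℝ (D.auxBasis i m k) x :=
    ae_all_iff.2 fun k =>
      (hR.aux_isMesh i m hm).ae_differentiableAt_of_zero (isP1_auxBasis k) (auxBasis_eq_zero k)
  unfold formA
  simp_rw [← integral_const_mul]
  rw [← integral_finsetSum _ fun k _ => (integrableOn_formA hu (hb k)).const_mul (c k)]
  refine integral_congr_ae (ae_restrict_of_ae ?_)
  filter_upwards [hd] with x hx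
  have h1 : ∀ a, pd a (D.lift i m c) x = ∑ k, c k * pd a (D.auxBasis i m k) x := by
    intro a
    have h2 : HasFDerivAt (D.lift i m c) (∑ k, c k • fderiv ℝ (D.auxBasis i m k) x) x :=
      HasFDerivAt.fun_sum fun k _ => (hx k).hasFDerivAt.const_mul (c k)
    rw [pd, h2.fderiv, _root_.sum_apply]
    rfl
  simp_rw [h1, Finset.mul_sum]
  rw [Finset.sum_comm (s := (Finset.univ : Finset (D.FreeNode m)))]
  refine Finset.sum_congr rfl fun a _ => ?_
  rw [Finset.sum_comm (s := (Finset.univ : Finset (D.FreeNode m)))]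
  exact Finset.sum_congr rfl fun b _ => Finset.sum_congr rfl fun k _ => by ring

/-- The Riesz representative of the diffusion form. -/
theorem delta_lineInt_riesz_formA_le (hR : D.IsRegular σ) (hm : m ∈ N.traces i) {u : Plane → ℝ}
    (hu : BoundedGradient (N.poly i) u) :
    D.δ * N.lineInt m (fun x => D.comb i m (D.rieszCoeff i m (formA N i u)) x ^ 2) ≤
      12 * volume.real (Metric.ball (0 : Plane) 1) * σ ^ 6 * (∑ a, ∑ b, |N.tensor i a b|) ^ 2 *
        semiSq N i u := by
  have hσ := hR.sigma_pos i
  have hδ := hR.δ_pos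
  set c := D.rieszCoeff i m (formA N i u) with hc
  set X := N.lineInt m fun x => D.comb i m c x ^ 2 with hX
  set ω := volume.real (Metric.ball (0 : Plane) 1)
  set κ := ∑ a, ∑ b, |N.tensor i a b|
  have hκ : 0 < κ := by
    have h1 := (N.tensor_posDef i).trace_pos
    rw [Matrix.trace_fin_two] at h1
    simp only [κ, Fin.sum_univ_two]
    linarith [le_abs_self (N.tensor i 0 0), le_abs_self (N.tensor i 1 1),
      abs_nonneg (N.tensor i 0 1), abs_nonneg (N.tensor i 1 0)]
  have hω : 0 < ω := ENNReal.toReal_pos (Metric.measure_ball_pos volume _ one_pos).ne'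
    measure_ball_lt_top.ne
  -- The representative is tested with itself: the functional is evaluated at the lift with the same
  -- coefficients.
  have h1 : X = formA N i u (D.lift i m c) := by
    rw [formA_lift hR hm hu, hX]
    simp only [sq]
    rw [lineInt_mul_comb hR hm (hR.continuousOn_comb hm c)]
    exact Finset.sum_congr rfl fun k _ => by rw [lineInt_comb_rieszCoeff_mul_hat hR hm]
  have h2 := sum_sq_le_lineInt hR hm c
  have h3 := semiSq_lift_le hR hm c
  set S := ∑ k, c k ^ 2
  have h4 : semiSq N i (D.lift i m c) ≤ 12 * ω * σ ^ 6 / D.δ * X := by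
    calc _ ≤ 2 * ω * σ ^ 4 * S := h3
      _ = 12 * ω * σ ^ 6 / D.δ * (D.δ / (6 * σ ^ 2) * S) := by field_simp; ring
      _ ≤ _ := mul_le_mul_of_nonneg_left h2 (by positivity)
  -- With this weight the term of the lift in Young's inequality becomes exactly `X / 2`, which is
  -- absorbed on the left.
  have hη : 0 < κ * (12 * ω * σ ^ 6 / D.δ) := by positivity
  have h5 := abs_formA_le hu ((hR.aux_isMesh i m hm).boundedGradient_of_zero (isP1_lift c)
    (lift_eq_zero c) (N.poly i)) hη
  rw [← h1] at h5
  set E := semiSq N i u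
  set B := 12 * ω * σ ^ 6 / D.δ with hB
  have hB0 : 0 < B := by positivity
  have h6 : X ≤ κ * (κ * B / 2 * E) + X / 2 := by
    calc X ≤ |X| := le_abs_self X
      _ ≤ _ := h5
      _ ≤ κ * (κ * B / 2 * E + 1 / (2 * (κ * B)) * (B * X)) := by gcongr
      _ = _ := by field_simp
  have h7 : X ≤ κ ^ 2 * B * E := by linarith
  calc D.δ * X ≤ D.δ * (κ ^ 2 * B * E) := mul_le_mul_of_nonneg_left h7 hδ.le
    _ = _ := by rw [hB]; field_simp

end Discretization

/-! ### The mean jumps -/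

namespace DFN

variable {L M : ℕ} (N : DFN L M) {m : Fin M}

theorem fst_mem (m : Fin M) : m ∈ N.traces (N.fst m) := N.mem_traces.2 (Or.inl rfl)

theorem snd_mem (m : Fin M) : m ∈ N.traces (N.snd m) := N.mem_traces.2 (Or.inr rfl)

/-- Sums over fractures and their traces, ordered by traces. -/
theorem sum_traces (F : Fin L → Fin M → ℝ) :
    ∑ i, ∑ m ∈ N.traces i, F i m = ∑ m, (F (N.fst m) m + F (N.snd m) m) := by
  rw [Finset.sum_comm' (t' := Finset.univ) (s' := fun m => {N.fst m, N.snd m})]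
  · exact Finset.sum_congr rfl fun m _ => Finset.sum_pair (N.fst_lt_snd m).ne
  · intro i m
    simp [N.mem_traces, eq_comm]

end DFN

/-- The explicit constant, unlike a minimum, also makes sense for an empty index set. -/
theorem exists_pos_forall_le {ι : Type*} [Fintype ι] {f : ι → ℝ} (hf : ∀ i, 0 < f i) :
    ∃ c, 0 < c ∧ ∀ i, c ≤ f i := by
  have h0 : ∀ i, 0 ≤ (f i)⁻¹ := fun i => (inv_pos.2 (hf i)).le
  have h1 : 0 < 1 + ∑ i, (f i)⁻¹ := by
    have := Finset.sum_nonneg fun i (_ : i ∈ Finset.univ) => h0 i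
    linarith
  refine ⟨(1 + ∑ i, (f i)⁻¹)⁻¹, inv_pos.2 h1, fun i => inv_le_of_inv_le₀ (hf i) ?_⟩
  have := Finset.single_le_sum (fun i _ => h0 i) (Finset.mem_univ i)
  linarith

theorem exists_nonneg_forall_ge {ι : Type*} [Fintype ι] (f : ι → ℝ) :
    ∃ C, 0 ≤ C ∧ ∀ i, f i ≤ C :=
  ⟨∑ i, |f i|, Finset.sum_nonneg fun _ _ => abs_nonneg _, fun i => (le_abs_self _).trans
    (Finset.single_le_sum (f := fun i => |f i|) (fun _ _ => abs_nonneg _) (Finset.mem_univ i))⟩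

namespace Discretization

variable {L M : ℕ} {N : DFN L M} {D : Discretization N} {i : Fin L} {m : Fin M} {σ : ℝ}

variable (D) in
/-- The largest discrete function on the trace with values in the unit interval. -/
noncomputable def cutoff (m : Fin M) : Space3 → ℝ := D.comb (N.fst m) m fun _ => 1

theorem IsRegular.cutoff_node (hR : D.IsRegular σ) {k : Fin (D.num m + 1)} :
    D.cutoff m (D.node m k) = 0 ∧ D.node m k ∈ N.dirichlet ∨
      D.cutoff m (D.node m k) = 1 ∧ D.node m k ∉ N.dirichlet := by
  by_cases hk : D.node m k ∈ N.dirichlet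
  · exact Or.inl ⟨hR.comb_node_dirichlet (N.fst_mem m) _ hk, hk⟩
  · exact Or.inr ⟨hR.comb_node (N.fst_mem m) (fun _ => 1) ⟨k, hk⟩, hk⟩

theorem IsRegular.traceSpace_cutoff (hR : D.IsRegular σ) (m : Fin M) :
    D.TraceSpace m (D.cutoff m) := hR.traceSpace_comb (N.fst_mem m) _

theorem IsRegular.cutoff_mem (hR : D.IsRegular σ) {x : Space3} (hx : x ∈ N.trace m) :
    D.cutoff m x ∈ Icc (0 : ℝ) 1 := by
  obtain ⟨k, s, hs, rfl⟩ := D.exists_mem_element hx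
  rw [(hR.traceSpace_cutoff m).isP1Trace k s hs]
  have h1 := hs.1
  have h2 := hs.2
  rcases hR.cutoff_node (m := m) (k := k.castSucc) with ⟨h, -⟩ | ⟨h, -⟩ <;>
  rcases hR.cutoff_node (m := m) (k := k.succ) with ⟨h', -⟩ | ⟨h', -⟩ <;>
  rw [h, h'] <;> constructor <;> linarith

/-- On each element the two nodal values of the cutoff add up to at least 1. Otherwise both end
points would be Dirichlet points, hence the two ends of the trace, and the single element would
leave no free node. The trapezoidal rule then gives the factor 1/2. -/
theorem IsRegular.length_div_two_le (hR : D.IsRegular σ) (m : Fin M) :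
    N.length m / 2 ≤ N.lineInt m (D.cutoff m) := by
  have hT := hR.traceSpace_cutoff m
  have end_of : ∀ k, D.node m k ∈ N.dirichlet → k = 0 ∨ k = Fin.last _ := by
    intro k hk
    have e : D.node m 0 = N.ptA m := by simp [node, D.param_zero]
    have e' : D.node m (Fin.last _) = N.ptB m := by simp [node, D.param_last]
    rcases N.dirichlet_inter_trace m ⟨hk, D.node_mem k⟩ with h | h
    · exact Or.inl (D.node_injective (h.trans e.symm))
    · exact Or.inr (D.node_injective ((mem_singleton_iff.1 h).trans e'.symm))
  have h1 : ∀ k : Fin (D.num m), 1 ≤ D.cutoff m (D.node m k.castSucc) +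
      D.cutoff m (D.node m k.succ) := by
    intro k
    rcases hR.cutoff_node (m := m) (k := k.castSucc) with ⟨h, hd⟩ | ⟨h, -⟩ <;>
    rcases hR.cutoff_node (m := m) (k := k.succ) with ⟨h', hd'⟩ | ⟨h', -⟩ <;>
    rw [h, h'] <;> norm_num
    obtain ⟨j, hj⟩ := hR.exists_free m
    have hk0 : k.1 = 0 := by
      rcases end_of _ hd with h | h
      · simpa [Fin.ext_iff] using h
      · exact absurd h (Fin.castSucc_lt_last k).ne
    have hk1 : k.1 + 1 = D.num m := by
      rcases end_of _ hd' with h | h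
      · exact absurd h (Fin.succ_ne_zero k)
      · simpa [Fin.ext_iff] using h
    have hj' : j = k.castSucc ∨ j = k.succ := by
      rw [Fin.ext_iff, Fin.ext_iff]
      simp only [Fin.val_castSucc, Fin.val_succ]
      have := j.2
      omega
    rcases hj' with rfl | rfl
    · exact hj hd
    · exact hj hd'
  have hone : PiecewiseLinear (D.param m) fun _ => (1 : ℝ) := fun k s _ => by ring
  have h2 := hone.integral_eq (D.param_zero m) (D.param_last m) (D.param_strictMono m)
    continuousOn_const
  have h3 := hT.isP1Trace.piecewiseLinear.integral_eq (D.param_zero m) (D.param_last m)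
    (D.param_strictMono m) (DFN.ContinuousOn.comp_point N hT.1)
  have h4 : (1 : ℝ) / 2 ≤ ∫ s in (0 : ℝ)..1, D.cutoff m (N.point m s) := by
    rw [h3]
    have : (1 : ℝ) / 2 = 1 / 2 * ∫ s in (0 : ℝ)..1, (1 : ℝ) := by simp
    rw [this, h2, Finset.mul_sum]
    refine Finset.sum_le_sum fun k _ => ?_
    have hp := sub_nonneg.2 ((D.param_strictMono m) (Fin.castSucc_lt_succ (i := k))).le
    have := mul_le_mul_of_nonneg_left (h1 k) hp
    simp only [D.node_eq] at this
    linarith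
  rw [N.lineInt_eq]
  have := mul_le_mul_of_nonneg_left h4 (N.length_pos (m := m)).le
  linarith

/-- The jump of `u` on a trace. -/
noncomputable def jump (N : DFN L M) (u : Fin L → Plane → ℝ) (m : Fin M) (x : Space3) : ℝ :=
  N.onSpace (N.fst m) (u (N.fst m)) x - N.onSpace (N.snd m) (u (N.snd m)) x

theorem continuousOn_jump {u : Fin L → Plane → ℝ} (hu : D.InV u) (m : Fin M) :
    ContinuousOn (jump N u m) (N.trace m) :=
  (N.continuousOn_onSpace (N.fst_mem m) (hu _).1.1).sub
    (N.continuousOn_onSpace (N.snd_mem m) (hu _).1.1)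

theorem meanJump_eq (u : Fin L → Plane → ℝ) (m : Fin M) :
    meanJump N u m = ∫ s in (0 : ℝ)..1, jump N u m (N.point m s) := by
  rw [meanJump, N.lineInt_eq, ← mul_assoc, inv_mul_cancel₀ N.length_pos.ne', one_mul]
  rfl

theorem boundedGradient (D : Discretization N) {u : Fin L → Plane → ℝ} (hu : D.InV u)
    (i : Fin L) : BoundedGradient (N.poly i) (u i) := by
  have := (D.isMesh i).exists_pd_bound (hu i).2
  rwa [D.mesh_space i] at this

/-- The oscillation of the jump on a trace is controlled by the gradients. -/
theorem exists_jump_bound (N : DFN L M) : ∃ C : ℝ, 0 ≤ C ∧ ∀ (D : Discretization N)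
    (u : Fin L → Plane → ℝ), D.InV u → ∀ m,
      ∫ s in (0 : ℝ)..1, |jump N u m (N.point m s) - meanJump N u m| ≤
        C * √(∑ i, semiSq N i (u i)) := by
  -- The constants are fixed per fracture and trace before the discretization and `u` are
  -- introduced.
  have h1 : ∀ (i : Fin L) (m : Fin M), ∃ C : ℝ, m ∈ N.traces i → 0 ≤ C ∧
      ∀ (D : Discretization N) (u : Fin L → Plane → ℝ), D.InV u →
      ∫ s in (0 : ℝ)..1, |N.onSpace i (u i) (N.point m s) -
        ∫ t in (0 : ℝ)..1, N.onSpace i (u i) (N.point m t)| ≤ C * √(∑ i, semiSq N i (u i)) := by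
    intro i m
    by_cases hm : m ∈ N.traces i
    · obtain ⟨C, hC0, hC⟩ := (N.isPolygon i).exists_poincare (N.coord_ptA_ne hm)
        (N.segment_coord_subset hm)
      refine ⟨C, fun _ => ⟨hC0, fun D u hu => ?_⟩⟩
      have h2 := hC (D.mesh i) (D.isMesh i) (D.mesh_space i) (u i) (hu i).1.1 (hu i).2
      have h3 : ∀ s, N.onSpace i (u i) (N.point m s) = u i (AffineMap.lineMap
          (N.coord i (N.ptA m)) (N.coord i (N.ptB m)) s) := fun s =>
        congrArg (u i) (N.coord_point hm s)
      simp only [h3]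
      refine h2.trans (mul_le_mul_of_nonneg_left (Real.sqrt_le_sqrt ?_) hC0)
      exact Finset.single_le_sum (f := fun i => semiSq N i (u i)) (fun _ _ => semiSq_nonneg _)
        (Finset.mem_univ i)
    · exact ⟨0, fun h => absurd h hm⟩
  choose C hC using h1
  obtain ⟨B, hB0, hB⟩ := exists_nonneg_forall_ge fun m => C (N.fst m) m + C (N.snd m) m
  refine ⟨B, hB0, fun D u hu m => ?_⟩
  have ha := (hC _ m (N.fst_mem m)).2 D u hu
  have hb := (hC _ m (N.snd_mem m)).2 D u hu
  set f := fun s => N.onSpace (N.fst m) (u (N.fst m)) (N.point m s) with hf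
  set g := fun s => N.onSpace (N.snd m) (u (N.snd m)) (N.point m s) with hg
  have hfc := N.continuousOn_onSpace (N.fst_mem m) (hu (N.fst m)).1.1
  have hgc := N.continuousOn_onSpace (N.snd_mem m) (hu (N.snd m)).1.1
  have hmean : meanJump N u m = (∫ t in (0 : ℝ)..1, f t) - ∫ t in (0 : ℝ)..1, g t := by
    rw [meanJump_eq]
    exact intervalIntegral.integral_sub (N.intervalIntegrable_comp_point hfc)
      (N.intervalIntegrable_comp_point hgc)
  have hfi := ((N.intervalIntegrable_comp_point hfc).sub (intervalIntegrable_const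
    (c := ∫ t in (0 : ℝ)..1, f t))).abs
  have hgi := ((N.intervalIntegrable_comp_point hgc).sub (intervalIntegrable_const
    (c := ∫ t in (0 : ℝ)..1, g t))).abs
  calc _ ≤ ∫ s in (0 : ℝ)..1, (|f s - ∫ t in (0 : ℝ)..1, f t| +
        |g s - ∫ t in (0 : ℝ)..1, g t|) := by
        refine intervalIntegral.integral_mono_on zero_le_one ?_ (hfi.add hgi) fun s _ => ?_
        · exact ((N.intervalIntegrable_comp_point (continuousOn_jump hu m)).sub
            intervalIntegrable_const).abs
        · rw [hmean]
          have : jump N u m (N.point m s) - ((∫ t in (0 : ℝ)..1, f t) - ∫ t in (0 : ℝ)..1, g t) =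
            (f s - ∫ t in (0 : ℝ)..1, f t) - (g s - ∫ t in (0 : ℝ)..1, g t) := by
            simp only [jump, hf, hg]; ring
          rw [this]
          exact abs_sub _ _
    _ = (∫ s in (0 : ℝ)..1, |f s - ∫ t in (0 : ℝ)..1, f t|) +
        ∫ s in (0 : ℝ)..1, |g s - ∫ t in (0 : ℝ)..1, g t| :=
        intervalIntegral.integral_add hfi hgi
    _ ≤ C (N.fst m) m * √(∑ i, semiSq N i (u i)) + C (N.snd m) m * √(∑ i, semiSq N i (u i)) :=
        add_le_add ha hb
    _ ≤ _ := by
        rw [← add_mul]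
        exact mul_le_mul_of_nonneg_right (hB m) (Real.sqrt_nonneg _)

/-- The pairing of the jump with the cutoff function controls the mean jump. -/
theorem IsRegular.meanJump_mul_lineInt (hR : D.IsRegular σ) {u : Fin L → Plane → ℝ}
    (hu : D.InV u) (m : Fin M) {B : ℝ} (hB : ∫ s in (0 : ℝ)..1,
      |jump N u m (N.point m s) - meanJump N u m| ≤ B) :
    N.length m * (meanJump N u m ^ 2 / 4 - B ^ 2) ≤
      meanJump N u m * N.lineInt m fun x => D.cutoff m x * jump N u m x := by
  set J := meanJump N u m with hJ
  have hχc := (hR.traceSpace_cutoff m).1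
  have hjc := continuousOn_jump hu m
  have hl := N.length_pos (m := m)
  have hd : ContinuousOn (fun x => jump N u m x - J) (N.trace m) := hjc.sub continuousOn_const
  have h1 : N.lineInt m (fun x => D.cutoff m x * jump N u m x) = J * N.lineInt m (D.cutoff m) +
      N.lineInt m fun x => D.cutoff m x * (jump N u m x - J) := by
    rw [← N.lineInt_const_mul, ← N.lineInt_add (f := fun x => J * D.cutoff m x)
      (g := fun x => D.cutoff m x * (jump N u m x - J)) (continuousOn_const.mul hχc) (hχc.mul hd)]
    congr 1
    funext x; ring
  have h2 : |N.lineInt m fun x => D.cutoff m x * (jump N u m x - J)| ≤ N.length m * B := by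
    rw [N.lineInt_eq, abs_mul, abs_of_pos hl]
    refine mul_le_mul_of_nonneg_left (le_trans ?_ hB) hl.le
    refine (intervalIntegral.abs_integral_le_integral_abs zero_le_one).trans ?_
    refine intervalIntegral.integral_mono_on zero_le_one
      (N.intervalIntegrable_comp_point (hχc.mul hd)).abs
      (N.intervalIntegrable_comp_point hd).abs fun s hs => ?_
    have h3 := hR.cutoff_mem (N.point_mem (m := m) hs)
    rw [abs_mul, abs_of_nonneg h3.1]
    exact mul_le_of_le_one_left (abs_nonneg _) h3.2
  have h3 := hR.length_div_two_le m
  set X := N.lineInt m fun x => D.cutoff m x * (jump N u m x - J)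
  have h4 : J ^ 2 * (N.length m / 2) ≤ J ^ 2 * N.lineInt m (D.cutoff m) :=
    mul_le_mul_of_nonneg_left h3 (sq_nonneg _)
  have h5 : -(|J| * (N.length m * B)) ≤ J * X := by
    have : |J * X| ≤ |J| * (N.length m * B) := by
      rw [abs_mul]; exact mul_le_mul_of_nonneg_left h2 (abs_nonneg _)
    linarith [neg_abs_le (J * X)]
  -- Half of the main term `J² / 2` is spent on the product `|J| B`.
  have h6 : N.length m * (|J| * B) ≤ N.length m * (J ^ 2 / 4 + B ^ 2) := by
    refine mul_le_mul_of_nonneg_left ?_ hl.le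
    nlinarith [sq_nonneg (|J| / 2 - B), sq_abs J]
  rw [h1, mul_add]
  nlinarith

/-! ### The test multiplier -/

variable (D) in
/-- The multiplier that tests the mean jumps of `u`. -/
noncomputable def jumpMultiplier (u : Fin L → Plane → ℝ) (i : Fin L) (m : Fin M) (x : Space3) : ℝ :=
  (if N.fst m = i then meanJump N u m else -meanJump N u m) * D.cutoff m x

theorem IsRegular.traceSpace_jumpMultiplier (hR : D.IsRegular σ) (u : Fin L → Plane → ℝ)
    (i : Fin L) (m : Fin M) : D.TraceSpace m (D.jumpMultiplier u i m) :=
  (hR.traceSpace_cutoff m).const_mul _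

theorem jumpMultiplier_fst (u : Fin L → Plane → ℝ) (m : Fin M) (x : Space3) :
    D.jumpMultiplier u (N.fst m) m x = meanJump N u m * D.cutoff m x := by
  rw [jumpMultiplier, if_pos rfl]

theorem jumpMultiplier_snd (u : Fin L → Plane → ℝ) (m : Fin M) (x : Space3) :
    D.jumpMultiplier u (N.snd m) m x = -(meanJump N u m * D.cutoff m x) := by
  rw [jumpMultiplier, if_neg (N.fst_lt_snd m).ne, neg_mul]

theorem IsRegular.jumpMultiplier_sq_le (hR : D.IsRegular σ) (u : Fin L → Plane → ℝ) (i : Fin L)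
    {x : Space3} (hx : x ∈ N.trace m) : D.jumpMultiplier u i m x ^ 2 ≤ meanJump N u m ^ 2 := by
  have h := hR.cutoff_mem hx
  have h1 : D.cutoff m x ^ 2 ≤ 1 := pow_le_one₀ h.1 h.2
  have h2 : (if N.fst m = i then meanJump N u m else -meanJump N u m) ^ 2 = meanJump N u m ^ 2 := by
    split_ifs <;> ring
  rw [jumpMultiplier, mul_pow, h2]
  exact mul_le_of_le_one_right (sq_nonneg _) h1

theorem lineInt_const (N : DFN L M) (m : Fin M) (c : ℝ) :
    N.lineInt m (fun _ => c) = N.length m * c := by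
  rw [N.lineInt_eq]; simp

theorem IsRegular.sum_lineInt_jumpMultiplier_sq_le (hR : D.IsRegular σ) (u : Fin L → Plane → ℝ) :
    ∑ i, ∑ m ∈ N.traces i, N.lineInt m (fun x => D.jumpMultiplier u i m x ^ 2) ≤
      2 * ∑ m, N.length m * meanJump N u m ^ 2 := by
  have h : ∀ i m, N.lineInt m (fun x => D.jumpMultiplier u i m x ^ 2) ≤
      N.length m * meanJump N u m ^ 2 := by
    intro i m
    rw [← lineInt_const]
    exact N.lineInt_mono ((hR.traceSpace_jumpMultiplier u i m).1.pow 2) continuousOn_const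
      fun x hx => hR.jumpMultiplier_sq_le u i hx
  rw [N.sum_traces fun i m => N.lineInt m fun x => D.jumpMultiplier u i m x ^ 2, Finset.mul_sum]
  exact Finset.sum_le_sum fun m _ => by linarith [h (N.fst m) m, h (N.snd m) m]

variable (D) in
-- The contributions of the two fractures of a trace have opposite signs and cancel against a
-- single-valued `ψ`. Therefore adding the test multiplier does not leave the kernel.
theorem sum_lineInt_jumpMultiplier_mul (u : Fin L → Plane → ℝ) (ψ : Fin M → Space3 → ℝ) :
    ∑ i, ∑ m ∈ N.traces i, N.lineInt m (fun x => D.jumpMultiplier u i m x * ψ m x) = 0 := by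
  rw [N.sum_traces fun i m => N.lineInt m fun x => D.jumpMultiplier u i m x * ψ m x]
  refine Finset.sum_eq_zero fun m _ => ?_
  simp only [jumpMultiplier_fst, jumpMultiplier_snd, neg_mul]
  simp only [neg_eq_neg_one_mul (meanJump N u m * D.cutoff m _ * ψ m _), N.lineInt_const_mul]
  ring

theorem IsRegular.sum_pairB_jumpMultiplier (hR : D.IsRegular σ) {u : Fin L → Plane → ℝ}
    (hu : D.InV u) : ∑ i, pairB N i (D.jumpMultiplier u i) (u i) =
      ∑ m, meanJump N u m * N.lineInt m fun x => D.cutoff m x * jump N u m x := by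
  unfold pairB
  rw [N.sum_traces fun i m => N.lineInt m fun x => D.jumpMultiplier u i m x * N.onSpace i (u i) x]
  refine Finset.sum_congr rfl fun m _ => ?_
  have h : ∀ i, m ∈ N.traces i → ContinuousOn (fun x => D.jumpMultiplier u i m x *
      N.onSpace i (u i) x) (N.trace m) := fun i hm =>
    (hR.traceSpace_jumpMultiplier u i m).1.mul (N.continuousOn_onSpace hm (hu i).1.1)
  rw [← N.lineInt_add (h _ (N.fst_mem m)) (h _ (N.snd_mem m)), ← N.lineInt_const_mul]
  congr 1
  funext x
  rw [jumpMultiplier_fst, jumpMultiplier_snd, jump]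
  ring

/-! ### Estimates of the stabilization -/

/-- Here `ρ`, `l`, `y` stand for the representative of the diffusion form, the multiplier and the
added test multiplier. The products of `l` with `(1 + t) ρ` and with `y` cost `l² / 4` each by
Young's inequality, which leaves half of `l²`. -/
theorem stab_pointwise (t ρ l y : ℝ) :
    l ^ 2 / 2 - (|t| + (1 + t) ^ 2 + 1) * ρ ^ 2 - 2 * y ^ 2 ≤ (ρ - l) * (t * ρ - (l + y)) := by
  have h1 : -(|t| * ρ ^ 2) ≤ t * ρ ^ 2 := by
    nlinarith [neg_abs_le t, sq_nonneg ρ]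
  nlinarith [sq_nonneg ((1 + t) * ρ - l / 2), sq_nonneg (ρ - y), sq_nonneg (l / 2 + y),
    sq_nonneg ρ, sq_nonneg y]

/-- The stabilization controls the multipliers. -/
theorem IsRegular.le_stabLocal (hR : D.IsRegular σ) (hm : m ∈ N.traces i) {u : Plane → ℝ}
    (hu : BoundedGradient (N.poly i) u) {lam ξ : Fin M → Space3 → ℝ}
    (hl : D.TraceSpace m (lam m)) (hξ : D.TraceSpace m (ξ m)) (t : ℝ) :
    D.δ * N.lineInt m (fun x => lam m x ^ 2) / 2 - (|t| + (1 + t) ^ 2 + 1) *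
      (12 * volume.real (Metric.ball (0 : Plane) 1) * σ ^ 6 * (∑ a, ∑ b, |N.tensor i a b|) ^ 2 *
        semiSq N i u) - 2 * (D.δ * N.lineInt m fun x => ξ m x ^ 2) ≤
      D.stabLocal i m (fun w => formA N i u w - pairB N i lam w)
        (fun w => t * formA N i u w - pairB N i (fun m x => lam m x + ξ m x) w) := by
  have hδ := hR.δ_pos
  rw [stabLocal_eq hR hm]
  set ρ := D.comb i m (D.rieszCoeff i m (formA N i u)) with hρ
  have hρc : ContinuousOn ρ (N.trace m) := hR.continuousOn_comb hm _
  have hmu : D.TraceSpace m ((fun m x => lam m x + ξ m x) m) := hl.add hξ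
  have e1 : ∀ x ∈ N.trace m, D.comb i m (D.rieszCoeff i m fun w => formA N i u w -
      pairB N i lam w) x = ρ x - lam m x := by
    intro x hx
    have h := comb_rieszCoeff_add (D := D) (i := i) (m := m) (formA N i u) (pairB N i lam) 1 (-1) x
    rw [comb_rieszCoeff_pairB hR hm hl hx] at h
    simp only [one_mul, neg_mul, ← sub_eq_add_neg] at h
    exact h
  have e2 : ∀ x ∈ N.trace m, D.comb i m (D.rieszCoeff i m fun w => t * formA N i u w -
      pairB N i (fun m x => lam m x + ξ m x) w) x = t * ρ x - (lam m x + ξ m x) := by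
    intro x hx
    have h := comb_rieszCoeff_add (D := D) (i := i) (m := m) (formA N i u)
      (pairB N i fun m x => lam m x + ξ m x) t (-1) x
    rw [comb_rieszCoeff_pairB hR hm hmu hx] at h
    simp only [one_mul, neg_mul, ← sub_eq_add_neg] at h
    exact h
  have e3 : N.lineInt m (fun x =>
      D.comb i m (D.rieszCoeff i m fun w => formA N i u w - pairB N i lam w) x *
      D.comb i m (D.rieszCoeff i m fun w => t * formA N i u w -
        pairB N i (fun m x => lam m x + ξ m x) w) x) =
      N.lineInt m (fun x => (ρ x - lam m x) * (t * ρ x - (lam m x + ξ m x))) :=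
    N.lineInt_congr fun x hx => by simp only [e1 x hx, e2 x hx]
  rw [e3]
  have c1 : ContinuousOn (fun x => 1 / 2 * lam m x ^ 2) (N.trace m) :=
    continuousOn_const.mul (hl.1.pow 2)
  have c2 : ContinuousOn (fun x => (|t| + (1 + t) ^ 2 + 1) * ρ x ^ 2) (N.trace m) :=
    continuousOn_const.mul (hρc.pow 2)
  have c3 : ContinuousOn (fun x => 2 * ξ m x ^ 2) (N.trace m) :=
    continuousOn_const.mul (hξ.1.pow 2)
  have h1 : N.lineInt m (fun x => 1 / 2 * lam m x ^ 2 - (|t| + (1 + t) ^ 2 + 1) * ρ x ^ 2 -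
      2 * ξ m x ^ 2) ≤ N.lineInt m fun x => (ρ x - lam m x) * (t * ρ x - (lam m x + ξ m x)) := by
    refine N.lineInt_mono ((c1.sub c2).sub c3)
      ((hρc.sub hl.1).mul ((continuousOn_const.mul hρc).sub (hl.1.add hξ.1))) fun x _ => ?_
    have := stab_pointwise t (ρ x) (lam m x) (ξ m x)
    linarith
  rw [N.lineInt_sub (f := fun x => 1 / 2 * lam m x ^ 2 - (|t| + (1 + t) ^ 2 + 1) * ρ x ^ 2)
    (c1.sub c2) c3, N.lineInt_sub c1 c2, N.lineInt_const_mul, N.lineInt_const_mul,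
    N.lineInt_const_mul] at h1
  have h2 := mul_le_mul_of_nonneg_left h1 hδ.le
  have h3 := delta_lineInt_riesz_formA_le hR hm hu
  have h4 : 0 ≤ |t| + (1 + t) ^ 2 + 1 := by positivity
  have h5 := mul_le_mul_of_nonneg_left h3 h4
  linarith

/-! ### Stability -/

theorem IsRegular.deltaF_pos (hR : D.IsRegular σ) (i : Fin L) : 0 < D.δF i :=
  pos_of_mul_pos_right (hR.δ_pos.trans_le (hR.comparable i).2) (hR.sigma_pos i).le

theorem IsRegular.deltaF_le (hR : D.IsRegular σ) (i : Fin L) :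
    D.δF i ≤ σ * Metric.diam (N.poly i) := by
  have hσ := hR.sigma_pos i
  obtain ⟨T, hT, hcard⟩ := D.exists_triangle i
  refine (hR.quasiUniform i T hT hcard).2.trans (mul_le_mul_of_nonneg_left ?_ hσ.le)
  refine Metric.diam_mono ?_ (N.isPolygon i).isCompact.isBounded
  rw [← D.mesh_space i]
  exact Geometry.SimplicialComplex.convexHull_subset_space hT

theorem normV_sq (u : Fin L → Plane → ℝ) : normV N u ^ 2 =
    ∑ i, semiSq N i (u i) + ∑ m, N.length m * meanJump N u m ^ 2 :=
  Real.sq_sqrt (add_nonneg (Finset.sum_nonneg fun _ _ => semiSq_nonneg _)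
    (Finset.sum_nonneg fun _ _ => mul_nonneg N.length_pos.le (sq_nonneg _)))

theorem IsRegular.normΛ_sq (hR : D.IsRegular σ) (lam : Fin L → Fin M → Space3 → ℝ) :
    D.normΛ lam ^ 2 =
      ∑ i, D.δF i * ∑ m ∈ N.traces i, N.lineInt m fun x => lam i m x ^ 2 :=
  Real.sq_sqrt (Finset.sum_nonneg fun i _ => mul_nonneg (hR.deltaF_pos i).le
    (Finset.sum_nonneg fun _ _ => N.lineInt_nonneg fun _ _ => sq_nonneg _))

/-- The norm of the test multiplier. -/
theorem IsRegular.normΛ_add_le (hR : D.IsRegular σ) {B : ℝ} (hB0 : 0 ≤ B)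
    (hB : ∀ i, D.δF i ≤ B) (u : Fin L → Plane → ℝ) {lam : Fin L → Fin M → Space3 → ℝ}
    (hl : D.InΛ lam) {κ : ℝ} (hκ : κ ^ 2 ≤ 1) :
    D.normΛ (fun i m x => lam i m x + κ * D.jumpMultiplier u i m x) ≤
      √(2 + 4 * B) * (normV N u + D.normΛ lam) := by
  have hV : 0 ≤ normV N u := Real.sqrt_nonneg _
  have hΛ : 0 ≤ D.normΛ lam := Real.sqrt_nonneg _
  -- The squared norm is at most `2 ‖lam‖² + 4 B J`: one factor 2 comes from the square of a sum,
  -- another in the second term from the two fractures at each trace.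
  refine (le_abs_self _).trans (abs_le_of_sq_le_sq ?_ (by positivity))
  rw [mul_pow, Real.sq_sqrt (by positivity)]
  set J := ∑ m, N.length m * meanJump N u m ^ 2 with hJ
  have hJ0 : 0 ≤ J := Finset.sum_nonneg fun _ _ => mul_nonneg N.length_pos.le (sq_nonneg _)
  have hJV : J ≤ normV N u ^ 2 := by
    rw [normV_sq]
    have := Finset.sum_nonneg fun i (_ : i ∈ Finset.univ) => semiSq_nonneg (N := N) (i := i) (u i)
    linarith
  have h1 : ∀ i, D.δF i * ∑ m ∈ N.traces i, N.lineInt m (fun x =>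
      (lam i m x + κ * D.jumpMultiplier u i m x) ^ 2) ≤
      2 * (D.δF i * ∑ m ∈ N.traces i, N.lineInt m fun x => lam i m x ^ 2) +
      2 * B * ∑ m ∈ N.traces i, N.lineInt m fun x => D.jumpMultiplier u i m x ^ 2 := by
    intro i
    have h2 : ∑ m ∈ N.traces i, N.lineInt m (fun x =>
        (lam i m x + κ * D.jumpMultiplier u i m x) ^ 2) ≤
        2 * (∑ m ∈ N.traces i, N.lineInt m fun x => lam i m x ^ 2) +
        2 * ∑ m ∈ N.traces i, N.lineInt m fun x => D.jumpMultiplier u i m x ^ 2 := by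
      rw [Finset.mul_sum, Finset.mul_sum, ← Finset.sum_add_distrib]
      refine Finset.sum_le_sum fun m hm => ?_
      have c1 := (hl i m hm).1
      have c2 := (hR.traceSpace_jumpMultiplier u i m).1
      rw [← N.lineInt_const_mul, ← N.lineInt_const_mul,
        ← N.lineInt_add (f := fun x => 2 * lam i m x ^ 2)
          (g := fun x => 2 * D.jumpMultiplier u i m x ^ 2)
          (continuousOn_const.mul (c1.pow 2)) (continuousOn_const.mul (c2.pow 2))]
      refine N.lineInt_mono ((c1.add (continuousOn_const.mul c2)).pow 2)
        ((continuousOn_const.mul (c1.pow 2)).add (continuousOn_const.mul (c2.pow 2)))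
        fun x _ => ?_
      set p := lam i m x
      set q := D.jumpMultiplier u i m x
      have h3 : κ ^ 2 * q ^ 2 ≤ 1 * q ^ 2 := mul_le_mul_of_nonneg_right hκ (sq_nonneg q)
      nlinarith [sq_nonneg (p - κ * q)]
    have h4 : 0 ≤ ∑ m ∈ N.traces i, N.lineInt m fun x => D.jumpMultiplier u i m x ^ 2 :=
      Finset.sum_nonneg fun _ _ => N.lineInt_nonneg fun _ _ => sq_nonneg _
    have h5 := mul_le_mul_of_nonneg_left h2 (hR.deltaF_pos i).le
    have h6 := mul_le_mul_of_nonneg_right (hB i) h4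
    linarith
  have h2 := Finset.sum_le_sum fun i (_ : i ∈ Finset.univ) => h1 i
  rw [Finset.sum_add_distrib, ← Finset.mul_sum, ← Finset.mul_sum, ← hR.normΛ_sq,
    ← hR.normΛ_sq] at h2
  have h3 := hR.sum_lineInt_jumpMultiplier_sq_le u
  have h4 := mul_le_mul_of_nonneg_left h3 (mul_nonneg zero_le_two hB0)
  rw [← hJ] at h4
  have h5 : 4 * B * J ≤ 4 * B * normV N u ^ 2 := mul_le_mul_of_nonneg_left hJV (by positivity)
  nlinarith [mul_nonneg hV hΛ, mul_nonneg (mul_nonneg hB0 hV) hΛ, mul_nonneg hB0 (sq_nonneg (D.normΛ lam)),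
    sq_nonneg (normV N u)]

theorem pairB_add_const_mul {lam ξ : Fin M → Space3 → ℝ} {v : Plane → ℝ}
    (hl : ∀ m ∈ N.traces i, ContinuousOn (lam m) (N.trace m))
    (hξ : ∀ m ∈ N.traces i, ContinuousOn (ξ m) (N.trace m)) (hv : ContinuousOn v (N.poly i))
    (κ : ℝ) : pairB N i (fun m x => lam m x + κ * ξ m x) v =
      pairB N i lam v + κ * pairB N i ξ v := by
  unfold pairB
  rw [Finset.mul_sum, ← Finset.sum_add_distrib]
  refine Finset.sum_congr rfl fun m hm => ?_
  have c := N.continuousOn_onSpace hm hv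
  rw [← N.lineInt_const_mul, ← N.lineInt_add (f := fun x => lam m x * N.onSpace i v x)
    (g := fun x => κ * (ξ m x * N.onSpace i v x)) ((hl m hm).mul c)
    (continuousOn_const.mul ((hξ m hm).mul c))]
  congr 1
  funext x; ring

/-- The stabilization with the test multiplier added to the trial multiplier. -/
theorem IsRegular.le_sum_stab (hR : D.IsRegular σ) {B CR κ : ℝ} (hB0 : 0 ≤ B)
    (hB : Fin L → D.δ ≤ B) (hCR0 : 0 ≤ CR)
    (hCR : ∀ i, 12 * volume.real (Metric.ball (0 : Plane) 1) * σ ^ 6 *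
      (∑ a, ∑ b, |N.tensor i a b|) ^ 2 ≤ CR)
    {u : Fin L → Plane → ℝ} (hu : D.InV u) {lam : Fin L → Fin M → Space3 → ℝ} (hl : D.InΛ lam)
    (hκ : κ ^ 2 ≤ 1) (t : ℝ) :
    (∑ i, ∑ m ∈ N.traces i, D.δ * N.lineInt m (fun x => lam i m x ^ 2)) / 2 -
      (|t| + (1 + t) ^ 2 + 1) * (M * CR) * ∑ i, semiSq N i (u i) -
      4 * B * ∑ m, N.length m * meanJump N u m ^ 2 ≤
    ∑ i, D.stab i (fun w => formA N i (u i) w - pairB N i (lam i) w)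
      (fun w => t * formA N i (u i) w -
        pairB N i (fun m x => lam i m x + κ * D.jumpMultiplier u i m x) w) := by
  have hξ : ∀ i m, D.TraceSpace m (D.jumpMultiplier u i m) := hR.traceSpace_jumpMultiplier u
  have hbg := D.boundedGradient hu
  set τ := |t| + (1 + t) ^ 2 + 1 with hτ
  have hτ0 : 0 ≤ τ := by positivity
  set X : Fin L → Fin M → ℝ := fun i m => N.lineInt m fun x => D.jumpMultiplier u i m x ^ 2
    with hX
  have h1 : ∀ i, ∀ m ∈ N.traces i, D.δ * N.lineInt m (fun x => lam i m x ^ 2) / 2 -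
      τ * (CR * semiSq N i (u i)) - 2 * B * X i m ≤ D.stabLocal i m
      (fun w => formA N i (u i) w - pairB N i (lam i) w) (fun w => t * formA N i (u i) w -
        pairB N i (fun m x => lam i m x + κ * D.jumpMultiplier u i m x) w) := by
    intro i m hm
    refine le_trans ?_ (hR.le_stabLocal hm (hbg i) (ξ := fun m x => κ * D.jumpMultiplier u i m x)
      (hl i m hm) ((hξ i m).const_mul κ) t)
    have h2 := mul_le_mul_of_nonneg_left
      (mul_le_mul_of_nonneg_right (hCR i) (semiSq_nonneg (N := N) (i := i) (u i))) hτ0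
    have h3 : N.lineInt m (fun x => (κ * D.jumpMultiplier u i m x) ^ 2) = κ ^ 2 * X i m := by
      rw [hX, ← N.lineInt_const_mul]
      congr 1
      funext x; ring
    have hX0 : 0 ≤ X i m := N.lineInt_nonneg fun _ _ => sq_nonneg _
    -- `hB` takes a fracture as argument, because without fractures nothing bounds the mesh size.
    have h4 : D.δ * (κ ^ 2 * X i m) ≤ B * (1 * X i m) :=
      mul_le_mul (hB i) (mul_le_mul_of_nonneg_right hκ hX0) (by positivity) hB0
    rw [h3]
    linarith
  have h2 := Finset.sum_le_sum fun i (_ : i ∈ Finset.univ) => Finset.sum_le_sum (h1 i)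
  refine le_trans ?_ h2
  simp only [Finset.sum_sub_distrib, ← Finset.sum_div, Finset.sum_const, nsmul_eq_mul]
  have h3 : ∑ i, ∑ m ∈ N.traces i, X i m ≤ 2 * ∑ m, N.length m * meanJump N u m ^ 2 :=
    hR.sum_lineInt_jumpMultiplier_sq_le u
  have h4 : ∑ i, (N.traces i).card * (τ * (CR * semiSq N i (u i))) ≤
      τ * (M * CR) * ∑ i, semiSq N i (u i) := by
    rw [Finset.mul_sum]
    refine Finset.sum_le_sum fun i _ => ?_
    have h5 : ((N.traces i).card : ℝ) ≤ M := by
      have := Finset.card_le_univ (N.traces i)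
      rw [Fintype.card_fin] at this
      exact_mod_cast this
    have := mul_le_mul_of_nonneg_right h5
      (mul_nonneg hτ0 (mul_nonneg hCR0 (semiSq_nonneg (N := N) (i := i) (u i))))
    linarith
  have h5 := mul_le_mul_of_nonneg_left h3 (mul_nonneg zero_le_two hB0)
  have h6 : ∑ i, ∑ m ∈ N.traces i, 2 * B * X i m = 2 * B * ∑ i, ∑ m ∈ N.traces i, X i m := by
    simp only [Finset.mul_sum]
  rw [h6]
  linarith

end Discretization

/-! ### The choice of the constants and the final estimate. -/

open Discretization

set_option maxHeartbeats 1000000 in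
theorem mainTheorem4 {L M : ℕ} (N : DFN L M) (t σ : ℝ) :
    ∃ α₀ C c : ℝ, 0 < α₀ ∧ 0 < C ∧ 0 < c ∧
      ∀ D : Discretization N, D.IsRegular σ → ∀ α : ℝ, 0 < α → α < α₀ →
        ∀ u lam, D.InV u → D.InΛ lam →
          ∃ mu, D.InΛ mu ∧ (D.InKerB lam → D.InKerB mu) ∧
            D.normΛ mu ≤ C * (Discretization.normV N u + D.normΛ lam) ∧
            c * ((Discretization.normV N u) ^ 2 + α * (D.normΛ lam) ^ 2)
              ≤ D.form α t u lam u mu := by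
  obtain ⟨B, hB0, hB⟩ := exists_nonneg_forall_ge fun i : Fin L => σ * Metric.diam (N.poly i)
  obtain ⟨B', hB0', hB'⟩ := exists_nonneg_forall_ge fun i : Fin L => σ ^ 2 * Metric.diam (N.poly i)
  obtain ⟨cA, hcA, hcA'⟩ := exists_pos_forall_le fun i => tensor_const_pos N i
  obtain ⟨CJ, hCJ, hjump⟩ := exists_jump_bound N
  obtain ⟨CR, hCR0, hCR⟩ := exists_nonneg_forall_ge fun i : Fin L =>
    12 * volume.real (Metric.ball (0 : Plane) 1) * σ ^ 6 * (∑ a, ∑ b, |N.tensor i a b|) ^ 2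
  set τ := |t| + (1 + t) ^ 2 + 1 with hτ
  have hτ0 : 0 ≤ τ := by positivity
  set C₂ := (∑ m, N.length m) * CJ ^ 2 with hC₂
  have hC₂0 : 0 ≤ C₂ := mul_nonneg (Finset.sum_nonneg fun m _ => N.length_pos.le) (sq_nonneg _)
  -- Small enough that the oscillation of the jumps costs at most a quarter of the coercivity. The
  -- summand `cA` keeps the denominator positive and `κ` at most 1.
  set κ := cA / (4 * (C₂ + cA)) with hκ
  have hκ0 : 0 < κ := by positivity
  have hκ1 : κ ≤ 1 := by rw [hκ, div_le_one (by positivity)]; linarith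
  have hκC : κ * C₂ ≤ cA / 4 := by
    rw [hκ, div_mul_eq_mul_div, div_le_div_iff₀ (by positivity) (by norm_num)]
    nlinarith [mul_nonneg hcA.le hcA.le]
  set Ca := τ * (M * CR) with hCa
  have hCa0 : 0 ≤ Ca := by positivity
  set Cb := 4 * B' with hCb
  have hCb0 : 0 ≤ Cb := by positivity
  -- The two bounds on `α` let the stabilization consume at most another quarter of the diffusion
  -- energy and half of the jump term `κ J / 4`. In the last constant, `|σ| + 1` passes from the
  -- fracture mesh sizes to `δ`; the absolute value is there because `σ` is arbitrary at this point.
  refine ⟨min (cA / (4 * (Ca + 1))) (κ / (8 * (Cb + 1))), √(2 + 4 * B),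
    min (min (cA / 2) (κ / 8)) (1 / (2 * (|σ| + 1))), by positivity, by positivity, by positivity,
    ?_⟩
  intro D hR α hα0 hα u lam hu hl
  have hξ : ∀ i m, D.TraceSpace m (D.jumpMultiplier u i m) := hR.traceSpace_jumpMultiplier u
  refine ⟨fun i m x => lam i m x + κ * D.jumpMultiplier u i m x,
    fun i m hm => (hl i m hm).add ((hξ i m).const_mul κ), fun hker ψ hψ => ?_,
    hR.normΛ_add_le hB0 (fun i => (hR.deltaF_le i).trans (hB i)) u hl (by nlinarith), ?_⟩
  · have h1 := hker ψ hψ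
    have h2 := D.sum_lineInt_jumpMultiplier_mul u ψ
    have h3 : ∀ i, ∀ m ∈ N.traces i, N.lineInt m (fun x =>
        (lam i m x + κ * D.jumpMultiplier u i m x) * ψ m x) =
        N.lineInt m (fun x => lam i m x * ψ m x) +
        κ * N.lineInt m (fun x => D.jumpMultiplier u i m x * ψ m x) := by
      intro i m hm
      rw [← N.lineInt_const_mul, ← N.lineInt_add (f := fun x => lam i m x * ψ m x)
        (g := fun x => κ * (D.jumpMultiplier u i m x * ψ m x)) ((hl i m hm).1.mul (hψ m).1)
        (continuousOn_const.mul ((hξ i m).1.mul (hψ m).1))]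
      congr 1
      funext x; ring
    rw [Finset.sum_congr rfl fun i _ => Finset.sum_congr rfl (h3 i)]
    simp only [Finset.sum_add_distrib, ← Finset.mul_sum]
    rw [h1, h2, mul_zero, add_zero]
  set E := ∑ i, semiSq N i (u i) with hE
  set J := ∑ m, N.length m * meanJump N u m ^ 2 with hJ
  set Λ := ∑ i, ∑ m ∈ N.traces i, D.δ * N.lineInt m (fun x => lam i m x ^ 2) with hΛ
  have hE0 : 0 ≤ E := Finset.sum_nonneg fun i _ => semiSq_nonneg _
  have hJ0 : 0 ≤ J := Finset.sum_nonneg fun m _ => mul_nonneg N.length_pos.le (sq_nonneg _)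
  have hΛ0 : 0 ≤ Λ := Finset.sum_nonneg fun i _ => Finset.sum_nonneg fun m _ =>
    mul_nonneg hR.δ_pos.le (N.lineInt_nonneg fun _ _ => sq_nonneg _)
  have hbg := D.boundedGradient hu
  have hA : cA * E ≤ ∑ i, formA N i (u i) (u i) := by
    rw [hE, Finset.mul_sum]
    exact Finset.sum_le_sum fun i _ => (mul_le_mul_of_nonneg_right (hcA' i)
      (semiSq_nonneg _)).trans (le_formA_self (hbg i))
  have hBB : ∑ i, pairB N i (fun m x => lam i m x + κ * D.jumpMultiplier u i m x) (u i) =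
      ∑ i, pairB N i (lam i) (u i) + κ * ∑ i, pairB N i (D.jumpMultiplier u i) (u i) := by
    rw [Finset.mul_sum, ← Finset.sum_add_distrib]
    exact Finset.sum_congr rfl fun i _ => pairB_add_const_mul (fun m hm => (hl i m hm).1)
      (fun m _ => (hξ i m).1) (hu i).1.1 κ
  have hBJ : J / 4 - C₂ * E ≤ ∑ i, pairB N i (D.jumpMultiplier u i) (u i) := by
    rw [hR.sum_pairB_jumpMultiplier hu]
    have h1 := Finset.sum_le_sum fun m (_ : m ∈ Finset.univ) =>
      hR.meanJump_mul_lineInt hu m (hjump D u hu m)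
    refine le_trans (le_of_eq ?_) h1
    rw [hJ, hC₂, Finset.sum_div, Finset.sum_mul, Finset.sum_mul, ← Finset.sum_sub_distrib]
    refine Finset.sum_congr rfl fun m _ => ?_
    rw [mul_pow, Real.sq_sqrt hE0]
    ring
  have hS : Λ / 2 - Ca * E - Cb * J ≤ _ :=
    hR.le_sum_stab hB0' (fun i => (hR.delta_le i).trans (hB' i)) hCR0 hCR hu hl
      (by nlinarith : κ ^ 2 ≤ 1) t
  have hΛn : D.normΛ lam ^ 2 ≤ (|σ| + 1) * Λ := by
    rw [hR.normΛ_sq, hΛ, Finset.mul_sum]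
    refine Finset.sum_le_sum fun i _ => ?_
    rw [← Finset.mul_sum, ← mul_assoc]
    refine mul_le_mul_of_nonneg_right ?_
      (Finset.sum_nonneg fun _ _ => N.lineInt_nonneg fun _ _ => sq_nonneg _)
    refine (hR.comparable i).1.trans (mul_le_mul_of_nonneg_right ?_ hR.δ_pos.le)
    linarith [le_abs_self σ]
  have hα1 : α * Ca ≤ cA / 4 := by
    have h1 := (hα.trans_le (min_le_left _ _)).le
    rw [le_div_iff₀ (by positivity)] at h1
    nlinarith
  have hα2 : α * Cb ≤ κ / 8 := by
    have h1 := (hα.trans_le (min_le_right _ _)).le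
    rw [le_div_iff₀ (by positivity)] at h1
    nlinarith
  -- The pairings of `lam` with `u` cancel here. The gradient terms leave `cA - cA/4 - cA/4`, and
  -- the jump terms leave `κ/4 - κ/8`.
  have hform : cA / 2 * E + κ / 8 * J + α * (Λ / 2) ≤ D.form α t u lam u
      fun i m x => lam i m x + κ * D.jumpMultiplier u i m x := by
    rw [form, hBB]
    have h1 := mul_le_mul_of_nonneg_left hBJ hκ0.le
    have h2 := mul_le_mul_of_nonneg_left hS hα0.le
    have h3 := mul_le_mul_of_nonneg_right hα1 hE0
    have h4 := mul_le_mul_of_nonneg_right hα2 hJ0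
    have h5 := mul_le_mul_of_nonneg_right hκC hE0
    linarith
  refine le_trans ?_ hform
  rw [normV_sq]
  set c := min (min (cA / 2) (κ / 8)) (1 / (2 * (|σ| + 1)))
  have hc1 : c ≤ cA / 2 := (min_le_left _ _).trans (min_le_left _ _)
  have hc2 : c ≤ κ / 8 := (min_le_left _ _).trans (min_le_right _ _)
  have hc3 : c * (|σ| + 1) ≤ 1 / 2 := by
    have h1 : c ≤ 1 / (2 * (|σ| + 1)) := min_le_right _ _
    have h2 : 0 < |σ| + 1 := by positivity
    rw [le_div_iff₀ (by positivity)] at h1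
    linarith
  have hc0 : 0 ≤ c := by positivity
  have h1 := mul_le_mul_of_nonneg_right hc1 hE0
  have h2 := mul_le_mul_of_nonneg_right hc2 hJ0
  have h3 := mul_le_mul_of_nonneg_left hΛn hc0
  have h4 := mul_le_mul_of_nonneg_right hc3 hΛ0
  have h5 : α * (c * D.normΛ lam ^ 2) ≤ α * (Λ / 2) :=
    mul_le_mul_of_nonneg_left (by linarith) hα0.le
  linarith
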